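/- **Setting.** All systems are finite-dimensional. $\mathcal N_{A\to B}$ is a quantum channel, $\varepsilon\in[0,1]$, and $F(\rho,\sigma)=(\operatorname{Tr}\sqrt{\sqrt\sigma\rho\sqrt\sigma})^2$ is the fidelity. A one-way LOCC superchannel $\Theta$ acts on a channel $\mathcal N_{A\to B}$ as $\Theta(\mathcal N)=\sum_x \mathcal D^x\circ\mathcal N\circ\mathcal E^x$, where $\{\mathcal E^x\}_x$ is a quantum instrument of the sender with finitely many outcomes $x$ (sent over a public classical channel) and each $\mathcal D^x$ is a channel of the receiver. *Distillable key.* A private state holding $\log_2 k$ bits is $\gamma^k=V(\Phi^k_{A'B'}\otimes\tau_{A''B''})V^\dagger$, with $\Phi^k$ the maximally entangled state of Schmidt rank $k$, $\tau$ a state and $V=\sum_{i}|i\rangle\langle i|_{A'}\otimes I_{B'}\otimes U^i_{A''B''}$ with $U^i$ unitary. The one-shot, one-way distillable key $K_D^{\varepsilon,\to}(\mathcal N)$ is the supremum of $\log_2 k$ over $k\ge 1$, states $\psi_{A'A''\hat A}$, private states $\gamma^k_{A'A''B'B''}$ and one-way LOCC superchannels $\Theta_{(A\to B)\to(\hat A\to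 B'B'')}$ with $F\big((\Theta(\mathcal N))(\psi_{A'A''\hat A}),\gamma^k\big)\ge 1-\varepsilon$. *Private capacity.* The one-shot forward-assisted private capacity $P^{\varepsilon,\to}(\mathcal N)$ is the supremum of $\log_2|\mathcal X|$ over finite non-empty message sets $\mathcal X$ and one-way LOCC superchannels $\Theta_{(A\to B)\to(X\to\hat X)}$ with classical input $X$ and output $\hat X$ for which, with $\mathcal U_{A\to BE}$ an isometric extension of $\mathcal N$, $$\inf_{\sigma}\max_{x\in\mathcal X}\big(1-F(|x\rangle\langle x|_{\hat X}\otimes\sigma,\ \omega^x)\big)\le\varepsilon .$$ Here $\omega^x$ is the joint state, when the message $x$ is sent, of the receiver's output $\hat X$ and of the eavesdropper, who holds $E$ and a copy of the public classical message; the infimum is over all states $\sigma$ of the eavesdropper's systems. *Unextendible entanglement.* $D^\varepsilon_{\min}(\rho\|\sigma)=-\log_2\inf\{\operatorname{Tr}[\Lambda\sigma]:0\le\Lambda\le I,\ \operatorname{Tr}[\Lambda\rho]\ge1-\varepsilon\}$, and $$E^{u,\varepsilon}_{\min}(\mathcal N)=\tfrac12\inf_{\mathcal M}\sup_{\rho_{RA}}D^\varepsilon_{\min}\big(\mathcal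 N(\rho_{RA})\,\|\,\mathcal M(\rho_{RA})\big),\qquad J:=J^\varepsilon_{\min}(\mathcal N):=2^{-2E^{u,\varepsilon}_{\min}(\mathcal N)},$$ where the supremum is over all states on $A$ and a reference system $R$ of any finite dimension, and the infimum is over all $\mathcal M=\operatorname{Tr}_B\circ\mathcal P_{A\to BE}$ with $E\cong B$ and $\mathcal P$ a channel such that $\operatorname{Tr}_E\circ\mathcal P=\mathcal N$. **Theorem.** (i) $J$ is the optimal value (supremum) of the semidefinite program $$\sup\Big\{\mu(1-\varepsilon)-\lambda:\ \lambda,\mu\ge0,\ Y_{AB}\ge0,\ \Gamma_{ABE}\ge0,\ \mu\Gamma^{\mathcal N}_{AB}\le\operatorname{Tr}_B[\Gamma_{ABE}]+Y_{AB},\ \operatorname{Tr}_B[Y_{AB}]\le\lambda I_A,\ \operatorname{Tr}_E[\Gamma_{ABE}]=\Gamma^{\mathcal N}_{AB}\Big\},$$ where $\Gamma^{\mathcal N}_{AB}$ is the Choi operator of $\mathcal N$; hence the bound in (ii) is computable by a semidefinite program. (ii) If $J>\varepsilon$, then $$P^{\varepsilon,\to}(\mathcal N)=K_D^{\varepsilon,\to}(\mathcal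 N)\le\frac12\log_2\left[\left(\frac{\sqrt{J(1-J)}+\sqrt{\varepsilon(1-\varepsilon)}}{J-\varepsilon}\right)^2+1\right].$$ -/

import Mathlib

open scoped MatrixOrder Kronecker ComplexOrder

noncomputable section

namespace PrivateCapacity

/-! ## States, fidelity, channels

A finite-dimensional quantum system is indexed by a finite type `a`; the operators on it are the
matrices `Matrix a a ℂ`, a composite system is indexed by the product type. -/

/-- A quantum state: a positive semidefinite operator of unit trace. -/
def IsState {a : Type*} [Fintype a] (ρ : Matrix a a ℂ) : Prop :=
  ρ.PosSemidef ∧ ρ.trace = 1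

/-- The fidelity `F(ρ, σ) = (Tr √(√σ ρ √σ))²`. -/
def fidelity {a : Type*} [Fintype a] [DecidableEq a] (ρ σ : Matrix a a ℂ) : ℝ :=
  (CFC.sqrt (CFC.sqrt σ * ρ * CFC.sqrt σ)).trace.re ^ 2

/-- The partial trace over the second tensor factor. -/
def traceSnd {a b : Type*} [Fintype b] : Matrix (a × b) (a × b) ℂ →ₗ[ℂ] Matrix a a ℂ where
  toFun X := Matrix.of fun i i' => ∑ j, X (i, j) (i', j)
  map_add' X Y := by
    ext i i'
    simp [Finset.sum_add_distrib]
  map_smul' c X := by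
    ext i i'
    simp [Finset.mul_sum]

/-- The partial trace over the first tensor factor. -/
def traceFst {a b : Type*} [Fintype a] : Matrix (a × b) (a × b) ℂ →ₗ[ℂ] Matrix b b ℂ where
  toFun X := Matrix.of fun j j' => ∑ i, X (i, j) (i, j')
  map_add' X Y := by
    ext i i'
    simp [Finset.sum_add_distrib]
  map_smul' c X := by
    ext i i'
    simp [Finset.mul_sum]

/-- Linear maps from operators on `a` to operators on `b`. -/
abbrev OpMap (a b : Type*) := Matrix a a ℂ →ₗ[ℂ] Matrix b b ℂ

/-- `(id_r ⊗ Φ)(X)`: the map `Φ` acts on the second tensor factor. -/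
def actSnd {a b r : Type*} (Φ : OpMap a b) (X : Matrix (r × a) (r × a) ℂ) :
    Matrix (r × b) (r × b) ℂ :=
  Matrix.of fun p q => Φ (Matrix.of fun i i' => X (p.1, i) (q.1, i')) p.2 q.2

/-- `(Φ ⊗ id_e)(X)`: the map `Φ` acts on the first tensor factor. -/
def actFst {a b e : Type*} (Φ : OpMap a b) (X : Matrix (a × e) (a × e) ℂ) :
    Matrix (b × e) (b × e) ℂ :=
  Matrix.of fun p q => Φ (Matrix.of fun i i' => X (i, p.2) (i', q.2)) p.1 q.1

/-- Complete positivity. -/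
def IsCP {a b : Type*} (Φ : OpMap a b) : Prop :=
  ∀ (r : ℕ) (X : Matrix (Fin r × a) (Fin r × a) ℂ), X.PosSemidef → (actSnd Φ X).PosSemidef

/-- A quantum channel: a completely positive trace-preserving linear map. -/
def IsChannel {a b : Type*} [Fintype a] [Fintype b] (Φ : OpMap a b) : Prop :=
  IsCP Φ ∧ ∀ X, (Φ X).trace = X.trace

/-- `V : ℋ_a → ℋ_b ⊗ ℋ_e` is an isometric extension of the channel `N` with environment `e`. -/
def IsIsometricExtension {a b e : Type*} [Fintype a] [DecidableEq a] [Fintype b] [Fintype e]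
    (N : OpMap a b) (V : Matrix (b × e) a ℂ) : Prop :=
  V.conjTranspose * V = 1 ∧ ∀ X, N X = traceSnd (V * X * V.conjTranspose)

/-! ## One-way LOCC superchannels -/

/-- A one-way LOCC superchannel `(a → b) → (c → d)`: the sender applies the quantum instrument
`enc`, sends the outcome `x : Fin m` over a public classical channel and the quantum output through
the given channel, and the receiver applies the channel `dec x`. -/
structure OneWayLOCC (a b c d : Type*) [Fintype a] [Fintype b] [Fintype c] [Fintype d]
    (m : ℕ) where
  /-- the instrument of the sender -/
  enc : Fin m → OpMap c a
  /-- the decoding maps of the receiver -/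
  dec : Fin m → OpMap b d
  enc_cp : ∀ x, IsCP (enc x)
  enc_tp : ∀ X, (∑ x, (enc x X).trace) = X.trace
  dec_channel : ∀ x, IsChannel (dec x)

/-- The action `N ↦ ∑ x, dec x ∘ N ∘ enc x` of a one-way LOCC superchannel. -/
def OneWayLOCC.apply {a b c d : Type*} [Fintype a] [Fintype b] [Fintype c] [Fintype d] {m : ℕ}
    (Θ : OneWayLOCC a b c d m) (N : OpMap a b) : OpMap c d :=
  ∑ x, Θ.dec x ∘ₗ N ∘ₗ Θ.enc x

/-! ## Private states and one-shot, one-way distillable key -/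

/-- The maximally entangled state of Schmidt rank `k`. -/
def maxEntangled (k : ℕ) : Matrix (Fin k × Fin k) (Fin k × Fin k) ℂ :=
  Matrix.of fun p q => if p.1 = p.2 ∧ q.1 = q.2 then (1 / k : ℂ) else 0

/-- The twisting operator `∑ i, |i⟩⟨i| ⊗ I ⊗ U i` on (key systems) × (shield systems). -/
def twisting {k : ℕ} {s : Type*} (U : Fin k → Matrix s s ℂ) :
    Matrix ((Fin k × Fin k) × s) ((Fin k × Fin k) × s) ℂ :=
  Matrix.of fun p q => if p.1 = q.1 then U p.1.1 p.2 q.2 else 0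

/-- Bipartite private states holding `log₂ k` secret bits. The sender holds `(A', A'')` and the
receiver holds `(B', B'')`; the key systems `A'`, `B'` have dimension `k`, and the shield systems
`A''`, `B''` are indexed by `s`, `t`. -/
def IsPrivateState {k : ℕ} {s t : Type*} [Fintype s] [Fintype t] [DecidableEq s] [DecidableEq t]
    (γ : Matrix ((Fin k × s) × (Fin k × t)) ((Fin k × s) × (Fin k × t)) ℂ) : Prop :=
  ∃ (τ : Matrix (s × t) (s × t) ℂ) (U : Fin k → Matrix (s × t) (s × t) ℂ),
    IsState τ ∧ (∀ i, U i ∈ Matrix.unitaryGroup (s × t) ℂ) ∧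
    γ = Matrix.reindex (Equiv.prodProdProdComm (Fin k) (Fin k) s t)
          (Equiv.prodProdProdComm (Fin k) (Fin k) s t)
          (twisting U * (maxEntangled k ⊗ₖ τ) * (twisting U).conjTranspose)

/-- `log₂ k` secret key bits can be distilled from the channel `N` with error `ε` by a one-way LOCC
superchannel `Θ` acting on `N` and a locally prepared state `ψ` of the systems `A' A'' Â`. -/
def KeyAchievable {a b : Type*} [Fintype a] [Fintype b] (N : OpMap a b) (ε : ℝ) (k : ℕ) : Prop :=
  ∃ (s t c m : ℕ) (ψ : Matrix ((Fin k × Fin s) × Fin c) ((Fin k × Fin s) × Fin c) ℂ)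
    (Θ : OneWayLOCC a b (Fin c) (Fin k × Fin t) m)
    (γ : Matrix ((Fin k × Fin s) × (Fin k × Fin t)) ((Fin k × Fin s) × (Fin k × Fin t)) ℂ),
    IsState ψ ∧ IsPrivateState γ ∧ 1 - ε ≤ fidelity (actSnd (Θ.apply N) ψ) γ

/-- The one-shot, one-way distillable key of a channel. -/
def distillableKey {a b : Type*} [Fintype a] [Fintype b] (N : OpMap a b) (ε : ℝ) : EReal :=
  sSup {r : EReal | ∃ k : ℕ, 1 ≤ k ∧ KeyAchievable N ε k ∧ r = ((Real.logb 2 k : ℝ) : EReal)}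

/-! ## One-shot forward-assisted private capacity -/

/-- The superchannel has classical input and classical output: the encoder only sees the diagonal
of its input, and the output of the decoder is diagonal. -/
def OneWayLOCC.IsClassical {a b : Type*} [Fintype a] [Fintype b] {n m : ℕ}
    (Θ : OneWayLOCC a b (Fin n) (Fin n) m) : Prop :=
  (∀ l X, Θ.enc l X = Θ.enc l (Matrix.diagonal X.diag)) ∧
    ∀ l X, (Θ.dec l X).IsDiag

/-- The joint state of the receiver's output, the environment `e` of the channel and the
eavesdropper's copy of the public classical message `l : Fin m`, when the sender transmits `x`:
`∑ l, (dec l ⊗ id_e)(V (enc l |x⟩⟨x|) V†) ⊗ |l⟩⟨l|`. -/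
def receiverEveState {a b e : Type*} [Fintype a] [Fintype b] {n m : ℕ}
    (Θ : OneWayLOCC a b (Fin n) (Fin n) m) (V : Matrix (b × e) a ℂ) (x : Fin n) :
    Matrix (Fin n × (e × Fin m)) (Fin n × (e × Fin m)) ℂ :=
  Matrix.of fun p q =>
    if p.2.2 = q.2.2 then
      actFst (Θ.dec p.2.2) (V * Θ.enc p.2.2 (Matrix.single x x 1) * V.conjTranspose)
        (p.1, p.2.1) (q.1, q.2.1)
    else 0

/-- The error of private communication: infimum over the states `σ` of the eavesdropper of the
maximum over the messages `x` of `1 - F(|x⟩⟨x| ⊗ σ, ·)`. -/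
def privateError {a b e : Type*} [Fintype a] [Fintype b] [Fintype e] [DecidableEq e] {n m : ℕ}
    (Θ : OneWayLOCC a b (Fin n) (Fin n) m) (V : Matrix (b × e) a ℂ) : ℝ :=
  ⨅ σ : {σ : Matrix (e × Fin m) (e × Fin m) ℂ // IsState σ}, ⨆ x : Fin n,
    (1 - fidelity (Matrix.single x x (1 : ℂ) ⊗ₖ σ.1) (receiverEveState Θ V x))

/-- `n` messages can be sent privately with error at most `ε` by a one-way LOCC superchannel,
whatever isometric extension `V` of `N` describes the eavesdropper. -/
def PrivateAchievable {a b : Type*} [Fintype a] [DecidableEq a] [Fintype b] (N : OpMap a b)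
    (ε : ℝ) (n : ℕ) : Prop :=
  ∃ (m : ℕ) (Θ : OneWayLOCC a b (Fin n) (Fin n) m), Θ.IsClassical ∧
    ∀ (d : ℕ) (V : Matrix (b × Fin d) a ℂ), IsIsometricExtension N V → privateError Θ V ≤ ε

/-- The one-shot forward-assisted private capacity of a channel. -/
def privateCapacity {a b : Type*} [Fintype a] [DecidableEq a] [Fintype b] (N : OpMap a b)
    (ε : ℝ) : EReal :=
  sSup {r : EReal | ∃ n : ℕ, 1 ≤ n ∧ PrivateAchievable N ε n ∧
    r = ((Real.logb 2 n : ℝ) : EReal)}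

/-! ## Smooth-min unextendible entanglement of a channel -/

/-- The least type-II error `Tr[Λσ]` over the tests `0 ≤ Λ ≤ I` with `Tr[Λρ] ≥ 1 - ε`. -/
def typeIIError {a : Type*} [Fintype a] [DecidableEq a] (ε : ℝ) (ρ σ : Matrix a a ℂ) : ℝ :=
  sInf {t : ℝ | ∃ Λ : Matrix a a ℂ, 0 ≤ Λ ∧ Λ ≤ 1 ∧ 1 - ε ≤ (Λ * ρ).trace.re ∧
    t = (Λ * σ).trace.re}

/-- `-log₂ t` for `t ≥ 0`, with `-log₂ 0 = +∞`. -/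
def negLog₂ (t : ℝ) : EReal :=
  if t ≤ 0 then ⊤ else ((-Real.logb 2 t : ℝ) : EReal)

/-- The smooth-min (hypothesis testing) relative entropy of states. -/
def Dmin {a : Type*} [Fintype a] [DecidableEq a] (ε : ℝ) (ρ σ : Matrix a a ℂ) : EReal :=
  negLog₂ (typeIIError ε ρ σ)

/-- The smooth-min relative entropy of channels: supremum over all states of the input and a
reference system of arbitrary finite dimension. -/
def DminChannel {a b : Type*} [Fintype a] [Fintype b] [DecidableEq b] (ε : ℝ)
    (N M : OpMap a b) : EReal :=
  ⨆ (r : ℕ) (ρ : {ρ : Matrix (Fin r × a) (Fin r × a) ℂ // IsState ρ}),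
    Dmin ε (actSnd N ρ.1) (actSnd M ρ.1)

/-- The channels `Tr_B ∘ P` for `P` a channel from `A` to `BE`, with `E` a copy of `B`, such that
`Tr_E ∘ P = N`. -/
def freeChannels {a b : Type*} [Fintype a] [Fintype b] (N : OpMap a b) : Set (OpMap a b) :=
  {M | ∃ P : OpMap a (b × b), IsChannel P ∧ traceSnd ∘ₗ P = N ∧ M = traceFst ∘ₗ P}

/-- The smooth-min unextendible entanglement of a channel. -/
def EminChannel {a b : Type*} [Fintype a] [Fintype b] [DecidableEq b] (ε : ℝ)
    (N : OpMap a b) : EReal :=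
  ((1 / 2 : ℝ) : EReal) * ⨅ M ∈ freeChannels N, DminChannel ε N M

/-- `J = 2 ^ (-2 E)`, with `2 ^ (-∞) = 0`. -/
def JminChannel {a b : Type*} [Fintype a] [Fintype b] [DecidableEq b] (ε : ℝ)
    (N : OpMap a b) : ℝ :=
  if EminChannel ε N = ⊤ then 0 else (2 : ℝ) ^ (-(2 * (EminChannel ε N).toReal))

/-! ## The semidefinite program -/

/-- The Choi operator of a map, on (input copy) × (output). -/
def choi {a b : Type*} [DecidableEq a] (N : OpMap a b) : Matrix (a × b) (a × b) ℂ :=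
  Matrix.of fun p q => N (Matrix.single p.1 q.1 1) p.2 q.2

/-- `Tr_E` of an operator on `A × (B × E)`. -/
def traceE {a b : Type*} [Fintype b] (Γ : Matrix (a × (b × b)) (a × (b × b)) ℂ) :
    Matrix (a × b) (a × b) ℂ :=
  actSnd traceSnd Γ

/-- `Tr_B` of an operator on `A × (B × E)`. -/
def traceB {a b : Type*} [Fintype b] (Γ : Matrix (a × (b × b)) (a × (b × b)) ℂ) :
    Matrix (a × b) (a × b) ℂ :=
  actSnd traceFst Γ

/-- The objective values of the feasible points of the semidefinite program: maximize
`μ (1 - ε) - λ` over `λ, μ ≥ 0`, `Y ≥ 0`, `Γ ≥ 0` subject to `μ Γ^N ≤ Tr_B Γ + Y`,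
`Tr_B Y ≤ λ I` and `Tr_E Γ = Γ^N`. -/
def sdpValues {a b : Type*} [Fintype a] [DecidableEq a] [Fintype b] (ε : ℝ)
    (N : OpMap a b) : Set ℝ :=
  {v | ∃ (lam μ : ℝ) (Y : Matrix (a × b) (a × b) ℂ)
      (Γ : Matrix (a × (b × b)) (a × (b × b)) ℂ),
    0 ≤ lam ∧ 0 ≤ μ ∧ 0 ≤ Y ∧ 0 ≤ Γ ∧
    (μ : ℂ) • choi N ≤ traceB Γ + Y ∧
    traceSnd Y ≤ (lam : ℂ) • (1 : Matrix a a ℂ) ∧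
    traceE Γ = choi N ∧
    v = μ * (1 - ε) - lam}

/-- The function `f(J, ε)` of the bound. -/
def keyBound (J ε : ℝ) : ℝ :=
  1 / 2 * Real.logb 2
    (((Real.sqrt (J * (1 - J)) + Real.sqrt (ε * (1 - ε))) / (J - ε)) ^ 2 + 1)

end PrivateCapacity

end

set_option linter.unusedSectionVars false

namespace PrivateCapacity

/-! ## Matrix preliminaries -/

section Prelim

variable {n m p q : Type*} [Fintype n] [Fintype m] [Fintype p] [Fintype q]

/-! Semidefinite program. For a fixed extension P of N with second marginal M, the best test between
N and M over all inputs is a conic problem: minimise Tr[Λ C_M] over 0 ≤ Λ ≤ σ ⊗ 1, Tr σ ≤ 1, Tr[Λ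
C_N] ≥ 1 - ε, where C denotes Choi operators and σ plays the role of the input marginal. Its dual
variables are λ, μ, Y. The infimum over M in the definition of J becomes a maximisation over the
Choi operator Γ of P, so both maximisations merge into one program. Weak duality
(`sdpValue_le_JminChannel`) reads μ C_N ≤ C_M + Y as complete positivity of a map. Strong duality
(`exists_primal_of_dual_bound`) is a Hahn–Banach separation with a Slater point, and
`exists_test_of_primal` turns a feasible (Λ, σ) back into an input state and a test.

Upper bound. It is a monogamy argument. A key protocol applied to an extension P, with the
receiver's decoder run on B and on E alike, produces one tripartite state whose two marginals are
the outputs of the protocol for N and for M. The projection onto the support of private states with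
the given twisting is a test. The output for N passes it with probability at least 1 - ε by the
fidelity criterion, hence the output for M passes with probability at least any y for which M has
type II errors at least y. The two projections, on AB and on AE, have all principal angles equal to
arccos(1/k) (`keyIsometry_cross_gram`), because the key values must agree on all three systems and
the shield part is unitary. The triangle inequality for angles (`two_projections`) gives √((1-ε)y) -
√(ε(1-y)) ≤ 1/k. Letting y tend to J and rewriting with tangents yields the stated bound.

Equality of capacity and key. The same integers are achievable for both tasks, with the same error.
From key to communication the sender one-time pads the message with the key and announces the
ciphertext. From communication to key the sender runs the encoder coherently on a uniform
superposition of messages, and the Kraus indices of encoder and decoder become shield systems. In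
both directions fidelities are handled as overlaps of purifications (Uhlmann). The first translation
preserves the overlap for every message, the second averages the overlaps over messages. The
message-dependent Uhlmann unitaries on the purification of the ideal eavesdropper state are
precisely the twisting unitaries of a private state. -/

theorem trace_conjTranspose_mul (A B : Matrix n m ℂ) :
    (A.conjTranspose * B).trace = ∑ i, ∑ j, star (A i j) * B i j := by
  simp only [Matrix.trace, Matrix.diag_apply, Matrix.mul_apply, Matrix.conjTranspose_apply]
  exact Finset.sum_comm

/-- Cauchy–Schwarz for the Hilbert–Schmidt inner product. -/
theorem norm_trace_conjTranspose_mul_sq_le (A B : Matrix n m ℂ) :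
    ‖(A.conjTranspose * B).trace‖ ^ 2
      ≤ (A.conjTranspose * A).trace.re * (B.conjTranspose * B).trace.re := by
  have key : ∀ C D : Matrix n m ℂ, (C.conjTranspose * D).trace
      = inner ℂ (WithLp.toLp 2 fun x : n × m => C x.1 x.2 : EuclideanSpace ℂ (n × m))
        (WithLp.toLp 2 fun x : n × m => D x.1 x.2) := by
    intro C D
    rw [trace_conjTranspose_mul, EuclideanSpace.inner_eq_star_dotProduct, dotProduct,
      Fintype.sum_prod_type]
    simp [mul_comm]
  rw [key, key, key]
  have := norm_inner_le_norm (𝕜 := ℂ)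
    (WithLp.toLp 2 fun x : n × m => A x.1 x.2 : EuclideanSpace ℂ (n × m))
    (WithLp.toLp 2 fun x : n × m => B x.1 x.2)
  have hre : ∀ x : EuclideanSpace ℂ (n × m), (inner ℂ x x : ℂ).re = ‖x‖ ^ 2 := fun x =>
    inner_self_eq_norm_sq (𝕜 := ℂ) x
  rw [hre, hre]
  exact (pow_le_pow_left₀ (norm_nonneg _) this 2).trans (mul_pow _ _ _).le

theorem trace_conjTranspose_mul_self_re_nonneg (A : Matrix n m ℂ) :
    0 ≤ (A.conjTranspose * A).trace.re :=
  (Complex.nonneg_iff.1 (Matrix.posSemidef_conjTranspose_mul_self A).trace_nonneg).1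

variable [DecidableEq n] [DecidableEq m] [DecidableEq p] [DecidableEq q]

/-- Square matrices with the same Gram matrix differ by a unitary. -/
theorem exists_unitary_mul_of_gram_eq {A B : Matrix n n ℂ}
    (h : A.conjTranspose * A = B.conjTranspose * B) :
    ∃ U ∈ Matrix.unitaryGroup n ℂ, B = U * A := by
  let E := EuclideanSpace ℂ n
  let fA : E →ₗ[ℂ] E := Matrix.toEuclideanLin A
  let fB : E →ₗ[ℂ] E := Matrix.toEuclideanLin B
  have hinner : ∀ (C : Matrix n n ℂ) (x : E), ‖Matrix.toEuclideanLin C x‖ ^ 2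
      = (inner ℂ x (Matrix.toEuclideanLin (C.conjTranspose * C) x)).re := by
    intro C x
    have h1 : Matrix.toEuclideanLin (C.conjTranspose * C) x
        = Matrix.toEuclideanLin C.conjTranspose (Matrix.toEuclideanLin C x) := by
      simp [Matrix.toEuclideanLin, Matrix.toLpLin_apply, Matrix.mulVec_mulVec]
    rw [h1, Matrix.toEuclideanLin_conjTranspose_eq_adjoint, LinearMap.adjoint_inner_right,
      inner_self_eq_norm_sq_to_K]
    norm_cast
  have hn : ∀ x, ‖fB x‖ = ‖fA x‖ := by
    intro x
    have : ‖fB x‖ ^ 2 = ‖fA x‖ ^ 2 := by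
      rw [hinner, hinner, h]
    exact (sq_eq_sq₀ (norm_nonneg _) (norm_nonneg _)).1 this
  -- The map A x ↦ B x is well defined and isometric on the range of A because ‖B x‖ = ‖A x‖. It
  -- extends to a linear isometry of the whole space, which is unitary in finite dimension.
  obtain ⟨g, hg⟩ := fA.rangeRestrict.exists_rightInverse_of_surjective fA.range_rangeRestrict
  have hg' : ∀ y, fA (g y) = y := fun y => by
    have := congrArg Subtype.val (LinearMap.congr_fun hg y)
    simpa using this
  let L : LinearMap.range fA →ₗᵢ[ℂ] E :=
    ⟨fB ∘ₗ g, fun y => by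
      change ‖fB (g y)‖ = ‖y‖
      rw [hn, hg']; rfl⟩
  have hL : ∀ x, L.extend (fA x) = fB x := by
    intro x
    have h1 := L.extend_apply ⟨fA x, LinearMap.mem_range_self fA x⟩
    have h2 : fB (g ⟨fA x, LinearMap.mem_range_self fA x⟩ - x) = 0 := by
      rw [← norm_eq_zero, hn, norm_eq_zero, map_sub, hg', sub_self]
    rw [map_sub, sub_eq_zero] at h2
    exact h1.trans h2
  let U : Matrix n n ℂ := Matrix.toEuclideanLin.symm L.extend.toLinearMap
  have hU : Matrix.toEuclideanLin U = L.extend.toLinearMap := LinearEquiv.apply_symm_apply _ _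
  refine ⟨U, ?_, ?_⟩
  · rw [Matrix.mem_unitaryGroup_iff']
    apply Matrix.toEuclideanLin.injective
    refine LinearMap.ext fun x => ext_inner_left ℂ fun y => ?_
    have h1 : Matrix.toEuclideanLin (star U * U) x
        = Matrix.toEuclideanLin U.conjTranspose (Matrix.toEuclideanLin U x) := by
      simp [Matrix.toEuclideanLin, Matrix.toLpLin_apply, Matrix.mulVec_mulVec,
        Matrix.star_eq_conjTranspose]
    rw [h1, Matrix.toEuclideanLin_conjTranspose_eq_adjoint, LinearMap.adjoint_inner_right, hU]
    have h2 := L.extend.inner_map_map y x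
    rw [show Matrix.toEuclideanLin (1 : Matrix n n ℂ) x = x by
      simp [Matrix.toEuclideanLin]]
    exact h2
  · apply Matrix.toEuclideanLin.injective
    refine LinearMap.ext fun x => ?_
    have h1 : Matrix.toEuclideanLin (U * A) x
        = Matrix.toEuclideanLin U (Matrix.toEuclideanLin A x) := by
      simp [Matrix.toEuclideanLin, Matrix.toLpLin_apply, Matrix.mulVec_mulVec]
    rw [h1, hU]
    exact (hL x).symm

theorem sqrt_isHermitian (A : Matrix n n ℂ) : (CFC.sqrt A).conjTranspose = CFC.sqrt A :=
  (Matrix.nonneg_iff_posSemidef.1 (CFC.sqrt_nonneg A)).1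

theorem sqrt_mul_sqrt {A : Matrix n n ℂ} (hA : A.PosSemidef) : CFC.sqrt A * CFC.sqrt A = A :=
  CFC.sqrt_mul_sqrt_self A (Matrix.nonneg_iff_posSemidef.2 hA)

/-- Polar decomposition of a square matrix. -/
theorem exists_unitary_mul_eq_sqrt (A : Matrix n n ℂ) :
    ∃ U ∈ Matrix.unitaryGroup n ℂ, CFC.sqrt (A.conjTranspose * A) = U * A := by
  refine exists_unitary_mul_of_gram_eq ?_
  rw [sqrt_isHermitian, sqrt_mul_sqrt (Matrix.posSemidef_conjTranspose_mul_self A)]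

theorem sqrt_eq_of_sq {A B : Matrix n n ℂ} (h : B * B = A) (hB : B.PosSemidef) :
    CFC.sqrt A = B :=
  CFC.sqrt_unique h (Matrix.nonneg_iff_posSemidef.2 hB)

/-- With Q = √(A†A) and the polar decomposition A = U†Q, the square root of AA† is U†QU, which has
the trace of Q. -/
theorem trace_sqrt_gram_comm_square (A : Matrix n n ℂ) :
    (CFC.sqrt (A.conjTranspose * A)).trace = (CFC.sqrt (A * A.conjTranspose)).trace := by
  obtain ⟨U, hU, h⟩ := exists_unitary_mul_eq_sqrt A
  have hU1 : U.conjTranspose * U = 1 := Matrix.mem_unitaryGroup_iff'.1 hU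
  have hU2 : U * U.conjTranspose = 1 := Matrix.mem_unitaryGroup_iff.1 hU
  have hA : A = U.conjTranspose * CFC.sqrt (A.conjTranspose * A) := by
    rw [h, ← Matrix.mul_assoc, hU1, Matrix.one_mul]
  set Q := CFC.sqrt (A.conjTranspose * A) with hQ
  have hQh : Q.conjTranspose = Q := sqrt_isHermitian _
  have hQp : Q.PosSemidef := Matrix.nonneg_iff_posSemidef.1 (CFC.sqrt_nonneg _)
  have : CFC.sqrt (A * A.conjTranspose) = U.conjTranspose * Q * U := by
    refine sqrt_eq_of_sq ?_ (hQp.conjTranspose_mul_mul_same U)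
    rw [hA, Matrix.conjTranspose_mul, Matrix.conjTranspose_conjTranspose, hQh]
    simp only [Matrix.mul_assoc]
    rw [← Matrix.mul_assoc U, hU2, Matrix.one_mul]
  rw [this, Matrix.mul_assoc, Matrix.trace_mul_comm, Matrix.mul_assoc, hU2, Matrix.mul_one]

theorem posSemidef_fromBlocks_diagonal {A : Matrix n n ℂ} {D : Matrix m m ℂ}
    (hA : A.PosSemidef) (hD : D.PosSemidef) : (Matrix.fromBlocks A 0 0 D).PosSemidef := by
  have : Matrix.fromBlocks A 0 0 D
      = (Matrix.fromBlocks (CFC.sqrt A) 0 0 (CFC.sqrt D)).conjTranspose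
        * Matrix.fromBlocks (CFC.sqrt A) 0 0 (CFC.sqrt D) := by
    rw [Matrix.fromBlocks_conjTranspose, Matrix.fromBlocks_multiply]
    simp [sqrt_isHermitian, sqrt_mul_sqrt hA, sqrt_mul_sqrt hD]
  rw [this]
  exact Matrix.posSemidef_conjTranspose_mul_self _

/-- A rectangular matrix becomes square as the off-diagonal block of a matrix on `n ⊕ m`, whose two
Gram matrices are block diagonal with one zero block. -/
theorem trace_sqrt_gram_comm (A : Matrix n m ℂ) :
    (CFC.sqrt (A.conjTranspose * A)).trace = (CFC.sqrt (A * A.conjTranspose)).trace := by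
  have h := trace_sqrt_gram_comm_square (Matrix.fromBlocks 0 A 0 0 : Matrix (n ⊕ m) (n ⊕ m) ℂ)
  have h1 : (Matrix.fromBlocks 0 A 0 0 : Matrix (n ⊕ m) (n ⊕ m) ℂ).conjTranspose
      * Matrix.fromBlocks 0 A 0 0 = Matrix.fromBlocks 0 0 0 (A.conjTranspose * A) := by
    simp [Matrix.fromBlocks_conjTranspose, Matrix.fromBlocks_multiply]
  have h2 : (Matrix.fromBlocks 0 A 0 0 : Matrix (n ⊕ m) (n ⊕ m) ℂ)
      * (Matrix.fromBlocks 0 A 0 0 : Matrix (n ⊕ m) (n ⊕ m) ℂ).conjTranspose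
      = Matrix.fromBlocks (A * A.conjTranspose) 0 0 0 := by
    simp [Matrix.fromBlocks_conjTranspose, Matrix.fromBlocks_multiply]
  have h3 : CFC.sqrt (Matrix.fromBlocks 0 0 0 (A.conjTranspose * A) : Matrix (n ⊕ m) (n ⊕ m) ℂ)
      = Matrix.fromBlocks 0 0 0 (CFC.sqrt (A.conjTranspose * A)) := by
    refine sqrt_eq_of_sq ?_ (posSemidef_fromBlocks_diagonal .zero
      (Matrix.nonneg_iff_posSemidef.1 (CFC.sqrt_nonneg _)))
    simp [Matrix.fromBlocks_multiply, sqrt_mul_sqrt (Matrix.posSemidef_conjTranspose_mul_self A)]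
  have h4 : CFC.sqrt (Matrix.fromBlocks (A * A.conjTranspose) 0 0 0 : Matrix (n ⊕ m) (n ⊕ m) ℂ)
      = Matrix.fromBlocks (CFC.sqrt (A * A.conjTranspose)) 0 0 0 := by
    refine sqrt_eq_of_sq ?_ (posSemidef_fromBlocks_diagonal
      (Matrix.nonneg_iff_posSemidef.1 (CFC.sqrt_nonneg _)) .zero)
    simp [Matrix.fromBlocks_multiply, sqrt_mul_sqrt (Matrix.posSemidef_self_mul_conjTranspose A)]
  rw [h1, h2, h3, h4] at h
  simpa [Matrix.trace] using h

/-! ## Fidelity through purifications -/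

/-- A factorization `ρ = S S†` is a purification of `ρ`. -/
theorem fidelity_eq_of_purification (S R : Matrix n m ℂ) :
    fidelity (S * S.conjTranspose) (R * R.conjTranspose)
      = (CFC.sqrt ((S.conjTranspose * R).conjTranspose * (S.conjTranspose * R))).trace.re ^ 2 := by
  rw [fidelity]
  set Q := CFC.sqrt (R * R.conjTranspose) with hQ
  have hQh : Q.conjTranspose = Q := sqrt_isHermitian _
  have hQQ : Q * Q = R * R.conjTranspose :=
    sqrt_mul_sqrt (Matrix.posSemidef_self_mul_conjTranspose R)
  have h1 : Q * (S * S.conjTranspose) * Q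
      = (S.conjTranspose * Q).conjTranspose * (S.conjTranspose * Q) := by
    rw [Matrix.conjTranspose_mul, Matrix.conjTranspose_conjTranspose, hQh]
    simp only [Matrix.mul_assoc]
  have h2 : (S.conjTranspose * Q) * (S.conjTranspose * Q).conjTranspose
      = (S.conjTranspose * R) * (S.conjTranspose * R).conjTranspose := by
    rw [Matrix.conjTranspose_mul, Matrix.conjTranspose_mul, Matrix.conjTranspose_conjTranspose,
      hQh, Matrix.mul_assoc, ← Matrix.mul_assoc Q, hQQ]
    simp only [Matrix.mul_assoc]
  -- The trace norm of X can be computed from XX†, and this matrix is the same for X = S†√(RR†) and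
  -- X = S†R. Hence √σ may be replaced by any factor R of σ.
  rw [h1, trace_sqrt_gram_comm, h2, ← trace_sqrt_gram_comm]

/-- Cauchy–Schwarz for √Q U and √Q, where A = U†Q is the polar decomposition: both have squared norm
Tr Q. -/
theorem norm_trace_le_trace_sqrt (A : Matrix n n ℂ) :
    ‖A.trace‖ ≤ (CFC.sqrt (A.conjTranspose * A)).trace.re := by
  obtain ⟨U, hU, h⟩ := exists_unitary_mul_eq_sqrt A
  have hU1 : U.conjTranspose * U = 1 := Matrix.mem_unitaryGroup_iff'.1 hU
  have hU2 : U * U.conjTranspose = 1 := Matrix.mem_unitaryGroup_iff.1 hU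
  set Q := CFC.sqrt (A.conjTranspose * A) with hQ
  have hQp : Q.PosSemidef := Matrix.nonneg_iff_posSemidef.1 (CFC.sqrt_nonneg _)
  have hA : A = U.conjTranspose * Q := by
    rw [h, ← Matrix.mul_assoc, hU1, Matrix.one_mul]
  have h0 : 0 ≤ Q.trace.re := (Complex.nonneg_iff.1 hQp.trace_nonneg).1
  have hr := sqrt_isHermitian Q
  have hrr := sqrt_mul_sqrt hQp
  have hcs := norm_trace_conjTranspose_mul_sq_le (CFC.sqrt Q * U) (CFC.sqrt Q)
  have e1 : (CFC.sqrt Q * U).conjTranspose * CFC.sqrt Q = A := by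
    rw [Matrix.conjTranspose_mul, hr, Matrix.mul_assoc, hrr, ← hA]
  have e2 : ((CFC.sqrt Q * U).conjTranspose * (CFC.sqrt Q * U)).trace = Q.trace := by
    rw [Matrix.conjTranspose_mul, hr, Matrix.mul_assoc, ← Matrix.mul_assoc (CFC.sqrt Q), hrr,
      Matrix.trace_mul_comm, Matrix.mul_assoc, hU2, Matrix.mul_one]
  rw [e1, e2, hr, hrr, ← sq] at hcs
  exact (sq_le_sq₀ (norm_nonneg _) h0).1 hcs

/-- The easy half of Uhlmann's theorem: the overlap of any two purifications on the same purifying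
system bounds the fidelity from below. -/
theorem norm_trace_sq_le_fidelity (S R : Matrix n m ℂ) :
    ‖(S.conjTranspose * R).trace‖ ^ 2
      ≤ fidelity (S * S.conjTranspose) (R * R.conjTranspose) := by
  rw [fidelity_eq_of_purification]
  exact pow_le_pow_left₀ (norm_nonneg _) (norm_trace_le_trace_sqrt _) 2

/-- Uhlmann's theorem. -/
theorem exists_unitary_trace_eq_sqrt_fidelity (S R : Matrix n m ℂ) :
    ∃ U ∈ Matrix.unitaryGroup m ℂ, (S.conjTranspose * (R * U)).trace
      = (Real.sqrt (fidelity (S * S.conjTranspose) (R * R.conjTranspose)) : ℂ) := by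
  obtain ⟨U, hU, h⟩ := exists_unitary_mul_eq_sqrt (S.conjTranspose * R)
  refine ⟨U, hU, ?_⟩
  have hp : (CFC.sqrt ((S.conjTranspose * R).conjTranspose
      * (S.conjTranspose * R))).PosSemidef := Matrix.nonneg_iff_posSemidef.1 (CFC.sqrt_nonneg _)
  have h0 := Complex.nonneg_iff.1 hp.trace_nonneg
  rw [fidelity_eq_of_purification, Real.sqrt_sq h0.1, ← Matrix.mul_assoc, Matrix.trace_mul_comm,
    ← h]
  exact Complex.ext rfl (by simpa using h0.2.symm)

theorem fidelity_nonneg (ρ σ : Matrix n n ℂ) : 0 ≤ fidelity ρ σ := sq_nonneg _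

theorem exists_purification {ρ : Matrix n n ℂ} (hρ : ρ.PosSemidef) :
    ρ = CFC.sqrt ρ * (CFC.sqrt ρ).conjTranspose := by
  rw [sqrt_isHermitian, sqrt_mul_sqrt hρ]

/-- Measuring the projection onto the range of the isometry `W` does not decrease the fidelity
with a state supported on that range. -/
theorem fidelity_isometry_le {ρ : Matrix n n ℂ} (hρ : ρ.PosSemidef) {τ : Matrix m m ℂ}
    (hτ : IsState τ) (W : Matrix n m ℂ) :
    fidelity ρ (W * τ * W.conjTranspose) ≤ (W * W.conjTranspose * ρ).trace.re := by
  set S := CFC.sqrt ρ with hS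
  set T := CFC.sqrt τ with hT
  have hSh : S.conjTranspose = S := sqrt_isHermitian ρ
  have hTh : T.conjTranspose = T := sqrt_isHermitian τ
  have hSS : S * S = ρ := sqrt_mul_sqrt hρ
  have hTT : T * T = τ := sqrt_mul_sqrt hτ.1
  -- Zero columns put the purifications of both states on the common purifying system `n ⊕ m`, so
  -- that Uhlmann's theorem applies although `n` and `m` differ.
  let Z : Matrix n (n ⊕ m) ℂ := Matrix.fromCols S 0
  let R : Matrix n (n ⊕ m) ℂ := Matrix.fromCols 0 (W * T)
  have hZ : Z * Z.conjTranspose = ρ := by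
    simp [Z, Matrix.conjTranspose_fromCols_eq_fromRows_conjTranspose, Matrix.fromCols_mul_fromRows,
      hSh, hSS]
  have hR : R * R.conjTranspose = W * τ * W.conjTranspose := by
    simp only [R, Matrix.conjTranspose_fromCols_eq_fromRows_conjTranspose,
      Matrix.fromCols_mul_fromRows, Matrix.conjTranspose_mul, hTh, Matrix.zero_mul, zero_add]
    rw [← hTT]; simp only [Matrix.mul_assoc]
  have hRd : R = W * (Matrix.fromCols 0 T : Matrix m (n ⊕ m) ℂ) := by
    simp [R, Matrix.mul_fromCols]
  obtain ⟨U, hU, h⟩ := exists_unitary_trace_eq_sqrt_fidelity Z R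
  have hU2 : U * U.conjTranspose = 1 := Matrix.mem_unitaryGroup_iff.1 hU
  set T' : Matrix m (n ⊕ m) ℂ := Matrix.fromCols 0 T with hT'
  have hTT' : T' * T'.conjTranspose = τ := by
    simp [T', Matrix.conjTranspose_fromCols_eq_fromRows_conjTranspose,
      Matrix.fromCols_mul_fromRows, hTh, hTT]
  -- The factor W of the second purification is moved onto the first. In the resulting
  -- Cauchy–Schwarz bound one factor is the probability of passing the test and the other is Tr τ =
  -- 1.
  have hcs := norm_trace_conjTranspose_mul_sq_le (W.conjTranspose * Z) (T' * U)
  have e1 : (W.conjTranspose * Z).conjTranspose * (T' * U) = Z.conjTranspose * (R * U) := by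
    rw [hRd]
    simp only [Matrix.conjTranspose_mul, Matrix.conjTranspose_conjTranspose, Matrix.mul_assoc]
  have e2 : ((W.conjTranspose * Z).conjTranspose * (W.conjTranspose * Z)).trace
      = (W * W.conjTranspose * ρ).trace := by
    rw [Matrix.conjTranspose_mul, Matrix.conjTranspose_conjTranspose, Matrix.mul_assoc,
      Matrix.trace_mul_comm, ← hZ]
    simp only [Matrix.mul_assoc]
  have e3 : ((T' * U).conjTranspose * (T' * U)).trace = 1 := by
    rw [Matrix.trace_mul_comm, Matrix.conjTranspose_mul, Matrix.mul_assoc,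
      ← Matrix.mul_assoc U, hU2, Matrix.one_mul, hTT', hτ.2]
  rw [e1, e2, e3, h, hZ, hR] at hcs
  simpa [Real.sq_sqrt (fidelity_nonneg _ _), abs_of_nonneg (Real.sqrt_nonneg _)] using hcs

end Prelim


/-! ## Choi operators and Kraus decompositions -/

section Kraus

variable {a b c d e r ι κ : Type*} [Fintype a] [Fintype b] [Fintype c] [Fintype d] [Fintype e]
  [Fintype r] [Fintype ι] [Fintype κ]

/-- The map with a given Choi operator. -/
def ofChoi (C : Matrix (a × b) (a × b) ℂ) : OpMap a b where
  toFun X := Matrix.of fun j j' => ∑ i, ∑ i', X i i' * C (i, j) (i', j')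
  map_add' X Y := by
    ext j j'
    simp [add_mul, Finset.sum_add_distrib]
  map_smul' t X := by
    ext j j'
    simp [Finset.mul_sum, mul_assoc]

theorem ofChoi_apply (C : Matrix (a × b) (a × b) ℂ) (X : Matrix a a ℂ) (j j' : b) :
    ofChoi C X j j' = ∑ i, ∑ i', X i i' * C (i, j) (i', j') := rfl

theorem map_eq_sum_choi [DecidableEq a] (Φ : OpMap a b) (X : Matrix a a ℂ) (j j' : b) :
    Φ X j j' = ∑ i, ∑ i', X i i' * choi Φ (i, j) (i', j') := by
  conv_lhs => rw [Matrix.matrix_eq_sum_single X]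
  simp only [map_sum, Matrix.sum_apply, choi, Matrix.of_apply]
  refine Finset.sum_congr rfl fun i _ => Finset.sum_congr rfl fun i' _ => ?_
  rw [show Matrix.single i i' (X i i') = X i i' • Matrix.single i i' (1 : ℂ) by
    rw [Matrix.smul_single]; simp, map_smul, Matrix.smul_apply, smul_eq_mul]

theorem ofChoi_choi [DecidableEq a] (Φ : OpMap a b) : ofChoi (choi Φ) = Φ := by
  refine LinearMap.ext fun X => Matrix.ext fun j j' => ?_
  rw [ofChoi_apply, map_eq_sum_choi]

theorem choi_ofChoi [DecidableEq a] (C : Matrix (a × b) (a × b) ℂ) : choi (ofChoi C) = C := by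
  ext ⟨i, j⟩ ⟨i', j'⟩
  rw [choi, Matrix.of_apply, ofChoi_apply, Finset.sum_eq_single i, Finset.sum_eq_single i']
  · simp
  · intro k _ hk; simp [Matrix.single, hk.symm]
  · simp
  · intro k _ hk; simp [Matrix.single, hk.symm]
  · simp

theorem IsCP.choi_posSemidef [DecidableEq a] {Φ : OpMap a b} (h : IsCP Φ) :
    (choi Φ).PosSemidef := by
  let eq := Fintype.equivFin a
  -- The unnormalised maximally entangled vector: its image under id ⊗ Φ is the Choi operator, up to
  -- relabelling the reference, which `IsCP` takes of the form `Fin r`.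
  let v : Fin (Fintype.card a) × a → ℂ := fun p => if p.1 = eq p.2 then 1 else 0
  have h1 := h (Fintype.card a) (Matrix.vecMulVec v (star v))
    (Matrix.posSemidef_vecMulVec_self_star v)
  have h2 := h1.submatrix (fun p : a × b => (eq p.1, p.2))
  convert h2 using 1
  ext ⟨i, j⟩ ⟨i', j'⟩
  simp only [choi, actSnd, Matrix.of_apply, Matrix.submatrix_apply]
  refine congrArg (fun M : Matrix a a ℂ => Φ M j j') (Matrix.ext fun k k' => ?_)
  simp only [Matrix.single, Matrix.of_apply, Matrix.vecMulVec_apply, v, Pi.star_apply,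
    EmbeddingLike.apply_eq_iff_eq]
  by_cases h : i = k <;> by_cases h' : i' = k' <;> simp [h, h']

/-- The completely positive map with the given Kraus operators. -/
def krausMap (K : ι → Matrix b a ℂ) : OpMap a b where
  toFun X := ∑ q, K q * X * (K q).conjTranspose
  map_add' X Y := by simp [Matrix.mul_add, Matrix.add_mul, Finset.sum_add_distrib]
  map_smul' t X := by simp [Finset.smul_sum]

theorem krausMap_apply (K : ι → Matrix b a ℂ) (X : Matrix a a ℂ) :
    krausMap K X = ∑ q, K q * X * (K q).conjTranspose := rfl

/-- The action of Kraus operators on a purification. -/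
def krausPurification {p : Type*} (K : ι → Matrix b a ℂ) (Ψ : Matrix (r × a) p ℂ) :
    Matrix (r × b) (ι × p) ℂ :=
  Matrix.of fun y q => ∑ i, K q.1 y.2 i * Ψ (y.1, i) q.2

theorem actSnd_krausMap {p : Type*} [Fintype p] (K : ι → Matrix b a ℂ) (Ψ : Matrix (r × a) p ℂ) :
    actSnd (krausMap K) (Ψ * Ψ.conjTranspose)
      = krausPurification K Ψ * (krausPurification K Ψ).conjTranspose := by
  ext ⟨x, j⟩ ⟨x', j'⟩
  simp only [actSnd, Matrix.of_apply, krausMap_apply, Matrix.sum_apply, Matrix.mul_apply,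
    krausPurification, Fintype.sum_prod_type, Matrix.conjTranspose_apply, star_sum, star_mul',
    Finset.sum_mul, Finset.mul_sum]
  refine Finset.sum_congr rfl fun q _ => ?_
  conv_rhs => rw [Finset.sum_comm]
  refine Finset.sum_congr rfl fun i _ => ?_
  conv_rhs => rw [Finset.sum_comm]
  refine Finset.sum_congr rfl fun i' _ => Finset.sum_congr rfl fun z _ => ?_
  ring

theorem actSnd_krausMap_posSemidef (K : ι → Matrix b a ℂ) {X : Matrix (r × a) (r × a) ℂ}
    (hX : X.PosSemidef) : (actSnd (krausMap K) X).PosSemidef := by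
  classical
  rw [exists_purification hX, actSnd_krausMap]
  exact Matrix.posSemidef_self_mul_conjTranspose _

theorem isCP_krausMap (K : ι → Matrix b a ℂ) : IsCP (krausMap K) :=
  fun _ _ hX => actSnd_krausMap_posSemidef K hX

/-- Each column of a factor of the Choi operator, reshaped to a matrix, is a Kraus operator. -/
theorem eq_krausMap_of_choi_eq [DecidableEq a] {Φ : OpMap a b} {Q : Matrix (a × b) ι ℂ}
    (h : choi Φ = Q * Q.conjTranspose) :
    Φ = krausMap fun q => Matrix.of fun j i => Q (i, j) q := by
  refine LinearMap.ext fun X => Matrix.ext fun j j' => ?_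
  rw [map_eq_sum_choi, h, krausMap_apply]
  simp only [Matrix.sum_apply, Matrix.mul_apply, Matrix.conjTranspose_apply, Matrix.of_apply,
    Finset.mul_sum, Finset.sum_mul]
  conv_rhs => rw [Finset.sum_comm]
  conv_rhs => enter [2, i']; rw [Finset.sum_comm]
  conv_rhs => rw [Finset.sum_comm]
  refine Finset.sum_congr rfl fun i _ => Finset.sum_congr rfl fun i' _ =>
    Finset.sum_congr rfl fun q _ => ?_
  ring

/-- The number `s` of Kraus operators stays free above the minimum, zero operators filling the
excess. This freedom is used later to make purifying systems large enough for Uhlmann's theorem. -/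
theorem exists_kraus_of_choi_posSemidef [DecidableEq a] {Φ : OpMap a b}
    (h : (choi Φ).PosSemidef) {s : ℕ} (hs : Fintype.card (a × b) ≤ s) :
    ∃ K : Fin s → Matrix b a ℂ, Φ = krausMap K := by
  classical
  obtain ⟨emb⟩ := Function.Embedding.nonempty_of_card_le
    (α := a × b) (β := Fin s) (by simpa using hs)
  refine ⟨Function.extend emb (fun q => Matrix.of fun j i => CFC.sqrt (choi Φ) (i, j) q) 0, ?_⟩
  conv_lhs => rw [eq_krausMap_of_choi_eq (exists_purification h)]
  refine LinearMap.ext fun X => ?_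
  rw [krausMap_apply, krausMap_apply]
  refine Fintype.sum_of_injective emb emb.injective _ _ (fun q hq => ?_) fun q => ?_
  · rw [Function.extend_apply' _ _ _ (by simpa using hq)]
    simp
  · rw [emb.injective.extend_apply]

theorem IsCP.exists_kraus {Φ : OpMap a b} (h : IsCP Φ) {s : ℕ}
    (hs : Fintype.card (a × b) ≤ s) : ∃ K : Fin s → Matrix b a ℂ, Φ = krausMap K := by
  classical
  exact exists_kraus_of_choi_posSemidef h.choi_posSemidef hs

theorem IsCP.actSnd_posSemidef {Φ : OpMap a b} (h : IsCP Φ) {X : Matrix (r × a) (r × a) ℂ}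
    (hX : X.PosSemidef) : (actSnd Φ X).PosSemidef := by
  obtain ⟨K, rfl⟩ := h.exists_kraus le_rfl
  exact actSnd_krausMap_posSemidef K hX

theorem isCP_of_choi_posSemidef [DecidableEq a] {Φ : OpMap a b}
    (h : (choi Φ).PosSemidef) : IsCP Φ := by
  obtain ⟨K, rfl⟩ := exists_kraus_of_choi_posSemidef h le_rfl
  exact isCP_krausMap K

theorem IsCP.posSemidef {Φ : OpMap a b} (h : IsCP Φ) {X : Matrix a a ℂ}
    (hX : X.PosSemidef) : (Φ X).PosSemidef := by
  obtain ⟨K, rfl⟩ := h.exists_kraus le_rfl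
  exact Matrix.posSemidef_sum _ fun q _ => hX.mul_mul_conjTranspose_same (K q)

theorem trace_krausMap (K : ι → Matrix b a ℂ) (X : Matrix a a ℂ) :
    (krausMap K X).trace = ((∑ q, (K q).conjTranspose * K q) * X).trace := by
  rw [krausMap_apply, Matrix.trace_sum, Finset.sum_mul, Matrix.trace_sum]
  refine Finset.sum_congr rfl fun q _ => ?_
  rw [Matrix.trace_mul_comm, ← Matrix.mul_assoc]

theorem eq_one_of_forall_trace_mul [DecidableEq a] {M : Matrix a a ℂ}
    (h : ∀ X, (M * X).trace = X.trace) : M = 1 := by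
  refine Matrix.ext fun i j => ?_
  have := h (Matrix.single j i 1)
  rw [Matrix.trace_mul_comm, Matrix.trace_single_mul] at this
  simp only [smul_eq_mul, one_mul] at this
  rw [this]
  by_cases hij : i = j
  · subst hij; simp
  · rw [Matrix.trace_single_eq_of_ne _ _ _ (fun h => hij h.symm), Matrix.one_apply_ne hij]

theorem IsChannel.exists_kraus [DecidableEq a] {Φ : OpMap a b} (h : IsChannel Φ) {s : ℕ}
    (hs : Fintype.card (a × b) ≤ s) :
    ∃ K : Fin s → Matrix b a ℂ, Φ = krausMap K ∧ ∑ q, (K q).conjTranspose * K q = 1 := by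
  obtain ⟨K, hK⟩ := h.1.exists_kraus hs
  refine ⟨K, hK, eq_one_of_forall_trace_mul fun X => ?_⟩
  rw [← trace_krausMap, ← hK, h.2]

theorem isChannel_krausMap [DecidableEq a] {K : ι → Matrix b a ℂ}
    (h : ∑ q, (K q).conjTranspose * K q = 1) : IsChannel (krausMap K) :=
  ⟨isCP_krausMap K, fun X => by rw [trace_krausMap, h, Matrix.one_mul]⟩

theorem krausMap_comp (K : ι → Matrix c b ℂ) (L : κ → Matrix b a ℂ) :
    krausMap K ∘ₗ krausMap L = krausMap fun q : ι × κ => K q.1 * L q.2 := by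
  refine LinearMap.ext fun X => ?_
  simp only [LinearMap.comp_apply, krausMap_apply, Fintype.sum_prod_type, Matrix.mul_sum,
    Matrix.sum_mul, Matrix.conjTranspose_mul, Matrix.mul_assoc]

theorem sum_krausMap (K : κ → ι → Matrix b a ℂ) :
    ∑ l, krausMap (K l) = krausMap fun q : κ × ι => K q.1 q.2 := by
  refine LinearMap.ext fun X => ?_
  simp only [LinearMap.sum_apply, krausMap_apply, Fintype.sum_prod_type]

/-- The Kraus operators `⟨e|V` of a channel with isometric extension `V`. -/
def envOp (V : Matrix (b × e) a ℂ) (x : e) : Matrix b a ℂ := Matrix.of fun j i => V (j, x) i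

theorem traceSnd_conj_eq_krausMap (V : Matrix (b × e) a ℂ) (X : Matrix a a ℂ) :
    traceSnd (V * X * V.conjTranspose) = krausMap (envOp V) X := by
  ext j j'
  simp [traceSnd, krausMap_apply, Matrix.sum_apply, Matrix.mul_apply, envOp]

theorem IsIsometricExtension.eq_krausMap [DecidableEq a] {N : OpMap a b}
    {V : Matrix (b × e) a ℂ} (h : IsIsometricExtension N V) : N = krausMap (envOp V) :=
  LinearMap.ext fun X => (h.2 X).trans (traceSnd_conj_eq_krausMap V X)

theorem IsChannel.exists_isIsometricExtension [DecidableEq a] {N : OpMap a b}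
    (h : IsChannel N) : ∃ (n : ℕ) (V : Matrix (b × Fin n) a ℂ), IsIsometricExtension N V := by
  obtain ⟨K, hK, hK1⟩ := h.exists_kraus le_rfl
  refine ⟨_, Matrix.of fun y i => K y.2 y.1 i, ?_, fun X => ?_⟩
  · rw [← hK1]
    ext i i'
    simp [Matrix.mul_apply, Matrix.sum_apply, Fintype.sum_prod_type]
    exact Finset.sum_comm
  · rw [traceSnd_conj_eq_krausMap, hK]
    rfl

/-! ### Kraus form of one-way LOCC superchannels -/

theorem OneWayLOCC.exists_kraus [DecidableEq b] [DecidableEq c] {m : ℕ}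
    (Θ : OneWayLOCC a b c d m) {s : ℕ}
    (hs : Fintype.card (c × a) ≤ s) :
    ∃ (E : Fin m → Fin s → Matrix a c ℂ)
      (D : Fin m → Fin (Fintype.card (b × d)) → Matrix d b ℂ),
      (∀ l, Θ.enc l = krausMap (E l)) ∧ (∀ l, Θ.dec l = krausMap (D l)) ∧
      (∑ l, ∑ f, (E l f).conjTranspose * E l f = 1) ∧
      ∀ l, ∑ g, (D l g).conjTranspose * D l g = 1 := by
  choose E hE using fun l => (Θ.enc_cp l).exists_kraus hs
  choose D hD hD1 using fun l => (Θ.dec_channel l).exists_kraus le_rfl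
  refine ⟨E, D, hE, hD, eq_one_of_forall_trace_mul fun X => ?_, hD1⟩
  rw [← Θ.enc_tp X, Finset.sum_mul, Matrix.trace_sum]
  exact Finset.sum_congr rfl fun l _ => by rw [hE, trace_krausMap]

/-- The one-way LOCC superchannel with given Kraus operators. -/
def OneWayLOCC.ofKraus [DecidableEq b] [DecidableEq c] {m : ℕ} (E : Fin m → ι → Matrix a c ℂ)
    (D : Fin m → κ → Matrix d b ℂ) (hE : ∑ l, ∑ f, (E l f).conjTranspose * E l f = 1)
    (hD : ∀ l, ∑ g, (D l g).conjTranspose * D l g = 1) : OneWayLOCC a b c d m where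
  enc l := krausMap (E l)
  dec l := krausMap (D l)
  enc_cp l := isCP_krausMap _
  enc_tp X := by
    simp_rw [trace_krausMap]
    rw [← Matrix.trace_sum, ← Finset.sum_mul, hE, Matrix.one_mul]
  dec_channel l := isChannel_krausMap (hD l)

theorem OneWayLOCC.apply_eq_krausMap {m : ℕ} {Θ : OneWayLOCC a b c d m}
    {E : Fin m → ι → Matrix a c ℂ} {D : Fin m → κ → Matrix d b ℂ}
    (hE : ∀ l, Θ.enc l = krausMap (E l)) (hD : ∀ l, Θ.dec l = krausMap (D l))
    (K : e → Matrix b a ℂ) :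
    Θ.apply (krausMap K)
      = krausMap fun q : Fin m × (κ × (e × ι)) => D q.1 q.2.1 * (K q.2.2.1 * E q.1 q.2.2.2) := by
  rw [OneWayLOCC.apply, ← sum_krausMap fun l (q : κ × (e × ι)) =>
    D l q.1 * (K q.2.1 * E l q.2.2)]
  refine Finset.sum_congr rfl fun l _ => ?_
  rw [hE, hD, krausMap_comp, krausMap_comp]

/-- A purification of the joint state of receiver and eavesdropper. -/
def eveAmplitude {n m : ℕ} (E : Fin m → ι → Matrix a (Fin n) ℂ)
    (D : Fin m → κ → Matrix (Fin n) b ℂ) (V : Matrix (b × e) a ℂ) (x : Fin n) :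
    Matrix (Fin n × (e × Fin m)) (ι × (Fin m × κ)) ℂ :=
  Matrix.of fun y q => if y.2.2 = q.2.1
    then (D y.2.2 q.2.2 * (envOp V y.2.1 * E y.2.2 q.1)) y.1 x else 0

/-- The purifying system consists of the Kraus indices and one more copy of the public message. This
copy dephases the message and makes the blocks with `l ≠ l'` vanish. -/
theorem receiverEveState_eq {n m : ℕ} {Θ : OneWayLOCC a b (Fin n) (Fin n) m}
    {E : Fin m → ι → Matrix a (Fin n) ℂ} {D : Fin m → κ → Matrix (Fin n) b ℂ}
    (hE : ∀ l, Θ.enc l = krausMap (E l)) (hD : ∀ l, Θ.dec l = krausMap (D l))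
    (V : Matrix (b × e) a ℂ) (x : Fin n) :
    receiverEveState Θ V x = eveAmplitude E D V x * (eveAmplitude E D V x).conjTranspose := by
  ext ⟨j, y, l⟩ ⟨j', y', l'⟩
  rw [Matrix.mul_apply, Fintype.sum_prod_type]
  simp_rw [Fintype.sum_prod_type]
  simp only [receiverEveState, eveAmplitude, Matrix.conjTranspose_apply, Matrix.of_apply]
  by_cases hl : l = l'
  · subst hl
    simp only [if_true]
    have h1 : ∀ (f : ι) (l₂ : Fin m) (g : κ),
        (if l = l₂ then (D l g * (envOp V y * E l f)) j x else 0)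
          * star (if l = l₂ then (D l g * (envOp V y' * E l f)) j' x else 0)
        = if l = l₂ then (D l g * (envOp V y * E l f)) j x
          * star ((D l g * (envOp V y' * E l f)) j' x) else 0 := by
      intro f l₂ g
      split_ifs <;> simp
    simp_rw [h1]
    simp only [Finset.sum_ite_irrel, Finset.sum_const_zero, Finset.sum_ite_eq, Finset.mem_univ,
      if_true]
    have h2 : (Matrix.of fun i i' => (V * Θ.enc l (Matrix.single x x 1) * V.conjTranspose)
          (i, y) (i', y') : Matrix b b ℂ)
        = ∑ f, Matrix.vecMulVec ((envOp V y * E l f) · x)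
            (star ((envOp V y' * E l f) · x)) := by
      rw [hE, krausMap_apply]
      ext i i'
      simp only [Matrix.mul_sum, Matrix.sum_mul, Matrix.of_apply, Matrix.sum_apply,
        Matrix.vecMulVec_apply]
      refine Finset.sum_congr rfl fun f _ => ?_
      rw [show V * (E l f * Matrix.single x x (1 : ℂ) * (E l f).conjTranspose) * V.conjTranspose
        = (V * E l f) * (Matrix.single x x (1 : ℂ) * (V * E l f).conjTranspose) by
          rw [Matrix.conjTranspose_mul]; simp only [Matrix.mul_assoc], Matrix.mul_apply,
        Finset.sum_eq_single x]
      · rw [Matrix.single_mul_apply_same, one_mul]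
        rfl
      · intro k _ hk
        rw [Matrix.single_mul_apply_of_ne _ _ _ _ _ hk, mul_zero]
      · simp
    rw [actFst, Matrix.of_apply]
    dsimp only
    rw [h2, hD, krausMap_apply]
    simp only [Matrix.mul_sum, Matrix.sum_mul, Matrix.sum_apply]
    rw [Finset.sum_comm]
    refine Finset.sum_congr rfl fun f _ => Finset.sum_congr rfl fun g _ => ?_
    rw [Matrix.mul_vecMulVec, Matrix.vecMulVec_mul, Matrix.vecMulVec_apply]
    congr 1
    simp only [Matrix.vecMul, dotProduct, Pi.star_apply, Matrix.conjTranspose_apply,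
      Matrix.mul_apply (M := D l g), star_sum, star_mul', mul_comm]
  · rw [if_neg hl]
    symm
    refine Finset.sum_eq_zero fun f _ => Finset.sum_eq_zero fun l₂ _ =>
      Finset.sum_eq_zero fun g _ => ?_
    by_cases h1 : l = l₂
    · rw [if_neg (c := l' = l₂) (fun h2 => hl (h1.trans h2.symm)), star_zero, mul_zero]
    · rw [if_neg h1, zero_mul]

end Kraus


/-! ## Type II errors -/

section TypeII

variable {a b c r : Type*} [Fintype a] [Fintype b] [Fintype c] [Fintype r]

theorem trace_mul_re_nonneg {A B : Matrix a a ℂ} (hA : A.PosSemidef) (hB : B.PosSemidef) :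
    0 ≤ (A * B).trace.re := by
  classical
  have h : (A * B).trace = (CFC.sqrt A * B * (CFC.sqrt A).conjTranspose).trace := by
    conv_lhs => rw [exists_purification hA]
    rw [sqrt_isHermitian, Matrix.mul_assoc, Matrix.trace_mul_comm]
  rw [h]
  exact (Complex.nonneg_iff.1 (hB.mul_mul_conjTranspose_same _).trace_nonneg).1

theorem trace_mul_re_mono {A B C : Matrix a a ℂ} (h : A ≤ B) (hC : C.PosSemidef) :
    (A * C).trace.re ≤ (B * C).trace.re := by
  have := trace_mul_re_nonneg (Matrix.le_iff.1 h) hC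
  rw [Matrix.sub_mul, Matrix.trace_sub, Complex.sub_re] at this
  linarith

theorem typeIIError_le [DecidableEq a] {ε : ℝ} {ρ σ Λ : Matrix a a ℂ} (hσ : σ.PosSemidef)
    (h0 : 0 ≤ Λ) (h1 : Λ ≤ 1) (h : 1 - ε ≤ (Λ * ρ).trace.re) :
    typeIIError ε ρ σ ≤ (Λ * σ).trace.re := by
  refine csInf_le ⟨0, ?_⟩ ⟨Λ, h0, h1, h, rfl⟩
  rintro t ⟨Λ', h0', -, -, rfl⟩
  exact trace_mul_re_nonneg (Matrix.nonneg_iff_posSemidef.1 h0') hσ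

/-- The infimum must range over a nonempty set to be meaningful in the reals. The trivial test Λ = 1
is feasible because ρ has unit trace and ε ≥ 0. -/
theorem le_typeIIError [DecidableEq a] {ε x : ℝ} (hε : 0 ≤ ε) {ρ σ : Matrix a a ℂ}
    (hρ : IsState ρ)
    (h : ∀ Λ : Matrix a a ℂ, 0 ≤ Λ → Λ ≤ 1 → 1 - ε ≤ (Λ * ρ).trace.re → x ≤ (Λ * σ).trace.re) :
    x ≤ typeIIError ε ρ σ := by
  refine le_csInf ⟨_, 1, ?_, le_rfl, ?_, rfl⟩ ?_
  · exact Matrix.nonneg_iff_posSemidef.2 .one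
  · rw [Matrix.one_mul, hρ.2]
    simpa using hε
  · rintro t ⟨Λ, h0, h1, h2, rfl⟩
    exact h Λ h0 h1 h2

theorem trace_actSnd {Φ : OpMap a b} (h : ∀ X, (Φ X).trace = X.trace)
    (X : Matrix (r × a) (r × a) ℂ) : (actSnd Φ X).trace = X.trace := by
  simp only [Matrix.trace, Matrix.diag_apply, Fintype.sum_prod_type, actSnd, Matrix.of_apply]
  refine Finset.sum_congr rfl fun x _ => ?_
  exact h (Matrix.of fun i i' => X (x, i) (x, i'))

theorem IsChannel.isState_actSnd {Φ : OpMap a b} (h : IsChannel Φ)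
    {X : Matrix (r × a) (r × a) ℂ} (hX : IsState X) : IsState (actSnd Φ X) :=
  ⟨h.1.actSnd_posSemidef hX.1, by rw [trace_actSnd h.2, hX.2]⟩

/-- The Kraus operators of the partial trace over the first factor. -/
theorem traceFst_eq_krausMap [DecidableEq a] [DecidableEq b] :
    (traceFst : OpMap (a × b) b)
      = krausMap fun i : a => Matrix.of fun (j : b) (p : a × b) => if p = (i, j) then 1 else 0 := by
  refine LinearMap.ext fun X => Matrix.ext fun j j' => ?_
  simp [traceFst, krausMap_apply, Matrix.sum_apply, Matrix.mul_apply]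

/-- The Kraus operators of the partial trace over the second factor. -/
theorem traceSnd_eq_krausMap [DecidableEq a] [DecidableEq b] :
    (traceSnd : OpMap (a × b) a)
      = krausMap fun i : b => Matrix.of fun (j : a) (p : a × b) => if p = (j, i) then 1 else 0 := by
  refine LinearMap.ext fun X => Matrix.ext fun j j' => ?_
  simp [traceSnd, krausMap_apply, Matrix.sum_apply, Matrix.mul_apply]

theorem trace_traceFst (X : Matrix (a × b) (a × b) ℂ) : (traceFst X).trace = X.trace := by
  simp only [Matrix.trace, traceFst, LinearMap.coe_mk, AddHom.coe_mk, Matrix.diag_apply,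
    Matrix.of_apply, Fintype.sum_prod_type]
  exact Finset.sum_comm

theorem trace_traceSnd (X : Matrix (a × b) (a × b) ℂ) : (traceSnd X).trace = X.trace := by
  simp only [Matrix.trace, traceSnd, LinearMap.coe_mk, AddHom.coe_mk, Matrix.diag_apply,
    Matrix.of_apply, Fintype.sum_prod_type]

theorem isChannel_traceFst : IsChannel (traceFst : OpMap (a × b) b) := by
  classical
  refine ⟨?_, trace_traceFst⟩
  rw [traceFst_eq_krausMap]
  exact isCP_krausMap _

theorem isChannel_traceSnd : IsChannel (traceSnd : OpMap (a × b) a) := by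
  classical
  refine ⟨?_, trace_traceSnd⟩
  rw [traceSnd_eq_krausMap]
  exact isCP_krausMap _

theorem IsChannel.comp {Φ : OpMap b c} {Ψ : OpMap a b} (hΦ : IsChannel Φ) (hΨ : IsChannel Ψ) :
    IsChannel (Φ ∘ₗ Ψ) :=
  ⟨fun _ _ hX => hΦ.1.actSnd_posSemidef (hΨ.1.actSnd_posSemidef hX),
    fun X => (hΦ.2 _).trans (hΨ.2 X)⟩

theorem isChannel_of_mem_freeChannels {N M : OpMap a b} (hM : M ∈ freeChannels N) :
    IsChannel M := by
  obtain ⟨P, hP, -, rfl⟩ := hM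
  exact isChannel_traceFst.comp hP

/-- The extension that appends a fixed pure state at E. -/
theorem freeChannels_nonempty [Nonempty b] {N : OpMap a b} (hN : IsChannel N) :
    (freeChannels N).Nonempty := by
  classical
  obtain ⟨j₀⟩ := ‹Nonempty b›
  let K : Unit → Matrix (b × b) b ℂ := fun _ =>
    Matrix.of fun p j => if p = (j, j₀) then 1 else 0
  have hK : IsChannel (krausMap K) := by
    refine isChannel_krausMap ?_
    ext i j
    simp only [K, Finset.univ_unique, Finset.sum_singleton, Matrix.mul_apply,
      Matrix.conjTranspose_apply, Matrix.of_apply, Matrix.one_apply]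
    rw [Finset.sum_eq_single (i, j₀)]
    · simp
    · intro p _ hp
      simp [hp]
    · simp
  refine ⟨_, krausMap K ∘ₗ N, hK.comp hN, ?_, rfl⟩
  refine LinearMap.ext fun X => Matrix.ext fun j j' => ?_
  simp [traceSnd, krausMap_apply, K, Matrix.mul_apply, ite_and, Finset.sum_ite_eq]

/-! ## The value `J` -/

variable [DecidableEq a] [DecidableEq b]

theorem isState_single {i : a} : IsState (Matrix.single i i (1 : ℂ)) := by
  refine ⟨?_, by simp⟩
  have : Matrix.single i i (1 : ℂ) = Matrix.vecMulVec (Pi.single i 1) (star (Pi.single i 1)) := by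
    ext j k
    simp only [Matrix.single, Matrix.of_apply, Matrix.vecMulVec_apply, Pi.single_apply,
      Pi.star_apply]
    by_cases h : i = j <;> by_cases h' : i = k <;> simp [h, h', eq_comm]
  rw [this]
  exact Matrix.posSemidef_vecMulVec_self_star _

/-- The trivial test has type II error 1 on any input state, and nonemptiness of `a` supplies such a
state. This keeps the infimum defining J away from -∞. -/
theorem DminChannel_nonneg [Nonempty a] {N M : OpMap a b} (hN : IsChannel N) (hM : IsChannel M)
    {ε : ℝ} (hε : 0 ≤ ε) : 0 ≤ DminChannel ε N M := by
  obtain ⟨i⟩ := ‹Nonempty a›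
  have hs : IsState (Matrix.single ((0 : Fin 1), i) ((0 : Fin 1), i) (1 : ℂ)) := isState_single
  refine le_trans ?_ (le_iSup₂_of_le 1 ⟨_, hs⟩ le_rfl)
  rw [Dmin, negLog₂]
  split_ifs with h
  · exact le_top
  · have h1 : typeIIError ε (actSnd N (Matrix.single ((0 : Fin 1), i) ((0 : Fin 1), i) (1 : ℂ)))
        (actSnd M (Matrix.single ((0 : Fin 1), i) ((0 : Fin 1), i) (1 : ℂ))) ≤ 1 := by
      refine (typeIIError_le (Λ := 1) (hM.isState_actSnd hs).1
        (Matrix.nonneg_iff_posSemidef.2 .one) le_rfl ?_).trans ?_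
      · rw [Matrix.one_mul, (hN.isState_actSnd hs).2]
        simpa using hε
      · rw [Matrix.one_mul, (hM.isState_actSnd hs).2]
        simp
    have h2 := Real.logb_nonpos (b := 2) (by norm_num) (not_le.1 h).le h1
    exact_mod_cast neg_nonneg.2 h2

/-- Since the infimum is not -∞, the factor 1/2 in E cancels against the 2 in the exponent of J,
apart from the infinite case in which J = 0. -/
theorem JminChannel_cases [Nonempty a] {N : OpMap a b} (hN : IsChannel N) {ε : ℝ} (hε : 0 ≤ ε) :
    ((⨅ M ∈ freeChannels N, DminChannel ε N M) = ⊤ ∧ JminChannel ε N = 0) ∨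
    ∃ t : ℝ, (⨅ M ∈ freeChannels N, DminChannel ε N M) = (t : EReal) ∧
      JminChannel ε N = (2 : ℝ) ^ (-t) := by
  have h0 : 0 ≤ ⨅ M ∈ freeChannels N, DminChannel ε N M :=
    le_iInf₂ fun M hM => DminChannel_nonneg hN (isChannel_of_mem_freeChannels hM) hε
  rw [JminChannel, EminChannel]
  generalize (⨅ M ∈ freeChannels N, DminChannel ε N M) = I at h0
  induction I with
  | bot => simp at h0
  | top =>
    left
    rw [EReal.coe_mul_top_of_pos (by norm_num)]
    simp
  | coe t =>
    right
    refine ⟨t, rfl, ?_⟩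
    rw [← EReal.coe_mul, if_neg (EReal.coe_ne_top _), EReal.toReal_coe]
    congr 1
    ring

theorem JminChannel_nonneg [Nonempty a] {N : OpMap a b} (hN : IsChannel N) {ε : ℝ} (hε : 0 ≤ ε) :
    0 ≤ JminChannel ε N := by
  obtain ⟨-, h⟩ | ⟨t, -, h⟩ := JminChannel_cases hN hε
  · exact h.ge
  · rw [h]; positivity

/-- With `exists_freeChannel_of_lt_JminChannel`, this characterises J as the supremum over free
channels M of the infimum over inputs of the type II error. From there on, logarithms and extended
reals are no longer needed. -/
theorem le_JminChannel [Nonempty a] {N M : OpMap a b} (hN : IsChannel N) {ε : ℝ} (hε : 0 ≤ ε)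
    (hM : M ∈ freeChannels N) {x : ℝ}
    (h : ∀ (r : ℕ) (ρ : Matrix (Fin r × a) (Fin r × a) ℂ), IsState ρ →
      x ≤ typeIIError ε (actSnd N ρ) (actSnd M ρ)) : x ≤ JminChannel ε N := by
  rcases le_or_gt x 0 with hx | hx
  · exact hx.trans (JminChannel_nonneg hN hε)
  have hI : (⨅ M ∈ freeChannels N, DminChannel ε N M) ≤ ((-Real.logb 2 x : ℝ) : EReal) := by
    refine iInf₂_le_of_le M hM (iSup₂_le fun r ρ => ?_)
    have h1 := h r ρ.1 ρ.2
    rw [Dmin, negLog₂, if_neg (not_le.2 (hx.trans_le h1))]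
    exact_mod_cast neg_le_neg (Real.logb_le_logb_of_le (by norm_num) hx h1)
  obtain ⟨h1, -⟩ | ⟨t, h1, h2⟩ := JminChannel_cases hN hε
  · rw [h1] at hI
    exact absurd (top_le_iff.1 hI) (EReal.coe_ne_top _)
  · rw [h1] at hI
    have h3 : t ≤ -Real.logb 2 x := by exact_mod_cast hI
    rw [h2, ← Real.logb_le_iff_le_rpow (by norm_num) hx]
    linarith

/-- The strict inequality `y < J` spares a proof that the infimum over M is attained. For `y ≤ 0`,
where the logarithm carries no information, every free channel serves. -/
theorem exists_freeChannel_of_lt_JminChannel [Nonempty a] [Nonempty b] {N : OpMap a b}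
    (hN : IsChannel N) {ε : ℝ} (hε : 0 ≤ ε) {y : ℝ} (hy : y < JminChannel ε N) :
    ∃ M ∈ freeChannels N, ∀ (r : ℕ) (ρ : Matrix (Fin r × a) (Fin r × a) ℂ), IsState ρ →
      y ≤ typeIIError ε (actSnd N ρ) (actSnd M ρ) := by
  rcases le_or_gt y 0 with hy0 | hy0
  · obtain ⟨M, hM⟩ := freeChannels_nonempty hN
    refine ⟨M, hM, fun r ρ hρ => hy0.trans (le_typeIIError hε (hN.isState_actSnd hρ) ?_)⟩
    intro Λ h0 _ _
    exact trace_mul_re_nonneg (Matrix.nonneg_iff_posSemidef.1 h0)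
      ((isChannel_of_mem_freeChannels hM).isState_actSnd hρ).1
  obtain ⟨-, h1⟩ | ⟨t, h1, h2⟩ := JminChannel_cases hN hε
  · linarith
  have h3 : (⨅ M ∈ freeChannels N, DminChannel ε N M) < ((-Real.logb 2 y : ℝ) : EReal) := by
    rw [h1]
    rw [h2, ← Real.logb_lt_iff_lt_rpow (by norm_num) hy0] at hy
    exact_mod_cast (by linarith : t < -Real.logb 2 y)
  simp only [iInf_lt_iff] at h3
  obtain ⟨M, hM, h4⟩ := h3
  refine ⟨M, hM, fun r ρ hρ => ?_⟩
  have h5 : Dmin ε (actSnd N ρ) (actSnd M ρ) < ((-Real.logb 2 y : ℝ) : EReal) :=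
    lt_of_le_of_lt (le_iSup₂_of_le r ⟨ρ, hρ⟩ le_rfl) h4
  rw [Dmin, negLog₂] at h5
  split_ifs at h5 with h6
  · exact absurd h5 not_top_lt
  · have h7 : -Real.logb 2 (typeIIError ε (actSnd N ρ) (actSnd M ρ)) < -Real.logb 2 y := by
      exact_mod_cast h5
    exact ((Real.logb_lt_logb_iff (by norm_num) hy0 (not_le.1 h6)).1 (neg_lt_neg_iff.1 h7)).le

/-- Tests on a reference system of any finite index type obey the bound on the type II error. -/
theorem le_trace_of_le_typeIIError {N M : OpMap a b} (hM : IsCP M) {ε x : ℝ}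
    (h : ∀ (r : ℕ) (ρ : Matrix (Fin r × a) (Fin r × a) ℂ), IsState ρ →
      x ≤ typeIIError ε (actSnd N ρ) (actSnd M ρ)) [DecidableEq r]
    {ρ : Matrix (r × a) (r × a) ℂ} (hρ : IsState ρ) {Λ : Matrix (r × b) (r × b) ℂ}
    (h0 : 0 ≤ Λ) (h1 : Λ ≤ 1) (hΛ : 1 - ε ≤ (Λ * actSnd N ρ).trace.re) :
    x ≤ (Λ * actSnd M ρ).trace.re := by
  let q := (Fintype.equivFin r).symm
  let ea : Fin (Fintype.card r) × a ≃ r × a := q.prodCongr (Equiv.refl a)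
  let eb : Fin (Fintype.card r) × b ≃ r × b := q.prodCongr (Equiv.refl b)
  have htr : ∀ Y : Matrix (r × b) (r × b) ℂ,
      (Λ.submatrix eb eb * Y.submatrix eb eb).trace = (Λ * Y).trace := by
    intro Y
    rw [Matrix.submatrix_mul_equiv]
    exact eb.sum_comp fun i => (Λ * Y) i i
  have hstate : IsState (ρ.submatrix ea ea) :=
    ⟨hρ.1.submatrix ea, (ea.sum_comp fun i => ρ i i).trans hρ.2⟩
  have hΦ : ∀ Φ : OpMap a b, actSnd Φ (ρ.submatrix ea ea) = (actSnd Φ ρ).submatrix eb eb :=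
    fun Φ => rfl
  rw [← htr, ← hΦ M]
  refine (h _ _ hstate).trans (typeIIError_le (hM.actSnd_posSemidef hstate.1) ?_ ?_ ?_)
  · exact Matrix.nonneg_iff_posSemidef.2 ((Matrix.nonneg_iff_posSemidef.1 h0).submatrix eb)
  · rw [Matrix.le_iff] at h1 ⊢
    have := h1.submatrix eb
    rwa [Matrix.submatrix_sub, Pi.sub_apply, Pi.sub_apply, Matrix.submatrix_one_equiv] at this
  · rw [hΦ N, htr]
    exact hΛ

end TypeII


/-! ## Semidefinite programming duality -/

section Duality

variable {a b n : Type*} [Fintype a] [Fintype b] [Fintype n] [DecidableEq a] [DecidableEq b]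
  [DecidableEq n]

/-- The entries of G are read off from the values of g on the real basis of matrix units and their
multiples by i, since Re((p - iq)(s + it)) = ps + qt. -/
theorem exists_trace_repr (g : Matrix n n ℂ →ₗ[ℝ] ℝ) :
    ∃ G : Matrix n n ℂ, ∀ X, g X = (G * X).trace.re := by
  refine ⟨Matrix.of fun j i => (g (Matrix.single i j 1) : ℂ)
    - Complex.I * (g (Matrix.single i j Complex.I) : ℂ), fun X => ?_⟩
  have h1 : ∀ i j, g (Matrix.single i j (X i j)) = (X i j).re * g (Matrix.single i j 1)
      + (X i j).im * g (Matrix.single i j Complex.I) := by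
    intro i j
    have : Matrix.single i j (X i j) = (X i j).re • Matrix.single i j (1 : ℂ)
        + (X i j).im • Matrix.single i j Complex.I := by
      rw [Matrix.smul_single, Matrix.smul_single, ← Matrix.single_add]
      congr 1
      simp [Complex.re_add_im]
    rw [this, map_add, map_smul, map_smul, smul_eq_mul, smul_eq_mul]
  conv_lhs => rw [Matrix.matrix_eq_sum_single X]
  simp only [map_sum, h1, Matrix.trace, Matrix.diag_apply, Matrix.mul_apply, Complex.re_sum,
    Matrix.of_apply]
  rw [Finset.sum_comm]
  refine Finset.sum_congr rfl fun j _ => Finset.sum_congr rfl fun i _ => ?_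
  simp
  ring

/-- The functional is extended to all matrices through the self-adjoint part. Replacing G by its
Hermitian part does not change Re Tr[GX] for Hermitian X. -/
theorem exists_hermitian_trace_repr (g : selfAdjoint.submodule ℝ (Matrix n n ℂ) →ₗ[ℝ] ℝ) :
    ∃ G : Matrix n n ℂ, G.IsHermitian ∧ ∀ X, g X = (G * (X : Matrix n n ℂ)).trace.re := by
  obtain ⟨G, hG⟩ := exists_trace_repr (g ∘ₗ (selfAdjointPart ℝ : Matrix n n ℂ →ₗ[ℝ] _))
  refine ⟨(1 / 2 : ℝ) • (G + G.conjTranspose), ?_, fun X => ?_⟩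
  · rw [Matrix.IsHermitian, Matrix.conjTranspose_smul, Matrix.conjTranspose_add,
      Matrix.conjTranspose_conjTranspose, add_comm, star_trivial]
  · have hX : (X : Matrix n n ℂ).conjTranspose = X := X.2
    have h2 : (selfAdjointPart ℝ : Matrix n n ℂ →ₗ[ℝ] _) (X : Matrix n n ℂ) = X := by
      refine Subtype.ext ?_
      exact IsSelfAdjoint.coe_selfAdjointPart_apply ℝ (show IsSelfAdjoint (X : Matrix n n ℂ) from X.2)
    have h1 : g X = (G * (X : Matrix n n ℂ)).trace.re := (congrArg g h2).symm.trans (hG X)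
    have h3 : (G.conjTranspose * (X : Matrix n n ℂ)).trace.re
        = (G * (X : Matrix n n ℂ)).trace.re := by
      rw [← Complex.conj_re, show (starRingEnd ℂ) (G.conjTranspose * (X : Matrix n n ℂ)).trace
        = star (G.conjTranspose * (X : Matrix n n ℂ)).trace from rfl,
        ← Matrix.trace_conjTranspose, Matrix.conjTranspose_mul, Matrix.conjTranspose_conjTranspose,
        hX, Matrix.trace_mul_comm]
    rw [h1, Matrix.smul_mul, Matrix.trace_smul, Complex.smul_re, Matrix.add_mul, Matrix.trace_add,
      Complex.add_re, h3, smul_eq_mul]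
    ring

/-- Self-duality of the positive semidefinite cone, tested on rank-one operators. -/
theorem posSemidef_of_trace_mul_nonneg {G : Matrix n n ℂ} (hG : G.IsHermitian)
    (h : ∀ P : Matrix n n ℂ, P.PosSemidef → 0 ≤ (G * P).trace.re) : G.PosSemidef := by
  refine Matrix.PosSemidef.of_dotProduct_mulVec_nonneg hG fun x => ?_
  have h1 := h _ (Matrix.posSemidef_vecMulVec_self_star x)
  rw [Matrix.mul_vecMulVec, Matrix.trace_vecMulVec, dotProduct_comm] at h1
  exact Complex.nonneg_iff.2 ⟨h1, (hG.im_star_dotProduct_mulVec_self x).symm⟩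

/-- Serves to read off the constraints on a separating functional: an affine function bounded above
on a ray has nonpositive slope. -/
theorem nonpos_of_forall_mul_add_le {x y z : ℝ} (h : ∀ t : ℝ, 0 ≤ t → t * x + y ≤ z) :
    x ≤ 0 := by
  by_contra! hx
  have h1 := h ((|z - y| + 1) / x) (by positivity)
  rw [div_mul_cancel₀ _ hx.ne'] at h1
  linarith [le_abs_self (z - y)]

theorem trace_mul_kronecker_one (σ : Matrix a a ℂ) (Y : Matrix (a × b) (a × b) ℂ) :
    ((σ ⊗ₖ (1 : Matrix b b ℂ)) * Y).trace = (σ * traceSnd Y).trace := by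
  simp only [Matrix.trace, Matrix.diag_apply, Matrix.mul_apply, Fintype.sum_prod_type,
    Matrix.kroneckerMap_apply, traceSnd, LinearMap.coe_mk, AddHom.coe_mk, Matrix.of_apply,
    Matrix.one_apply, mul_ite, mul_one, mul_zero, ite_mul, zero_mul, Finset.sum_ite_eq,
    Finset.mem_univ, if_true, Finset.mul_sum]
  exact Finset.sum_congr rfl fun i _ => Finset.sum_comm

open scoped Matrix.Norms.L2Operator in
theorem le_one_of_norm_le_one {X : Matrix n n ℂ} (hX : IsSelfAdjoint X) (h : ‖X‖ ≤ 1) : X ≤ 1 := by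
  have h1 := IsSelfAdjoint.le_algebraMap_norm_self (a := X) hX
  refine h1.trans ?_
  have h2 : algebraMap ℝ (Matrix n n ℂ) ‖X‖ ≤ algebraMap ℝ (Matrix n n ℂ) 1 := by
    rw [Matrix.le_iff, ← map_sub, Algebra.algebraMap_eq_smul_one]
    exact Matrix.PosSemidef.one.smul (sub_nonneg.2 h)
  simpa using h2

theorem posSemidef_traceSnd {Y : Matrix (a × b) (a × b) ℂ} (h : Y.PosSemidef) :
    (traceSnd Y).PosSemidef := isChannel_traceSnd.1.posSemidef h

open scoped Matrix.Norms.L2Operator in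
/-- Strong duality: a bound `u` on the dual program yields a primal feasible point of value at
most `u`. -/
theorem exists_primal_of_dual_bound {CN CM : Matrix (a × b) (a × b) ℂ} (hN : CN.PosSemidef)
    (hM : CM.PosSemidef) {c u : ℝ}
    (h : ∀ (lam μ : ℝ) (Y : Matrix (a × b) (a × b) ℂ), 0 ≤ lam → 0 ≤ μ → 0 ≤ Y →
      μ • CN ≤ CM + Y → traceSnd Y ≤ lam • (1 : Matrix a a ℂ) → μ * c - lam ≤ u) :
    ∃ (Λ : Matrix (a × b) (a × b) ℂ) (σ : Matrix a a ℂ), Λ.PosSemidef ∧ σ.PosSemidef ∧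
      Λ ≤ σ ⊗ₖ (1 : Matrix b b ℂ) ∧ σ.trace.re ≤ 1 ∧ c ≤ (Λ * CN).trace.re ∧
      (Λ * CM).trace.re ≤ u := by
  let H₁ := selfAdjoint.submodule ℝ (Matrix (a × b) (a × b) ℂ)
  let H₂ := selfAdjoint.submodule ℝ (Matrix a a ℂ)
  -- The hypograph of the dual value as a function of perturbations of the two matrix constraints.
  -- The hypothesis on `u` concerns the unperturbed fibre (·, 0, 0) only.
  let S : Set (ℝ × H₁ × H₂) := {p | ∃ (lam μ : ℝ) (Y : Matrix (a × b) (a × b) ℂ), 0 ≤ lam ∧ 0 ≤ μ ∧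
    0 ≤ Y ∧ p.1 ≤ μ * c - lam ∧ (p.2.1 : Matrix (a × b) (a × b) ℂ) ≤ CM + Y - μ • CN ∧
    (p.2.2 : Matrix a a ℂ) ≤ lam • (1 : Matrix a a ℂ) - traceSnd Y}
  have hS : Convex ℝ S := by
    rintro p ⟨l, m, Y, hl, hm, hY, h1, h2, h3⟩ q ⟨l', m', Y', hl', hm', hY', h1', h2', h3'⟩ s t hs
      ht hst
    refine ⟨s * l + t * l', s * m + t * m', s • Y + t • Y', by positivity, by positivity, ?_, ?_,
      ?_, ?_⟩
    · rw [Matrix.nonneg_iff_posSemidef] at *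
      exact (hY.smul hs).add (hY'.smul ht)
    · have e1 := mul_le_mul_of_nonneg_left h1 hs
      have e2 := mul_le_mul_of_nonneg_left h1' ht
      simp only [Prod.fst_add, Prod.smul_fst, smul_eq_mul]
      linarith
    · rw [Matrix.le_iff] at *
      have e := (h2.smul hs).add (h2'.smul ht)
      have hc : CM = s • CM + t • CM := by rw [← add_smul, hst, one_smul]
      convert e using 1
      simp only [Prod.snd_add, Prod.fst_add, Prod.smul_snd, Prod.smul_fst, Submodule.coe_add,
        Submodule.coe_smul]
      conv_lhs => rw [hc]
      module
    · rw [Matrix.le_iff] at *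
      have e := (h3.smul hs).add (h3'.smul ht)
      convert e using 1
      have e1 : traceSnd (s • Y + t • Y') = s • traceSnd Y + t • traceSnd Y' := by
        rw [map_add, LinearMap.map_smul_of_tower, LinearMap.map_smul_of_tower]
      simp only [Prod.snd_add, Prod.smul_snd, Submodule.coe_add, Submodule.coe_smul]
      rw [e1]
      module
  have htr1 : traceSnd (1 : Matrix (a × b) (a × b) ℂ)
      = (Fintype.card b : ℝ) • (1 : Matrix a a ℂ) := by
    ext i j
    by_cases hij : i = j <;> simp [traceSnd, Matrix.one_apply, hij]
  have hint : (interior S).Nonempty := by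
    let T : Set (ℝ × H₁ × H₂) := Set.Iio (-((Fintype.card b : ℝ) + 1)) ×ˢ
      (Metric.ball 0 1 ×ˢ Metric.ball 0 1)
    have hT : IsOpen T := isOpen_Iio.prod (Metric.isOpen_ball.prod Metric.isOpen_ball)
    refine ⟨(-((Fintype.card b : ℝ) + 2), 0, 0), interior_mono (s := T) ?_ ?_⟩
    · rintro ⟨v, X, Z⟩ ⟨hv, hX, hZ⟩
      have hX1 : (X : Matrix (a × b) (a × b) ℂ) ≤ 1 :=
        le_one_of_norm_le_one X.2 (mem_ball_zero_iff.1 hX).le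
      have hZ1 : (Z : Matrix a a ℂ) ≤ 1 := le_one_of_norm_le_one Z.2 (mem_ball_zero_iff.1 hZ).le
      -- Slater point: Y = 1 has Tr_B Y = |b|·1, so λ = |b| + 1 and μ = 0 leave slack at least 1 in
      -- both matrix constraints. This absorbs every perturbation in the unit balls.
      refine ⟨(Fintype.card b : ℝ) + 1, 0, 1, by positivity, le_rfl, ?_, ?_, ?_, ?_⟩
      · exact Matrix.nonneg_iff_posSemidef.2 .one
      · have : v < -((Fintype.card b : ℝ) + 1) := hv
        simp only
        linarith
      · rw [zero_smul, sub_zero]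
        exact hX1.trans (le_add_of_nonneg_left (Matrix.nonneg_iff_posSemidef.2 hM))
      · rw [htr1, ← sub_smul, add_sub_cancel_left, one_smul]
        exact hZ1
    · rw [hT.interior_eq]
      refine ⟨?_, by simp, by simp⟩
      simp
  -- Otherwise some (u + δ/2, 0, 0) would lie in `S`, a dual value above the bound `u`.
  have hu : ((u, 0, 0) : ℝ × H₁ × H₂) ∉ interior S := by
    intro hmem
    have hcont : Filter.Tendsto (fun t : ℝ => ((u + t, 0, 0) : ℝ × H₁ × H₂)) (nhds 0)
        (nhds (u, 0, 0)) := by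
      have : Continuous fun t : ℝ => ((u + t, 0, 0) : ℝ × H₁ × H₂) := by fun_prop
      simpa using this.tendsto 0
    have h1 := hcont (mem_interior_iff_mem_nhds.1 hmem)
    obtain ⟨δ, hδ, hball⟩ := Metric.mem_nhds_iff.1 (Filter.mem_map.1 h1)
    have h2 : δ / 2 ∈ Metric.ball (0 : ℝ) δ := by
      rw [mem_ball_zero_iff, Real.norm_eq_abs, abs_of_pos (by positivity)]
      linarith
    obtain ⟨l, m, Y, hl, hm, hY, h3, h4, h5⟩ := hball h2
    have h6 := h l m Y hl hm hY (by
      have : (0 : Matrix (a × b) (a × b) ℂ) ≤ CM + Y - m • CN := h4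
      exact sub_nonneg.1 this) (by
      have : (0 : Matrix a a ℂ) ≤ l • (1 : Matrix a a ℂ) - traceSnd Y := h5
      exact sub_nonneg.1 this)
    simp only at h3
    linarith
  obtain ⟨f, hf0, hf⟩ := geometric_hahn_banach_of_nonempty_interior_point hS hu hint
  let f₀ : ℝ := f (1, 0, 0)
  obtain ⟨Λ, hΛh, hΛ⟩ := exists_hermitian_trace_repr
    (f.toLinearMap ∘ₗ LinearMap.inr ℝ ℝ (H₁ × H₂) ∘ₗ LinearMap.inl ℝ H₁ H₂)
  obtain ⟨σ, hσh, hσ⟩ := exists_hermitian_trace_repr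
    (f.toLinearMap ∘ₗ LinearMap.inr ℝ ℝ (H₁ × H₂) ∘ₗ LinearMap.inr ℝ H₁ H₂)
  have hfe : ∀ (v : ℝ) (X : H₁) (Z : H₂), f (v, X, Z) = v * f₀
      + (Λ * (X : Matrix (a × b) (a × b) ℂ)).trace.re + (σ * (Z : Matrix a a ℂ)).trace.re := by
    intro v X Z
    rw [← hΛ, ← hσ]
    have e : ((v, X, Z) : ℝ × H₁ × H₂) = v • ((1, 0, 0) : ℝ × H₁ × H₂) + (0, X, 0) + (0, 0, Z) := by
      simp
    rw [e, map_add, map_add, map_smul]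
    rfl
  -- The separating functional evaluated at the points of `S`, parametrised by the dual variables
  -- and the slacks `v`, `P`, `Q`. Sending one of these parameters to infinity along a ray yields
  -- one primal constraint; setting all of them to zero bounds the primal objective.
  have key : ∀ (lam μ v : ℝ) (Y P : Matrix (a × b) (a × b) ℂ) (Q : Matrix a a ℂ), 0 ≤ lam → 0 ≤ μ →
      Y.PosSemidef → P.PosSemidef → Q.PosSemidef → 0 ≤ v →
      (μ * c - lam - v) * f₀ + ((Λ * CM).trace.re + (Λ * Y).trace.re - μ * (Λ * CN).trace.re
        - (Λ * P).trace.re) + (lam * σ.trace.re - (σ * traceSnd Y).trace.re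
        - (σ * Q).trace.re) ≤ u * f₀ := by
    intro lam μ v Y P Q hl hm hY hP hQ hv
    let X : H₁ := ⟨CM + Y - μ • CN - P, by
      have : (CM + Y - μ • CN - P).IsHermitian :=
        ((hM.1.add hY.1).sub (hN.smul hm).1).sub hP.1
      exact this⟩
    let Z : H₂ := ⟨lam • 1 - traceSnd Y - Q, by
      have : (lam • (1 : Matrix a a ℂ) - traceSnd Y - Q).IsHermitian :=
        ((Matrix.PosSemidef.one.smul hl).1.sub (posSemidef_traceSnd hY).1).sub hQ.1
      exact this⟩
    have h1 := hf (μ * c - lam - v, X, Z) ⟨lam, μ, Y, hl, hm, Matrix.nonneg_iff_posSemidef.2 hY,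
      by simpa using hv, sub_le_self _ (Matrix.nonneg_iff_posSemidef.2 hP),
      sub_le_self _ (Matrix.nonneg_iff_posSemidef.2 hQ)⟩
    rw [hfe, hfe] at h1
    have e1 : (Λ * (X : Matrix (a × b) (a × b) ℂ)).trace.re = (Λ * CM).trace.re
        + (Λ * Y).trace.re - μ * (Λ * CN).trace.re - (Λ * P).trace.re := by
      change (Λ * (CM + Y - μ • CN - P)).trace.re = _
      simp [Matrix.mul_sub, Matrix.mul_add]
    have e2 : (σ * (Z : Matrix a a ℂ)).trace.re = lam * σ.trace.re - (σ * traceSnd Y).trace.re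
        - (σ * Q).trace.re := by
      change (σ * (lam • 1 - traceSnd Y - Q)).trace.re = _
      simp [Matrix.mul_sub]
    rw [e1, e2] at h1
    simpa using h1
  have hf₀ : 0 ≤ f₀ := by
    refine neg_nonpos.1 (nonpos_of_forall_mul_add_le (y := (Λ * CM).trace.re) (z := u * f₀)
      fun t ht => ?_)
    have := key 0 0 t 0 0 0 le_rfl le_rfl .zero .zero .zero ht
    simp at this
    linarith
  have hΛp : Λ.PosSemidef := by
    refine posSemidef_of_trace_mul_nonneg hΛh fun P hP => ?_
    refine neg_nonpos.1 (nonpos_of_forall_mul_add_le (y := (Λ * CM).trace.re) (z := u * f₀)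
      fun t ht => ?_)
    have := key 0 0 0 0 (t • P) 0 le_rfl le_rfl .zero (hP.smul ht) .zero le_rfl
    simp at this
    linarith
  have hσp : σ.PosSemidef := by
    refine posSemidef_of_trace_mul_nonneg hσh fun P hP => ?_
    refine neg_nonpos.1 (nonpos_of_forall_mul_add_le (y := (Λ * CM).trace.re) (z := u * f₀)
      fun t ht => ?_)
    have := key 0 0 0 0 0 (t • P) le_rfl le_rfl .zero .zero (hP.smul ht) le_rfl
    simp at this
    linarith
  have hle : (σ ⊗ₖ (1 : Matrix b b ℂ) - Λ).PosSemidef := by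
    refine posSemidef_of_trace_mul_nonneg ((hσp.kronecker .one).1.sub hΛh) fun P hP => ?_
    refine neg_nonpos.1 (nonpos_of_forall_mul_add_le (y := (Λ * CM).trace.re) (z := u * f₀)
      fun t ht => ?_)
    have := key 0 0 0 (t • P) 0 0 le_rfl le_rfl (hP.smul ht) .zero .zero le_rfl
    rw [LinearMap.map_smul_of_tower] at this
    rw [Matrix.sub_mul, Matrix.trace_sub, trace_mul_kronecker_one]
    simp at this ⊢
    linarith
  have hcN : c * f₀ - (Λ * CN).trace.re ≤ 0 := by
    refine nonpos_of_forall_mul_add_le (y := (Λ * CM).trace.re) (z := u * f₀) fun t ht => ?_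
    have := key 0 t 0 0 0 0 le_rfl ht .zero .zero .zero le_rfl
    simp at this
    linarith
  have hσt : σ.trace.re - f₀ ≤ 0 := by
    refine nonpos_of_forall_mul_add_le (y := (Λ * CM).trace.re) (z := u * f₀) fun t ht => ?_
    have := key t 0 0 0 0 0 ht le_rfl .zero .zero .zero le_rfl
    simp at this
    linarith
  have hcM : (Λ * CM).trace.re ≤ u * f₀ := by
    have := key 0 0 0 0 0 0 le_rfl le_rfl .zero .zero .zero le_rfl
    simpa using this
  -- If f₀ = 0, then Tr σ ≤ f₀ forces σ = 0, then Λ ≤ σ ⊗ 1 forces Λ = 0, so the functional would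
  -- vanish. Dividing by f₀ afterwards normalises Λ and σ.
  have hpos : 0 < f₀ := by
    refine lt_of_le_of_ne hf₀ fun h0 => hf0 ?_
    have hσ0 : σ = 0 := by
      rw [← hσp.trace_eq_zero_iff]
      have h1 := Complex.nonneg_iff.1 hσp.trace_nonneg
      exact Complex.ext (le_antisymm (by simp; linarith) h1.1) h1.2.symm
    have hΛ0 : Λ = 0 := by
      refine le_antisymm ?_ (Matrix.nonneg_iff_posSemidef.2 hΛp)
      have : Λ ≤ σ ⊗ₖ (1 : Matrix b b ℂ) := Matrix.le_iff.2 hle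
      rwa [hσ0, Matrix.zero_kronecker] at this
    refine ContinuousLinearMap.ext fun p => ?_
    obtain ⟨v, X, Z⟩ := p
    rw [hfe, hΛ0, hσ0, ← h0]
    simp
  have hi : 0 ≤ f₀⁻¹ := (inv_pos.2 hpos).le
  have hsm : ∀ A B : Matrix (a × b) (a × b) ℂ, ((f₀⁻¹ • A) * B).trace.re
      = f₀⁻¹ * (A * B).trace.re := by
    intro A B
    rw [Matrix.smul_mul, Matrix.trace_smul, Complex.smul_re, smul_eq_mul]
  refine ⟨f₀⁻¹ • Λ, f₀⁻¹ • σ, hΛp.smul hi, hσp.smul hi, ?_, ?_, ?_, ?_⟩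
  · rw [Matrix.le_iff, Matrix.smul_kronecker, ← smul_sub]
    exact hle.smul hi
  · rw [Matrix.trace_smul, Complex.smul_re, smul_eq_mul, inv_mul_le_iff₀ hpos]
    linarith
  · rw [hsm, inv_mul_eq_div, le_div_iff₀ hpos]
    linarith
  · rw [hsm, inv_mul_le_iff₀ hpos]
    linarith

end Duality


/-! ## The semidefinite program computes `J` -/

section SDP

variable {a b c r : Type*} [Fintype a] [Fintype b] [Fintype c] [Fintype r] [DecidableEq a]
  [DecidableEq b]

theorem choi_comp (Φ : OpMap b c) (P : OpMap a b) : choi (Φ ∘ₗ P) = actSnd Φ (choi P) := rfl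

theorem choi_injective {Φ Ψ : OpMap a b} (h : choi Φ = choi Ψ) : Φ = Ψ := by
  rw [← ofChoi_choi Φ, h, ofChoi_choi]

theorem trace_actSnd_ofChoi (Y : Matrix (a × b) (a × b) ℂ) (ρ : Matrix (r × a) (r × a) ℂ) :
    (actSnd (ofChoi Y) ρ).trace = ((traceSnd Y).transpose * traceFst ρ).trace := by
  simp only [Matrix.trace, Matrix.diag_apply, Fintype.sum_prod_type, actSnd, Matrix.of_apply,
    ofChoi_apply, Matrix.mul_apply, Matrix.transpose_apply, traceSnd, traceFst, LinearMap.coe_mk,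
    AddHom.coe_mk, Finset.sum_mul_sum]
  rw [Finset.sum_comm]
  conv_rhs => rw [Finset.sum_comm]
  conv_lhs => enter [2, j]; rw [Finset.sum_comm]
  rw [Finset.sum_comm]
  refine Finset.sum_congr rfl fun i _ => ?_
  conv_lhs => enter [2, j]; rw [Finset.sum_comm]
  rw [Finset.sum_comm]
  refine Finset.sum_congr rfl fun i' _ => Finset.sum_congr rfl fun j _ =>
    Finset.sum_congr rfl fun x _ => mul_comm _ _

/-- The output trace depends on the input only through its marginal on `a`, paired with the
transpose of Tr_B Y. So λ bounds it uniformly over inputs and reference systems. -/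
theorem trace_actSnd_ofChoi_le {Y : Matrix (a × b) (a × b) ℂ} {lam : ℝ}
    (h : traceSnd Y ≤ (lam : ℂ) • (1 : Matrix a a ℂ)) {ρ : Matrix (r × a) (r × a) ℂ}
    (hρ : IsState ρ) : (actSnd (ofChoi Y) ρ).trace.re ≤ lam := by
  have h1 := trace_mul_re_nonneg (Matrix.le_iff.1 h).transpose
    (isChannel_traceFst.1.posSemidef hρ.1)
  rw [Matrix.transpose_sub, Matrix.sub_mul, Matrix.trace_sub, ← trace_actSnd_ofChoi] at h1
  simp only [Matrix.transpose_smul, Matrix.transpose_one, Matrix.smul_mul, Matrix.one_mul,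
    Matrix.trace_smul, trace_traceFst, hρ.2] at h1
  simpa using h1

/-- Weak duality. The condition Tr_E Γ = C_N makes Γ the Choi operator of an extension of N, trace
preservation being inherited from N; let M be its other marginal and 𝒴 the map with Choi operator Y.
The first constraint says that M + 𝒴 - μN is completely positive, so any test Λ with Tr[Λ N(ρ)] ≥ 1
- ε satisfies μ(1-ε) ≤ Tr[Λ M(ρ)] + Tr[𝒴(ρ)] ≤ Tr[Λ M(ρ)] + λ. -/
theorem sdpValue_le_JminChannel [Nonempty a] {N : OpMap a b} (hN : IsChannel N) {ε : ℝ}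
    (hε : 0 ≤ ε) {v : ℝ} (hv : v ∈ sdpValues ε N) : v ≤ JminChannel ε N := by
  obtain ⟨lam, μ, Y, Γ, hl, hm, hY, hΓ, h1, h2, h3, rfl⟩ := hv
  have hYp := Matrix.nonneg_iff_posSemidef.1 hY
  have hcP : choi (ofChoi Γ) = Γ := choi_ofChoi Γ
  have hPN : traceSnd ∘ₗ ofChoi Γ = N := choi_injective (by
    rw [choi_comp, hcP]
    exact h3)
  have hPc : IsChannel (ofChoi Γ) := by
    refine ⟨isCP_of_choi_posSemidef (by rw [hcP]; exact Matrix.nonneg_iff_posSemidef.1 hΓ),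
      fun X => ?_⟩
    rw [← trace_traceSnd, ← hN.2 X, ← hPN]
    rfl
  have hM : traceFst ∘ₗ ofChoi Γ ∈ freeChannels N := ⟨ofChoi Γ, hPc, hPN, rfl⟩
  have hcM : choi (traceFst ∘ₗ ofChoi Γ) = traceB Γ := by
    rw [choi_comp, hcP]
    rfl
  set M := traceFst ∘ₗ ofChoi Γ
  have hΨ : IsCP (M + ofChoi Y - (μ : ℂ) • N) := by
    refine isCP_of_choi_posSemidef ?_
    have : choi (M + ofChoi Y - (μ : ℂ) • N) = choi M + choi (ofChoi Y) - (μ : ℂ) • choi N := rfl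
    rw [this, choi_ofChoi, hcM]
    exact Matrix.le_iff.1 h1
  refine le_JminChannel hN hε hM fun r ρ hρ => le_typeIIError hε (hN.isState_actSnd hρ)
    fun Λ hΛ0 hΛ1 hΛ => ?_
  have h4 := trace_mul_re_nonneg (Matrix.nonneg_iff_posSemidef.1 hΛ0) (hΨ.actSnd_posSemidef hρ.1)
  have h5 : actSnd (M + ofChoi Y - (μ : ℂ) • N) ρ
      = actSnd M ρ + actSnd (ofChoi Y) ρ - (μ : ℂ) • actSnd N ρ := rfl
  have h6 : IsCP (ofChoi Y) := isCP_of_choi_posSemidef (by rwa [choi_ofChoi])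
  have h7 := trace_mul_re_mono hΛ1 (h6.actSnd_posSemidef hρ.1)
  rw [Matrix.one_mul] at h7
  have h8 := trace_actSnd_ofChoi_le h2 hρ
  rw [h5, Matrix.mul_sub, Matrix.mul_add, Matrix.mul_smul, Matrix.trace_sub, Matrix.trace_add,
    Matrix.trace_smul, smul_eq_mul, Complex.sub_re, Complex.add_re, Complex.re_ofReal_mul] at h4
  have h9 := mul_le_mul_of_nonneg_left hΛ hm
  linarith

theorem trace_choi {N : OpMap a b} (hN : IsChannel N) :
    (choi N).trace = Fintype.card a := by
  have : ∀ i, ∑ j, choi N (i, j) (i, j) = 1 := fun i => by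
    have := hN.2 (Matrix.single i i 1)
    rw [Matrix.trace_single_eq_same] at this
    rw [← this]
    rfl
  simp [Matrix.trace, Fintype.sum_prod_type, this]

/-- The state with purification `W` on the input and a copy of it. -/
theorem actSnd_vec (Φ : OpMap a b) (W : Matrix a a ℂ) :
    actSnd Φ (Matrix.vecMulVec (fun p : a × a => W p.1 p.2) (star fun p : a × a => W p.1 p.2))
      = (W ⊗ₖ (1 : Matrix b b ℂ)) * choi Φ * (W ⊗ₖ (1 : Matrix b b ℂ)).conjTranspose := by
  ext ⟨i, j⟩ ⟨i', j'⟩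
  simp only [actSnd, Matrix.of_apply, map_eq_sum_choi, Matrix.vecMulVec_apply, Pi.star_apply,
    Matrix.mul_apply, Fintype.sum_prod_type, Matrix.kroneckerMap_apply, Matrix.one_apply,
    Matrix.conjTranspose_apply, mul_ite, mul_one, mul_zero, ite_mul, zero_mul, Finset.sum_ite_eq,
    Finset.mem_univ, if_true, apply_ite star, star_zero]
  rw [Finset.sum_comm]
  simp only [Finset.sum_mul]
  refine Finset.sum_congr rfl fun k _ => Finset.sum_congr rfl fun k' _ => ?_
  ring

/-- If σ is invertible of unit trace, the input with amplitude matrix √σ and the test (σ^(-1/2) ⊗ 1)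
Λ (σ^(-1/2) ⊗ 1) reproduce the primal values. The general case is perturbed to this one at the cost
δ. -/
theorem exists_test_of_primal [Nonempty a] {N M : OpMap a b} (hN : IsChannel N)
    (hM : IsChannel M)
    {c u δ : ℝ} (hc : c ≤ 1) (hu : 0 ≤ u) (hδ : 0 < δ) {Λ : Matrix (a × b) (a × b) ℂ}
    {σ : Matrix a a ℂ} (hΛ : Λ.PosSemidef) (hσ : σ.PosSemidef)
    (hle : Λ ≤ σ ⊗ₖ (1 : Matrix b b ℂ)) (htr : σ.trace.re ≤ 1)
    (hcN : c ≤ (Λ * choi N).trace.re) (hcM : (Λ * choi M).trace.re ≤ u) :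
    ∃ (ρ : Matrix (a × a) (a × a) ℂ) (T : Matrix (a × b) (a × b) ℂ), IsState ρ ∧ 0 ≤ T ∧ T ≤ 1 ∧
      c ≤ (T * actSnd N ρ).trace.re ∧ (T * actSnd M ρ).trace.re ≤ u + δ := by
  have hd : (0 : ℝ) < Fintype.card a := by exact_mod_cast Fintype.card_pos
  set d : ℝ := ((Fintype.card a : ℕ) : ℝ) with hdd
  set κ : ℝ := 1 - σ.trace.re with hκ
  have hκ0 : 0 ≤ κ := sub_nonneg.2 htr
  have hδ1 : 0 < 1 + δ := by linarith
  -- Since κ is the missing trace of σ, the perturbed σ' has trace (Tr σ + κ + δ)/(1 + δ) = 1.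
  -- Adding (δ/d)·1 to Λ keeps Λ' ≤ σ' ⊗ 1 and adds exactly δ to Tr[Λ C] for the Choi operator C of
  -- any channel, as Tr C = d.
  let σ' : Matrix a a ℂ := (1 + δ)⁻¹ • (σ + ((κ + δ) / d) • 1)
  let Λ' : Matrix (a × b) (a × b) ℂ := (1 + δ)⁻¹ • (Λ + (δ / d) • 1)
  have hσ' : σ'.PosDef :=
    (Matrix.PosDef.posSemidef_add hσ (Matrix.PosDef.one.smul (by positivity))).smul (by positivity)
  have hσt : σ'.trace = 1 := by
    have h1 : σ.trace = ((σ.trace.re : ℝ) : ℂ) :=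
      Complex.ext rfl (by simpa using (Complex.nonneg_iff.1 hσ.trace_nonneg).2.symm)
    have h2 : (1 + δ)⁻¹ * (σ.trace.re + (κ + δ) / d * d) = 1 := by
      rw [hκ]; field_simp; ring
    simp only [σ', Matrix.trace_smul, Matrix.trace_add, Matrix.trace_one]
    rw [h1]
    have h3 : (Fintype.card a : ℂ) = ((d : ℝ) : ℂ) := by simp [hdd]
    rw [h3]
    simp only [Complex.real_smul]
    exact_mod_cast h2
  have hΛ' : Λ'.PosSemidef := (hΛ.add (Matrix.PosSemidef.one.smul (by positivity))).smul
    (by positivity)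
  have hle' : (σ' ⊗ₖ (1 : Matrix b b ℂ) - Λ').PosSemidef := by
    have e : σ' ⊗ₖ (1 : Matrix b b ℂ) - Λ' = (1 + δ)⁻¹ • ((σ ⊗ₖ (1 : Matrix b b ℂ) - Λ)
        + (κ / d) • 1) := by
      simp only [σ', Λ', Matrix.smul_kronecker, Matrix.add_kronecker, Matrix.one_kronecker_one]
      rw [← smul_sub, add_div, add_smul]
      congr 1
      abel
    rw [e]
    exact ((Matrix.le_iff.1 hle).add (Matrix.PosSemidef.one.smul (by positivity))).smul
      (by positivity)
  have hval : ∀ {Φ : OpMap a b}, IsChannel Φ →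
      (Λ' * choi Φ).trace.re = (1 + δ)⁻¹ * ((Λ * choi Φ).trace.re + δ) := by
    intro Φ hΦ
    simp only [Λ', Matrix.smul_mul, Matrix.add_mul, Matrix.one_mul, Matrix.trace_smul,
      Matrix.trace_add, trace_choi hΦ, Complex.smul_re, Complex.add_re, smul_eq_mul,
      Complex.natCast_re]
    rw [← hdd, div_mul_cancel₀ _ hd.ne']
  set W := CFC.sqrt σ' with hW
  have hWh : W.conjTranspose = W := sqrt_isHermitian _
  have hWW : W * W = σ' := sqrt_mul_sqrt hσ'.posSemidef
  have hWu : IsUnit W.det := by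
    have h1 : IsUnit σ'.det := (Matrix.isUnit_iff_isUnit_det _).1 hσ'.isUnit
    rw [← hWW, Matrix.det_mul] at h1
    exact isUnit_of_mul_isUnit_left h1
  let K : Matrix (a × b) (a × b) ℂ := W⁻¹ ⊗ₖ (1 : Matrix b b ℂ)
  let L : Matrix (a × b) (a × b) ℂ := W ⊗ₖ (1 : Matrix b b ℂ)
  have hKL : K * L = 1 := by
    simp only [K, L, ← Matrix.mul_kronecker_mul, Matrix.nonsing_inv_mul W hWu, Matrix.one_mul,
      Matrix.one_kronecker_one]
  have hLh : L.conjTranspose = L := by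
    simp only [L, Matrix.conjTranspose_kronecker, hWh, Matrix.conjTranspose_one]
  have hKh : K.conjTranspose = K := by
    simp only [K, Matrix.conjTranspose_kronecker, Matrix.conjTranspose_nonsing_inv, hWh,
      Matrix.conjTranspose_one]
  have hLK : L * K = 1 := by
    rw [← hLh, ← hKh, ← Matrix.conjTranspose_mul, hKL, Matrix.conjTranspose_one]
  have hσK : K.conjTranspose * (σ' ⊗ₖ (1 : Matrix b b ℂ)) * K = 1 := by
    have : σ' ⊗ₖ (1 : Matrix b b ℂ) = L * L := by
      simp only [L, ← Matrix.mul_kronecker_mul, hWW, Matrix.one_mul]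
    rw [this, hKh, ← Matrix.mul_assoc, hKL, Matrix.one_mul, hLK]
  let ρ : Matrix (a × a) (a × a) ℂ :=
    Matrix.vecMulVec (fun p : a × a => W p.1 p.2) (star fun p : a × a => W p.1 p.2)
  have hρ : IsState ρ := by
    refine ⟨Matrix.posSemidef_vecMulVec_self_star _, ?_⟩
    rw [← hσt, ← hWW]
    conv_rhs => rw [← hWh]
    rw [trace_conjTranspose_mul]
    simp only [ρ, Matrix.trace, Matrix.diag_apply, Fintype.sum_prod_type, Matrix.vecMulVec_apply,
      Pi.star_apply, mul_comm, hWh]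
  have htrace : ∀ Φ : OpMap a b,
      (K.conjTranspose * Λ' * K * actSnd Φ ρ).trace = (Λ' * choi Φ).trace := by
    intro Φ
    rw [actSnd_vec, hKh]
    change (K * Λ' * K * (L * choi Φ * L.conjTranspose)).trace = _
    rw [hLh, Matrix.mul_assoc L, ← Matrix.mul_assoc (K * Λ' * K), Matrix.mul_assoc (K * Λ'), hKL,
      Matrix.mul_one, Matrix.mul_assoc, Matrix.trace_mul_comm, Matrix.mul_assoc, Matrix.mul_assoc,
      hLK, Matrix.mul_one]
  refine ⟨ρ, K.conjTranspose * Λ' * K, hρ, ?_, ?_, ?_, ?_⟩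
  · exact Matrix.nonneg_iff_posSemidef.2 (hΛ'.conjTranspose_mul_mul_same K)
  · rw [Matrix.le_iff]
    have := hle'.conjTranspose_mul_mul_same K
    rwa [Matrix.mul_sub, Matrix.sub_mul, hσK] at this
  -- The value against N is at least (c + δ)/(1 + δ), which is at least c because c ≤ 1. The value
  -- against M is at most (u + δ)/(1 + δ), at most u + δ because u ≥ 0.
  · rw [htrace, hval hN, inv_mul_eq_div, le_div_iff₀ hδ1]
    nlinarith
  · rw [htrace, hval hM, inv_mul_le_iff₀ hδ1]
    nlinarith

/-- If an upper bound u were below J, pick y strictly between them and a free M with all type II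
errors at least y. With Γ the Choi operator of the extension behind M, u bounds the dual program of
the pair N, M. Strong duality then gives a test with error at most u + (y - u)/2 < y. -/
theorem isLUB_sdpValues [Nonempty a] {N : OpMap a b} (hN : IsChannel N) {ε : ℝ}
    (hε : 0 ≤ ε) : IsLUB (sdpValues ε N) (JminChannel ε N) := by
  refine ⟨fun v hv => sdpValue_le_JminChannel hN hε hv, fun u hu => ?_⟩
  have hb : Nonempty b := by
    by_contra hb
    rw [not_nonempty_iff] at hb
    obtain ⟨i⟩ := ‹Nonempty a›
    have := hN.2 (Matrix.single i i 1)
    simp [Matrix.trace] at this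
  by_contra! hlt
  obtain ⟨y, huy, hyJ⟩ := exists_between hlt
  obtain ⟨M, hM, hy⟩ := exists_freeChannel_of_lt_JminChannel hN hε hyJ
  have hMc := isChannel_of_mem_freeChannels hM
  obtain ⟨P, hP, hPN, hPM⟩ := hM
  have hmem : ∀ (lam μ : ℝ) (Y : Matrix (a × b) (a × b) ℂ), 0 ≤ lam → 0 ≤ μ → 0 ≤ Y →
      μ • choi N ≤ choi M + Y → traceSnd Y ≤ lam • (1 : Matrix a a ℂ) →
      μ * (1 - ε) - lam ≤ u := by
    intro lam μ Y hl hm hY h1 h2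
    refine hu ⟨lam, μ, Y, choi P, hl, hm, hY, Matrix.nonneg_iff_posSemidef.2 hP.1.choi_posSemidef,
      ?_, ?_, ?_, rfl⟩
    · rw [hPM, choi_comp] at h1
      simpa only [traceB, Complex.coe_smul] using h1
    · simpa only [Complex.coe_smul] using h2
    · rw [traceE, ← choi_comp, hPN]
  have hu0 : 0 ≤ u := by
    have := hmem 0 0 0 le_rfl le_rfl le_rfl
      (by simpa using Matrix.nonneg_iff_posSemidef.2 hMc.1.choi_posSemidef) (by simp)
    simpa using this
  obtain ⟨Λ, σ, hΛ, hσ, hle, htr, hcN, hcM⟩ := exists_primal_of_dual_bound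
    hN.1.choi_posSemidef hMc.1.choi_posSemidef hmem
  obtain ⟨ρ, T, hρ, hT0, hT1, hTN, hTM⟩ := exists_test_of_primal hN hMc (by linarith) hu0
    (δ := (y - u) / 2) (by linarith) hΛ hσ hle htr hcN hcM
  have := le_trace_of_le_typeIIError hMc.1 hy hρ hT0 hT1 hTN
  linarith

end SDP


/-! ## Private states -/

section PrivateStates

variable {s t q : Type*} [Fintype s] [Fintype t] [Fintype q] [DecidableEq s] [DecidableEq t] {k : ℕ}

/-- The isometry whose range supports the private states with twisting unitaries `U`. -/
noncomputable def keyIsometry (U : Fin k → Matrix (s × t) (s × t) ℂ) :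
    Matrix ((Fin k × s) × (Fin k × t)) (s × t) ℂ :=
  Matrix.of fun p w => if p.1.1 = p.2.1 then
    ((Real.sqrt k)⁻¹ : ℂ) * U p.1.1 (p.1.2, p.2.2) w else 0

theorem inv_sqrt_mul_inv_sqrt (k : ℕ) :
    ((Real.sqrt k)⁻¹ : ℂ) * star ((Real.sqrt k)⁻¹ : ℂ) = 1 / k := by
  rw [star_inv₀, ← mul_inv, one_div]
  congr 1
  rw [Complex.star_def, Complex.conj_ofReal, ← Complex.ofReal_mul,
    Real.mul_self_sqrt (Nat.cast_nonneg k)]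
  simp

/-- The twisted maximally entangled state is supported on the vectors k^(-1/2) Σ_i |ii⟩ ⊗ U_i w, the
images of w under `keyIsometry U`. -/
theorem privateState_eq (U : Fin k → Matrix (s × t) (s × t) ℂ) (τ : Matrix (s × t) (s × t) ℂ) :
    Matrix.reindex (Equiv.prodProdProdComm (Fin k) (Fin k) s t)
        (Equiv.prodProdProdComm (Fin k) (Fin k) s t)
        (twisting U * (maxEntangled k ⊗ₖ τ) * (twisting U).conjTranspose)
      = keyIsometry U * τ * (keyIsometry U).conjTranspose := by
  ext ⟨⟨i, α⟩, j, β⟩ ⟨⟨i', α'⟩, j', β'⟩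
  simp only [Matrix.reindex_apply, Matrix.submatrix_apply, Equiv.prodProdProdComm_symm,
    Equiv.prodProdProdComm_apply, Matrix.mul_apply, Matrix.conjTranspose_apply, twisting,
    keyIsometry, Matrix.of_apply, Matrix.kroneckerMap_apply, maxEntangled]
  simp_rw [Fintype.sum_prod_type (α₁ := Fin k × Fin k)]
  simp only [ite_mul, zero_mul, Finset.sum_ite_irrel, Finset.sum_const_zero, Finset.sum_ite_eq,
    Finset.mem_univ, if_true, apply_ite star, star_zero, mul_ite, mul_zero]
  have hk := inv_sqrt_mul_inv_sqrt k
  by_cases h' : i' = j'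
  · simp only [h', if_true, and_true]
    by_cases h : i = j
    · subst h
      rw [if_pos rfl]
      refine Finset.sum_congr rfl fun w' _ => ?_
      rw [Finset.sum_eq_single (i, i)]
      · simp only [if_true]
        rw [Finset.sum_mul, Finset.sum_mul]
        refine Finset.sum_congr rfl fun w _ => ?_
        rw [← hk, star_mul']
        ring
      · intro x _ hx
        simp [hx.symm]
      · simp
    · rw [if_neg h]
      refine Finset.sum_eq_zero fun w' _ => ?_
      rw [Finset.sum_eq_zero, zero_mul]
      intro x _
      split_ifs with h1 h2
      · exact absurd (by rw [← h2] at h1; exact h1) h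
      · rfl
      · rfl
  · simp [h']

theorem keyIsometry_gram (hk : 1 ≤ k) {U : Fin k → Matrix (s × t) (s × t) ℂ}
    (hU : ∀ i, U i ∈ Matrix.unitaryGroup (s × t) ℂ) :
    (keyIsometry U).conjTranspose * keyIsometry U = 1 := by
  ext w w'
  have h1 : ∀ i, ∑ α, ∑ β, star (U i (α, β) w) * U i (α, β) w' = (1 : Matrix (s × t) (s × t) ℂ) w w' := by
    intro i
    rw [← Matrix.mem_unitaryGroup_iff'.1 (hU i), Matrix.star_eq_conjTranspose, Matrix.mul_apply,
      Fintype.sum_prod_type]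
    rfl
  have h2 : ∀ (i : Fin k) (α : s), ∑ j, ∑ β, star (keyIsometry U ((i, α), (j, β)) w)
      * keyIsometry U ((i, α), (j, β)) w'
      = (1 / k : ℂ) * ∑ β, star (U i (α, β) w) * U i (α, β) w' := by
    intro i α
    rw [Finset.sum_eq_single i]
    · rw [Finset.mul_sum]
      refine Finset.sum_congr rfl fun β _ => ?_
      simp only [keyIsometry, Matrix.of_apply, if_true, star_mul', ← inv_sqrt_mul_inv_sqrt k]
      ring
    · intro j _ hj
      simp [keyIsometry, hj.symm]
    · simp
  simp only [Matrix.mul_apply, Matrix.conjTranspose_apply, Fintype.sum_prod_type, h2]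
  simp only [← Finset.mul_sum, h1]
  have : (k : ℂ) ≠ 0 := by
    have : k ≠ 0 := by omega
    exact_mod_cast this
  simp [this]

/-- The projection onto private states of the first and second of three systems. -/
noncomputable def keyIsometryFst (U : Fin k → Matrix (s × t) (s × t) ℂ) :
    Matrix ((Fin k × s) × ((Fin k × t) × (Fin k × t))) ((s × t) × (Fin k × t)) ℂ :=
  Matrix.of fun p w => if p.2.2 = w.2 then keyIsometry U (p.1, p.2.1) w.1 else 0

/-- The projection onto private states of the first and third of three systems. -/
noncomputable def keyIsometrySnd (U : Fin k → Matrix (s × t) (s × t) ℂ) :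
    Matrix ((Fin k × s) × ((Fin k × t) × (Fin k × t))) ((s × t) × (Fin k × t)) ℂ :=
  Matrix.of fun p w => if p.2.1 = w.2 then keyIsometry U (p.1, p.2.2) w.1 else 0

theorem keyIsometryFst_mul (U : Fin k → Matrix (s × t) (s × t) ℂ) (p q) :
    (keyIsometryFst U * (keyIsometryFst U).conjTranspose) p q
      = if p.2.2 = q.2.2 then
          (keyIsometry U * (keyIsometry U).conjTranspose) (p.1, p.2.1) (q.1, q.2.1) else 0 := by
  obtain ⟨x, y, z⟩ := p
  obtain ⟨x', y', z'⟩ := q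
  simp only [Matrix.mul_apply, Matrix.conjTranspose_apply, keyIsometryFst, Matrix.of_apply]
  rw [Fintype.sum_prod_type]
  simp only [ite_mul, zero_mul, Finset.sum_ite_eq, Finset.mem_univ, if_true, apply_ite star,
    star_zero, mul_ite, mul_zero]
  by_cases h : z = z'
  · simp [h]
  · simp [h]

theorem keyIsometrySnd_mul (U : Fin k → Matrix (s × t) (s × t) ℂ) (p q) :
    (keyIsometrySnd U * (keyIsometrySnd U).conjTranspose) p q
      = if p.2.1 = q.2.1 then
          (keyIsometry U * (keyIsometry U).conjTranspose) (p.1, p.2.2) (q.1, q.2.2) else 0 := by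
  obtain ⟨x, y, z⟩ := p
  obtain ⟨x', y', z'⟩ := q
  simp only [Matrix.mul_apply, Matrix.conjTranspose_apply, keyIsometrySnd, Matrix.of_apply]
  rw [Fintype.sum_prod_type]
  simp only [ite_mul, zero_mul, Finset.sum_ite_eq, Finset.mem_univ, if_true, apply_ite star,
    star_zero, mul_ite, mul_zero]
  by_cases h : y = y'
  · simp [h]
  · simp [h]

theorem trace_mul_actSnd_traceSnd {x y z : Type*} [Fintype x] [Fintype y] [Fintype z]
    [DecidableEq z] (T : Matrix (x × y) (x × y) ℂ) (Ω : Matrix (x × (y × z)) (x × (y × z)) ℂ) :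
    ((Matrix.of fun p q : x × (y × z) => if p.2.2 = q.2.2 then T (p.1, p.2.1) (q.1, q.2.1) else 0) * Ω).trace
      = (T * actSnd traceSnd Ω).trace := by
  simp only [Matrix.trace, Matrix.diag_apply, Matrix.mul_apply, Matrix.of_apply, actSnd, traceSnd,
    LinearMap.coe_mk, AddHom.coe_mk, Fintype.sum_prod_type, ite_mul, zero_mul, Finset.sum_ite_eq,
    Finset.mem_univ, if_true, Finset.mul_sum]
  refine Finset.sum_congr rfl fun i _ => Finset.sum_congr rfl fun j _ => ?_
  rw [Finset.sum_comm]
  exact Finset.sum_congr rfl fun i' _ => Finset.sum_comm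

theorem trace_mul_actSnd_traceFst {x y z : Type*} [Fintype x] [Fintype y] [Fintype z]
    [DecidableEq y] (T : Matrix (x × z) (x × z) ℂ) (Ω : Matrix (x × (y × z)) (x × (y × z)) ℂ) :
    ((Matrix.of fun p q : x × (y × z) => if p.2.1 = q.2.1 then T (p.1, p.2.2) (q.1, q.2.2) else 0) * Ω).trace
      = (T * actSnd traceFst Ω).trace := by
  simp only [Matrix.trace, Matrix.diag_apply, Matrix.mul_apply, Matrix.of_apply, actSnd, traceFst,
    LinearMap.coe_mk, AddHom.coe_mk, Fintype.sum_prod_type, ite_mul, zero_mul,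
    Finset.sum_ite_irrel, Finset.sum_const_zero, Finset.sum_ite_eq,
    Finset.mem_univ, if_true, Finset.mul_sum]
  refine Finset.sum_congr rfl fun i _ => ?_
  rw [Finset.sum_comm]
  refine Finset.sum_congr rfl fun j _ => ?_
  rw [Finset.sum_comm]
  exact Finset.sum_congr rfl fun i' _ => Finset.sum_comm

theorem trace_keyIsometryFst (U : Fin k → Matrix (s × t) (s × t) ℂ)
    (Ω : Matrix ((Fin k × s) × ((Fin k × t) × (Fin k × t)))
      ((Fin k × s) × ((Fin k × t) × (Fin k × t))) ℂ) :
    (keyIsometryFst U * (keyIsometryFst U).conjTranspose * Ω).trace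
      = (keyIsometry U * (keyIsometry U).conjTranspose * actSnd traceSnd Ω).trace := by
  rw [← trace_mul_actSnd_traceSnd]
  exact congrArg (fun G => (G * Ω).trace) (Matrix.ext (keyIsometryFst_mul U))

theorem trace_keyIsometrySnd (U : Fin k → Matrix (s × t) (s × t) ℂ)
    (Ω : Matrix ((Fin k × s) × ((Fin k × t) × (Fin k × t)))
      ((Fin k × s) × ((Fin k × t) × (Fin k × t))) ℂ) :
    (keyIsometrySnd U * (keyIsometrySnd U).conjTranspose * Ω).trace
      = (keyIsometry U * (keyIsometry U).conjTranspose * actSnd traceFst Ω).trace := by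
  rw [← trace_mul_actSnd_traceFst]
  exact congrArg (fun G => (G * Ω).trace) (Matrix.ext (keyIsometrySnd_mul U))

theorem keyIsometryFst_gram (hk : 1 ≤ k) {U : Fin k → Matrix (s × t) (s × t) ℂ}
    (hU : ∀ i, U i ∈ Matrix.unitaryGroup (s × t) ℂ) :
    (keyIsometryFst U).conjTranspose * keyIsometryFst U = 1 := by
  ext ⟨w, z⟩ ⟨w', z'⟩
  have h := congrFun (congrFun (keyIsometry_gram hk hU) w) w'
  simp only [Matrix.mul_apply, Matrix.conjTranspose_apply] at h
  simp only [Matrix.mul_apply, Matrix.conjTranspose_apply, keyIsometryFst, Matrix.of_apply]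
  simp_rw [Fintype.sum_prod_type (α₁ := Fin k × s),
    Fintype.sum_prod_type (α₁ := Fin k × t) (α₂ := Fin k × t)]
  rw [Fintype.sum_prod_type (α₁ := Fin k × s)] at h
  simp only [ite_mul, zero_mul, Finset.sum_ite_eq', Finset.mem_univ, if_true, apply_ite star,
    star_zero, mul_ite, mul_zero]
  by_cases hz : z = z'
  · simp only [hz, if_true, h, Matrix.one_apply, Prod.mk.injEq, and_true]
  · simp [hz, Ne.symm hz]

theorem keyIsometrySnd_gram (hk : 1 ≤ k) {U : Fin k → Matrix (s × t) (s × t) ℂ}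
    (hU : ∀ i, U i ∈ Matrix.unitaryGroup (s × t) ℂ) :
    (keyIsometrySnd U).conjTranspose * keyIsometrySnd U = 1 := by
  ext ⟨w, z⟩ ⟨w', z'⟩
  have h := congrFun (congrFun (keyIsometry_gram hk hU) w) w'
  simp only [Matrix.mul_apply, Matrix.conjTranspose_apply] at h
  simp only [Matrix.mul_apply, Matrix.conjTranspose_apply, keyIsometrySnd, Matrix.of_apply]
  simp_rw [Fintype.sum_prod_type (α₁ := Fin k × s),
    Fintype.sum_prod_type (α₁ := Fin k × t) (α₂ := Fin k × t)]
  rw [Fintype.sum_prod_type (α₁ := Fin k × s)] at h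
  simp only [ite_mul, zero_mul, Finset.sum_ite_irrel, Finset.sum_const_zero, Finset.sum_ite_eq',
    Finset.mem_univ, if_true, apply_ite star, star_zero, mul_ite, mul_zero]
  by_cases hz : z = z'
  · simp only [hz, if_true, h, Matrix.one_apply, Prod.mk.injEq, and_true]
  · simp [hz, Ne.symm hz]

theorem keyIsometry_cross (U : Fin k → Matrix (s × t) (s × t) ℂ) (w w' : s × t)
    (j₀ j₁ : Fin k) (β₀ β₁ : t) :
    ((keyIsometryFst U).conjTranspose * keyIsometrySnd U) (w, (j₀, β₀)) (w', (j₁, β₁))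
      = if j₀ = j₁ then (1 / k : ℂ) * ∑ α, star (U j₀ (α, β₁) w) * U j₀ (α, β₀) w' else 0 := by
  simp only [Matrix.mul_apply, Matrix.conjTranspose_apply, keyIsometryFst, keyIsometrySnd,
    Matrix.of_apply]
  simp_rw [Fintype.sum_prod_type (α₁ := Fin k × s),
    Fintype.sum_prod_type (α₁ := Fin k × t) (α₂ := Fin k × t)]
  simp only [ite_mul, zero_mul, Finset.sum_ite_irrel, Finset.sum_const_zero, Finset.sum_ite_eq',
    Finset.mem_univ, if_true, apply_ite star, star_zero, mul_ite, mul_zero]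
  simp only [keyIsometry, Matrix.of_apply, apply_ite star, star_zero, ite_mul, zero_mul, mul_ite,
    mul_zero, Fintype.sum_prod_type, Finset.sum_ite_irrel, Finset.sum_const_zero,
    Finset.sum_ite_eq', Finset.mem_univ, if_true]
  by_cases h : j₀ = j₁
  · simp only [h, if_true, Finset.mul_sum, ← inv_sqrt_mul_inv_sqrt k, star_mul']
    refine Finset.sum_congr rfl fun α _ => ?_
    ring
  · simp [h]

/-- The heart of the bound. In W₁†W₂ the key indices of the three parties must coincide and the two
normalisations give 1/k. For each key value j, what is left is U_j on the first and third shields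
followed by U_j† on the first and second, a unitary up to relabelling. So all principal angles have
cosine 1/k. -/
theorem keyIsometry_cross_gram {U : Fin k → Matrix (s × t) (s × t) ℂ}
    (hU : ∀ i, U i ∈ Matrix.unitaryGroup (s × t) ℂ) :
    ((keyIsometryFst U).conjTranspose * keyIsometrySnd U)
      * ((keyIsometryFst U).conjTranspose * keyIsometrySnd U).conjTranspose
      = ((1 / k : ℝ) ^ 2) • 1 := by
  ext ⟨w, j, β⟩ ⟨w₂, j₂, β₂⟩
  have hU1 : ∀ i, ∀ w w₂ : s × t, ∑ α, ∑ β, star (U i (α, β) w) * U i (α, β) w₂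
      = (1 : Matrix (s × t) (s × t) ℂ) w w₂ := by
    intro i w w₂
    rw [← Matrix.mem_unitaryGroup_iff'.1 (hU i), Matrix.star_eq_conjTranspose, Matrix.mul_apply,
      Fintype.sum_prod_type]
    rfl
  have hU2 : ∀ i, ∀ w w₂ : s × t, ∑ z, U i w z * star (U i w₂ z)
      = (1 : Matrix (s × t) (s × t) ℂ) w w₂ := by
    intro i w w₂
    rw [← Matrix.mem_unitaryGroup_iff.1 (hU i), Matrix.star_eq_conjTranspose, Matrix.mul_apply]
    rfl
  rw [Matrix.mul_apply, Fintype.sum_prod_type]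
  simp_rw [Fintype.sum_prod_type (α₁ := Fin k)]
  simp only [Matrix.conjTranspose_apply (M := (keyIsometryFst U).conjTranspose * keyIsometrySnd U),
    keyIsometry_cross, ite_mul, zero_mul,
    Finset.sum_ite_irrel, Finset.sum_const_zero, Finset.sum_ite_eq, Finset.mem_univ, if_true,
    apply_ite star, star_zero, mul_ite, mul_zero]
  by_cases hj : j = j₂
  · subst hj
    simp only [if_true]
    have h1 : ∀ (w' : s × t) (β₁ : t),
        (1 / k : ℂ) * (∑ α, star (U j (α, β₁) w) * U j (α, β) w')
          * star ((1 / k : ℂ) * ∑ α, star (U j (α, β₁) w₂) * U j (α, β₂) w')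
        = ∑ α, ∑ α', (1 / k : ℂ) ^ 2 * (star (U j (α, β₁) w) * U j (α', β₁) w₂)
          * (U j (α, β) w' * star (U j (α', β₂) w')) := by
      intro w' β₁
      have : star (1 / k : ℂ) = 1 / k := by simp
      rw [star_mul', this, star_sum, mul_mul_mul_comm, Finset.sum_mul_sum, Finset.mul_sum]
      refine Finset.sum_congr rfl fun α _ => ?_
      rw [Finset.mul_sum]
      refine Finset.sum_congr rfl fun α' _ => ?_
      rw [star_mul', star_star]
      ring
    simp_rw [h1]
    have h2 : (∑ w' : s × t, ∑ β₁ : t, ∑ α : s, ∑ α' : s,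
        (1 / k : ℂ) ^ 2 * (star (U j (α, β₁) w) * U j (α', β₁) w₂)
          * (U j (α, β) w' * star (U j (α', β₂) w')))
        = ∑ α : s, ∑ β₁ : t, ∑ α' : s, (1 / k : ℂ) ^ 2 * (star (U j (α, β₁) w) * U j (α', β₁) w₂)
          * (1 : Matrix (s × t) (s × t) ℂ) (α, β) (α', β₂) := by
      rw [Finset.sum_comm]
      conv_rhs => rw [Finset.sum_comm]
      refine Finset.sum_congr rfl fun β₁ _ => ?_
      rw [Finset.sum_comm]
      refine Finset.sum_congr rfl fun α _ => ?_
      rw [Finset.sum_comm]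
      refine Finset.sum_congr rfl fun α' _ => ?_
      rw [← Finset.mul_sum, hU2]
    rw [h2]
    by_cases hβ : β = β₂
    · simp only [Matrix.one_apply, Prod.mk.injEq, hβ, and_true, mul_ite, mul_one, mul_zero,
        Finset.sum_ite_eq, Finset.mem_univ, if_true, ← Finset.mul_sum, hU1]
      simp [Matrix.smul_apply, Matrix.one_apply]
    · simp [hβ]
  · simp [hj]

end PrivateStates

/-! ## Two tests on one state -/

section Angle

variable {n m₁ m₂ q : Type*} [Fintype n] [Fintype m₁] [Fintype m₂] [Fintype q] [DecidableEq n]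
  [DecidableEq m₁] [DecidableEq m₂]

theorem trace_conjTranspose_mul_self_eq (A : Matrix n q ℂ) :
    (A.conjTranspose * A).trace = ((A.conjTranspose * A).trace.re : ℂ) :=
  Complex.ext rfl (by
    simpa using (Complex.nonneg_iff.1
      (Matrix.posSemidef_conjTranspose_mul_self A).trace_nonneg).2.symm)

/-- If the ranges of two isometries have the same angle everywhere, then a state cannot pass both
of the tests given by the projections onto them with large probability. -/
theorem two_projections {W₁ : Matrix n m₁ ℂ} {W₂ : Matrix n m₂ ℂ}
    (h₁ : W₁.conjTranspose * W₁ = 1) (h₂ : W₂.conjTranspose * W₂ = 1) {κ : ℝ} (hκ : 0 ≤ κ)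
    (hX : (W₁.conjTranspose * W₂) * (W₁.conjTranspose * W₂).conjTranspose = (κ ^ 2) • 1)
    {Ω : Matrix n n ℂ} (hΩ : IsState Ω) {x y : ℝ}
    (hx : x = (W₁ * W₁.conjTranspose * Ω).trace.re)
    (hy : y = (W₂ * W₂.conjTranspose * Ω).trace.re) :
    0 ≤ x ∧ x ≤ 1 ∧ 0 ≤ y ∧ y ≤ 1 ∧
      x * y - Real.sqrt (x * (1 - x) * (y * (1 - y))) ≤ κ * Real.sqrt (x * y) := by
  obtain ⟨Z, hZ⟩ : ∃ Z : Matrix n n ℂ, Ω = Z * Z.conjTranspose := ⟨_, exists_purification hΩ.1⟩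
  have hZ1 : (Z.conjTranspose * Z).trace = 1 := by rw [Matrix.trace_mul_comm, ← hZ, hΩ.2]
  set a := W₁.conjTranspose * Z with ha
  set b := W₂.conjTranspose * Z with hb
  have hat : (a.conjTranspose * a).trace = (x : ℂ) := by
    have : (a.conjTranspose * a).trace = (W₁ * W₁.conjTranspose * Ω).trace := by
      rw [Matrix.trace_mul_comm, ha, Matrix.conjTranspose_mul, Matrix.conjTranspose_conjTranspose,
        hZ, Matrix.mul_assoc W₁, Matrix.trace_mul_comm W₁]
      simp only [Matrix.mul_assoc]
    rw [trace_conjTranspose_mul_self_eq, this, hx]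
  have hbt : (b.conjTranspose * b).trace = (y : ℂ) := by
    have : (b.conjTranspose * b).trace = (W₂ * W₂.conjTranspose * Ω).trace := by
      rw [Matrix.trace_mul_comm, hb, Matrix.conjTranspose_mul, Matrix.conjTranspose_conjTranspose,
        hZ, Matrix.mul_assoc W₂, Matrix.trace_mul_comm W₂]
      simp only [Matrix.mul_assoc]
    rw [trace_conjTranspose_mul_self_eq, this, hy]
  set A := W₁ * a with hA
  set B := W₂ * b with hB
  have hAA : (A.conjTranspose * A).trace = x := by
    rw [hA, Matrix.conjTranspose_mul, Matrix.mul_assoc, ← Matrix.mul_assoc _ W₁, h₁,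
      Matrix.one_mul, hat]
  have hBB : (B.conjTranspose * B).trace = y := by
    rw [hB, Matrix.conjTranspose_mul, Matrix.mul_assoc, ← Matrix.mul_assoc _ W₂, h₂,
      Matrix.one_mul, hbt]
  have hAZ : (A.conjTranspose * Z).trace = x := by
    rw [hA, Matrix.conjTranspose_mul, Matrix.mul_assoc, ← ha, hat]
  have hZB : (Z.conjTranspose * B).trace = y := by
    rw [hB, ← Matrix.mul_assoc]
    have : Z.conjTranspose * W₂ = b.conjTranspose := by
      rw [hb, Matrix.conjTranspose_mul, Matrix.conjTranspose_conjTranspose]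
    rw [this, hbt]
  have hZA : (Z.conjTranspose * A).trace = x := by
    rw [hA, ← Matrix.mul_assoc]
    have : Z.conjTranspose * W₁ = a.conjTranspose := by
      rw [ha, Matrix.conjTranspose_mul, Matrix.conjTranspose_conjTranspose]
    rw [this, hat]
  have hBZ : (B.conjTranspose * Z).trace = y := by
    rw [hB, Matrix.conjTranspose_mul, Matrix.mul_assoc, ← hb, hbt]
  -- A and B are the projections of the unit vector Z onto the two ranges. Their components
  -- orthogonal to Z have squared norms x(1-x) and y(1-y).
  have hCC : ((A - (x : ℂ) • Z).conjTranspose * (A - (x : ℂ) • Z)).trace.re = x * (1 - x) := by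
    simp only [Matrix.conjTranspose_sub, Matrix.conjTranspose_smul, Matrix.sub_mul, Matrix.mul_sub,
      Matrix.smul_mul, Matrix.mul_smul, Matrix.trace_sub, Matrix.trace_smul, hAA, hAZ, hZA, hZ1]
    simp
    try ring
  have hDD : ((B - (y : ℂ) • Z).conjTranspose * (B - (y : ℂ) • Z)).trace.re = y * (1 - y) := by
    simp only [Matrix.conjTranspose_sub, Matrix.conjTranspose_smul, Matrix.sub_mul, Matrix.mul_sub,
      Matrix.smul_mul, Matrix.mul_smul, Matrix.trace_sub, Matrix.trace_smul, hBB, hBZ, hZB, hZ1]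
    simp
    try ring
  have hCD : ((A - (x : ℂ) • Z).conjTranspose * (B - (y : ℂ) • Z)).trace.re
      = (A.conjTranspose * B).trace.re - x * y := by
    simp only [Matrix.conjTranspose_sub, Matrix.conjTranspose_smul, Matrix.sub_mul, Matrix.mul_sub,
      Matrix.smul_mul, Matrix.mul_smul, Matrix.trace_sub, Matrix.trace_smul, hAZ, hZB, hZ1]
    simp
  have hx0 : 0 ≤ x := by
    have := trace_conjTranspose_mul_self_re_nonneg a
    rwa [hat] at this
  have hy0 : 0 ≤ y := by
    have := trace_conjTranspose_mul_self_re_nonneg b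
    rwa [hbt] at this
  have hx1 : 0 ≤ x * (1 - x) := hCC ▸ trace_conjTranspose_mul_self_re_nonneg _
  have hy1 : 0 ≤ y * (1 - y) := hDD ▸ trace_conjTranspose_mul_self_re_nonneg _
  refine ⟨hx0, by nlinarith, hy0, by nlinarith, ?_⟩
  -- Cauchy–Schwarz on the components orthogonal to Z bounds Re⟨A, B⟩ from below.
  have hlow : -Real.sqrt (x * (1 - x) * (y * (1 - y)))
      ≤ (A.conjTranspose * B).trace.re - x * y := by
    have h := norm_trace_conjTranspose_mul_sq_le (A - (x : ℂ) • Z) (B - (y : ℂ) • Z)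
    rw [hCC, hDD] at h
    have h' := Real.le_sqrt_of_sq_le h
    rw [← hCD]
    exact (neg_le_neg h').trans (neg_le_of_abs_le (Complex.abs_re_le_norm _))
  -- The angle hypothesis bounds the same inner product from above: ⟨A, B⟩ = ⟨X†a, b⟩ with ‖X†a‖² =
  -- κ²x and ‖b‖² = y.
  have hup : (A.conjTranspose * B).trace.re ≤ κ * Real.sqrt (x * y) := by
    set X := W₁.conjTranspose * W₂ with hXdef
    have h := norm_trace_conjTranspose_mul_sq_le (X.conjTranspose * a) b
    have e1 : (X.conjTranspose * a).conjTranspose * b = A.conjTranspose * B := by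
      rw [Matrix.conjTranspose_mul, Matrix.conjTranspose_conjTranspose, hXdef, hA, hB,
        Matrix.conjTranspose_mul W₁ a]
      simp only [Matrix.mul_assoc]
    have e2 : ((X.conjTranspose * a).conjTranspose * (X.conjTranspose * a)).trace.re
        = κ ^ 2 * x := by
      rw [Matrix.conjTranspose_mul, Matrix.conjTranspose_conjTranspose, Matrix.mul_assoc,
        ← Matrix.mul_assoc X, hX, Matrix.smul_mul, Matrix.one_mul, Matrix.mul_smul,
        Matrix.trace_smul, hat]
      rw [Complex.smul_re, Complex.ofReal_re, smul_eq_mul]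
    rw [e1, e2, hbt, Complex.ofReal_re] at h
    have h' := Real.le_sqrt_of_sq_le h
    rw [mul_assoc, Real.sqrt_mul (sq_nonneg κ), Real.sqrt_sq hκ] at h'
    exact (Complex.re_le_norm _).trans h'
  linarith

end Angle


/-! ## The bound on the distillable key -/

section Pullback

variable {a b c d r ι κ : Type*} [Fintype a] [Fintype b] [Fintype c] [Fintype d] [Fintype r]
  [Fintype ι] [Fintype κ] [DecidableEq a] [DecidableEq b] [DecidableEq c] [DecidableEq d]
  [DecidableEq r]

theorem actSnd_krausMap_eq_sum (K : ι → Matrix b a ℂ) (X : Matrix (r × a) (r × a) ℂ) :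
    actSnd (krausMap K) X = ∑ q, ((1 : Matrix r r ℂ) ⊗ₖ K q) * X
      * ((1 : Matrix r r ℂ) ⊗ₖ K q).conjTranspose := by
  ext ⟨x, j⟩ ⟨x', j'⟩
  simp only [actSnd, Matrix.of_apply, krausMap_apply, Matrix.sum_apply, Matrix.mul_apply,
    Matrix.conjTranspose_apply, Fintype.sum_prod_type, Matrix.kroneckerMap_apply, Matrix.one_apply,
    ite_mul, one_mul, zero_mul, Finset.sum_ite_irrel, Finset.sum_const_zero, Finset.sum_ite_eq,
    Finset.mem_univ, if_true, apply_ite star, star_zero, mul_ite, mul_zero]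

/-- Tests after a channel are tests before it. -/
theorem exists_pullback_test {Φ : OpMap a b} (hΦ : IsChannel Φ)
    {Λ : Matrix (r × b) (r × b) ℂ} (h0 : 0 ≤ Λ) (h1 : Λ ≤ 1) :
    ∃ T : Matrix (r × a) (r × a) ℂ, 0 ≤ T ∧ T ≤ 1 ∧
      ∀ X, (T * X).trace = (Λ * actSnd Φ X).trace := by
  obtain ⟨K, rfl, hK⟩ := hΦ.exists_kraus le_rfl
  let L := fun q => (1 : Matrix r r ℂ) ⊗ₖ K q
  have hL : ∑ q, (L q).conjTranspose * L q = 1 := by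
    simp only [L, Matrix.conjTranspose_kronecker, Matrix.conjTranspose_one,
      ← Matrix.mul_kronecker_mul, Matrix.one_mul]
    rw [← Matrix.one_kronecker_one, ← hK]
    ext p q
    simp only [Matrix.sum_apply, Matrix.kroneckerMap_apply, Finset.mul_sum]
  have h0' := Matrix.nonneg_iff_posSemidef.1 h0
  refine ⟨∑ q, (L q).conjTranspose * Λ * L q, ?_, ?_, fun X => ?_⟩
  · exact Matrix.nonneg_iff_posSemidef.2
      (Matrix.posSemidef_sum _ fun q _ => h0'.conjTranspose_mul_mul_same _)
  · rw [Matrix.le_iff, ← hL, ← Finset.sum_sub_distrib]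
    refine Matrix.posSemidef_sum _ fun q _ => ?_
    have := (Matrix.le_iff.1 h1).conjTranspose_mul_mul_same (L q)
    rwa [Matrix.mul_sub, Matrix.sub_mul, Matrix.mul_one] at this
  · rw [actSnd_krausMap_eq_sum, Finset.sum_mul, Matrix.mul_sum, Matrix.trace_sum, Matrix.trace_sum]
    refine Finset.sum_congr rfl fun q _ => ?_
    change ((L q).conjTranspose * Λ * L q * X).trace = (Λ * (L q * X * (L q).conjTranspose)).trace
    rw [Matrix.mul_assoc, Matrix.mul_assoc, Matrix.trace_mul_comm]
    simp only [Matrix.mul_assoc]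

/-- `N` acting on the second factor, as a map of operators. -/
def actSndMap {l : Type*} (N : OpMap a b) : OpMap (l × a) (l × b) where
  toFun X := actSnd N X
  map_add' X Y := by
    ext p q
    exact congrFun (congrFun (map_add N (Matrix.of fun i i' => X (p.1, i) (q.1, i'))
      (Matrix.of fun i i' => Y (p.1, i) (q.1, i'))) p.2) q.2
  map_smul' z X := by
    ext p q
    exact congrFun (congrFun (map_smul N z (Matrix.of fun i i' => X (p.1, i) (q.1, i'))) p.2) q.2

/-- The instrument of the sender as a channel that outputs the classical message. -/
def instrument {m : ℕ} (E : Fin m → ι → Matrix a c ℂ) : OpMap c (Fin m × a) :=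
  krausMap fun q : Fin m × ι => Matrix.of fun p i => if q.1 = p.1 then E q.1 q.2 p.2 i else 0

theorem instrument_apply {m : ℕ} (E : Fin m → ι → Matrix a c ℂ) (X : Matrix c c ℂ)
    (p q : Fin m × a) :
    instrument E X p q = if p.1 = q.1 then krausMap (E p.1) X p.2 q.2 else 0 := by
  obtain ⟨l, i⟩ := p
  obtain ⟨l', i'⟩ := q
  simp only [instrument, krausMap_apply, Matrix.sum_apply, Matrix.mul_apply, Matrix.of_apply,
    Matrix.conjTranspose_apply, Fintype.sum_prod_type, ite_mul, zero_mul, Finset.sum_ite_irrel,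
    Finset.sum_const_zero, Finset.sum_ite_eq', Finset.mem_univ, if_true, apply_ite star, star_zero,
    mul_ite, mul_zero]
  by_cases h : l = l'
  · simp [h]
  · simp [h, Ne.symm h]

theorem isChannel_instrument {m : ℕ} {E : Fin m → ι → Matrix a c ℂ}
    (hE : ∑ l, ∑ f, (E l f).conjTranspose * E l f = 1) : IsChannel (instrument E) := by
  refine isChannel_krausMap ?_
  rw [← hE, Fintype.sum_prod_type]
  refine Finset.sum_congr rfl fun l _ => Finset.sum_congr rfl fun f _ => ?_
  ext i i'
  simp only [Matrix.mul_apply, Matrix.conjTranspose_apply, Matrix.of_apply, Fintype.sum_prod_type,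
    apply_ite star, star_zero, ite_mul, zero_mul, mul_ite, mul_zero, Finset.sum_ite_irrel,
    Finset.sum_const_zero, Finset.sum_ite_eq, Finset.mem_univ, if_true]

/-- The decoder of the receiver as a channel that reads the classical message. -/
def controlledDecoder {m : ℕ} (D : Fin m → κ → Matrix d b ℂ) : OpMap (Fin m × b) d :=
  krausMap fun q : Fin m × κ => Matrix.of fun j p => if q.1 = p.1 then D q.1 q.2 j p.2 else 0

theorem controlledDecoder_apply {m : ℕ} (D : Fin m → κ → Matrix d b ℂ)
    (Y : Matrix (Fin m × b) (Fin m × b) ℂ) :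
    controlledDecoder D Y
      = ∑ l, krausMap (D l) (Matrix.of fun j j' => Y (l, j) (l, j')) := by
  ext j j'
  simp only [controlledDecoder, krausMap_apply, Matrix.sum_apply, Matrix.mul_apply, Matrix.of_apply,
    Matrix.conjTranspose_apply, Fintype.sum_prod_type, ite_mul, zero_mul, Finset.sum_ite_irrel,
    Finset.sum_const_zero, Finset.sum_ite_eq, Finset.mem_univ, if_true, apply_ite star, star_zero,
    mul_ite, mul_zero]

theorem isChannel_controlledDecoder {m : ℕ} {D : Fin m → κ → Matrix d b ℂ}
    (hD : ∀ l, ∑ g, (D l g).conjTranspose * D l g = 1) : IsChannel (controlledDecoder D) := by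
  refine isChannel_krausMap ?_
  ext ⟨l, j⟩ ⟨l', j'⟩
  simp only [Fintype.sum_prod_type, Matrix.sum_apply, Matrix.mul_apply, Matrix.conjTranspose_apply,
    Matrix.of_apply, apply_ite star, star_zero, ite_mul, zero_mul, mul_ite, mul_zero,
    Finset.sum_ite_irrel, Finset.sum_const_zero, Finset.sum_ite_eq', Finset.mem_univ, if_true]
  by_cases h : l = l'
  · subst h
    have := congrFun (congrFun (hD l) j) j'
    simp only [Matrix.sum_apply, Matrix.mul_apply, Matrix.conjTranspose_apply] at this
    simp only [if_true, this, Matrix.one_apply, Prod.mk.injEq, true_and]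
  · simp [h, Ne.symm h]

theorem OneWayLOCC.apply_eq_comp {m : ℕ} {Θ : OneWayLOCC a b c d m}
    {E : Fin m → ι → Matrix a c ℂ} {D : Fin m → κ → Matrix d b ℂ}
    (hE : ∀ l, Θ.enc l = krausMap (E l)) (hD : ∀ l, Θ.dec l = krausMap (D l)) (N : OpMap a b) :
    Θ.apply N = controlledDecoder D ∘ₗ actSndMap N ∘ₗ instrument E := by
  refine LinearMap.ext fun X => ?_
  rw [OneWayLOCC.apply, LinearMap.sum_apply, LinearMap.comp_apply, controlledDecoder_apply]
  refine Finset.sum_congr rfl fun l _ => ?_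
  rw [hD, LinearMap.comp_apply, LinearMap.comp_apply, hE]
  refine congrArg _ ?_
  ext j j'
  change N _ j j' = N (Matrix.of fun i i' => instrument E X (l, i) (l, i')) j j'
  refine congrArg (fun M => N M j j') ?_
  ext i i'
  simp [instrument_apply]

/-- Tests after a one-way LOCC superchannel satisfy the bound on the type II error. -/
theorem le_trace_superchannel {m : ℕ} (Θ : OneWayLOCC a b c d m) {N M : OpMap a b} (hM : IsCP M)
    {ε x : ℝ} (h : ∀ (r : ℕ) (ρ : Matrix (Fin r × a) (Fin r × a) ℂ), IsState ρ →
      x ≤ typeIIError ε (actSnd N ρ) (actSnd M ρ))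
    {ψ : Matrix (r × c) (r × c) ℂ} (hψ : IsState ψ) {Λ : Matrix (r × d) (r × d) ℂ}
    (h0 : 0 ≤ Λ) (h1 : Λ ≤ 1) (hΛ : 1 - ε ≤ (Λ * actSnd (Θ.apply N) ψ).trace.re) :
    x ≤ (Λ * actSnd (Θ.apply M) ψ).trace.re := by
  obtain ⟨E, D, hE, hD, hE1, hD1⟩ := Θ.exists_kraus le_rfl
  obtain ⟨T, hT0, hT1, hT⟩ := exists_pullback_test (isChannel_controlledDecoder hD1) h0 h1
  -- The public message bypasses the channel, so it is counted as part of the reference. The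
  -- superchannel then becomes a choice of input state followed by a choice of test.
  let ea : (r × Fin m) × a ≃ r × (Fin m × a) := Equiv.prodAssoc _ _ _
  let eb : (r × Fin m) × b ≃ r × (Fin m × b) := Equiv.prodAssoc _ _ _
  have hst := (isChannel_instrument hE1).isState_actSnd hψ
  set χ := actSnd (instrument E) ψ
  have hρ : IsState (χ.submatrix ea ea) :=
    ⟨hst.1.submatrix ea, (ea.sum_comp fun i => χ i i).trans hst.2⟩
  have htr : ∀ Y : Matrix (r × (Fin m × b)) (r × (Fin m × b)) ℂ,
      (T.submatrix eb eb * Y.submatrix eb eb).trace = (T * Y).trace := by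
    intro Y
    rw [Matrix.submatrix_mul_equiv]
    exact eb.sum_comp fun i => (T * Y) i i
  have hval : ∀ Φ : OpMap a b, (T.submatrix eb eb * actSnd Φ (χ.submatrix ea ea)).trace
      = (Λ * actSnd (Θ.apply Φ) ψ).trace := by
    intro Φ
    have e1 : actSnd Φ (χ.submatrix ea ea) = (actSnd (actSndMap Φ) χ).submatrix eb eb := rfl
    rw [e1, htr, hT, Θ.apply_eq_comp hE hD]
    rfl
  rw [← hval] at hΛ ⊢
  refine le_trace_of_le_typeIIError hM h hρ ?_ ?_ hΛ
  · exact Matrix.nonneg_iff_posSemidef.2 ((Matrix.nonneg_iff_posSemidef.1 hT0).submatrix eb)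
  · rw [Matrix.le_iff] at hT1 ⊢
    have := hT1.submatrix eb
    rwa [Matrix.submatrix_sub, Pi.sub_apply, Pi.sub_apply, Matrix.submatrix_one_equiv] at this

theorem single_prod (i i' : a) (j j' : b) :
    (Matrix.single (i, j) (i', j') (1 : ℂ) : Matrix (a × b) (a × b) ℂ)
      = Matrix.single i i' 1 ⊗ₖ Matrix.single j j' 1 := by
  rw [Matrix.single_kronecker_single, one_mul]

theorem traceSnd_kronecker (A : Matrix a a ℂ) (B : Matrix b b ℂ) :
    traceSnd (A ⊗ₖ B) = B.trace • A := by
  ext i i'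
  simp [traceSnd, Matrix.trace, Finset.mul_sum, mul_comm]

theorem traceFst_kronecker (A : Matrix a a ℂ) (B : Matrix b b ℂ) :
    traceFst (A ⊗ₖ B) = A.trace • B := by
  ext i i'
  simp [traceFst, Matrix.trace, Finset.sum_mul]

theorem krausMap_kronecker_apply (K : κ → Matrix d b ℂ) (A B : Matrix b b ℂ) :
    krausMap (fun g : κ × κ => K g.1 ⊗ₖ K g.2) (A ⊗ₖ B) = krausMap K A ⊗ₖ krausMap K B := by
  simp only [krausMap_apply, Fintype.sum_prod_type, Matrix.conjTranspose_kronecker,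
    ← Matrix.mul_kronecker_mul]
  ext p q
  simp only [Matrix.sum_apply, Matrix.kroneckerMap_apply, Finset.sum_mul_sum]

/-- Matrix units of a product system are product operators, so product operators determine a linear
map. -/
theorem linearMap_ext_kronecker {Φ Ψ : OpMap (b × b) d}
    (h : ∀ A B : Matrix b b ℂ, Φ (A ⊗ₖ B) = Ψ (A ⊗ₖ B)) : Φ = Ψ := by
  refine choi_injective (Matrix.ext fun p q => ?_)
  obtain ⟨⟨i, j⟩, y⟩ := p
  obtain ⟨⟨i', j'⟩, y'⟩ := q
  change Φ (Matrix.single (i, j) (i', j') 1) y y' = Ψ (Matrix.single (i, j) (i', j') 1) y y'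
  rw [single_prod, h]

theorem traceSnd_comp_krausMap {K : κ → Matrix d b ℂ} (hK : ∑ g, (K g).conjTranspose * K g = 1) :
    traceSnd ∘ₗ krausMap (fun g : κ × κ => K g.1 ⊗ₖ K g.2) = krausMap K ∘ₗ traceSnd := by
  refine linearMap_ext_kronecker fun A B => ?_
  rw [LinearMap.comp_apply, LinearMap.comp_apply, krausMap_kronecker_apply, traceSnd_kronecker,
    traceSnd_kronecker, map_smul, (isChannel_krausMap hK).2]

theorem traceFst_comp_krausMap {K : κ → Matrix d b ℂ} (hK : ∑ g, (K g).conjTranspose * K g = 1) :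
    traceFst ∘ₗ krausMap (fun g : κ × κ => K g.1 ⊗ₖ K g.2) = krausMap K ∘ₗ traceFst := by
  refine linearMap_ext_kronecker fun A B => ?_
  rw [LinearMap.comp_apply, LinearMap.comp_apply, krausMap_kronecker_apply, traceFst_kronecker,
    traceFst_kronecker, map_smul, (isChannel_krausMap hK).2]

theorem OneWayLOCC.isChannel_apply {m : ℕ} (Θ : OneWayLOCC a b c d m) {N : OpMap a b}
    (hN : IsChannel N) : IsChannel (Θ.apply N) := by
  constructor
  · obtain ⟨E, D, hE, hD, -, -⟩ := Θ.exists_kraus le_rfl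
    obtain ⟨K, rfl⟩ := hN.1.exists_kraus le_rfl
    rw [OneWayLOCC.apply_eq_krausMap hE hD]
    exact isCP_krausMap _
  · intro X
    rw [OneWayLOCC.apply, LinearMap.sum_apply, Matrix.trace_sum, ← Θ.enc_tp X]
    exact Finset.sum_congr rfl fun l _ => ((Θ.dec_channel l).2 _).trans (hN.2 _)

theorem sum_kronecker_gram {K : κ → Matrix d b ℂ} (hK : ∑ g, (K g).conjTranspose * K g = 1) :
    ∑ g : κ × κ, (K g.1 ⊗ₖ K g.2).conjTranspose * (K g.1 ⊗ₖ K g.2) = 1 := by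
  simp only [Matrix.conjTranspose_kronecker, ← Matrix.mul_kronecker_mul, Fintype.sum_prod_type]
  rw [← Matrix.one_kronecker_one]
  conv_rhs => rw [← hK]
  ext p q
  simp only [Matrix.sum_apply, Matrix.kroneckerMap_apply, Finset.sum_mul_sum]

/-- A one-way LOCC superchannel maps extensions of a channel to extensions. -/
theorem exists_extension_superchannel {m : ℕ} (Θ : OneWayLOCC a b c d m) {P : OpMap a (b × b)}
    (hP : IsChannel P) : ∃ Q : OpMap c (d × d), IsChannel Q ∧
      traceSnd ∘ₗ Q = Θ.apply (traceSnd ∘ₗ P) ∧ traceFst ∘ₗ Q = Θ.apply (traceFst ∘ₗ P) := by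
  obtain ⟨-, D, -, hD, -, hD1⟩ := Θ.exists_kraus le_rfl
  -- The decoder belonging to the public message is run on both B and E, which is possible because
  -- the message is classical. Tracing out one copy leaves the decoder on the other, by trace
  -- preservation.
  let Θ' : OneWayLOCC a (b × b) c (d × d) m :=
    { enc := Θ.enc
      dec := fun l => krausMap fun g : Fin (Fintype.card (b × d)) × Fin (Fintype.card (b × d)) =>
        D l g.1 ⊗ₖ D l g.2
      enc_cp := Θ.enc_cp
      enc_tp := Θ.enc_tp
      dec_channel := fun l => isChannel_krausMap (sum_kronecker_gram (hD1 l)) }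
  refine ⟨Θ'.apply P, Θ'.isChannel_apply hP, ?_, ?_⟩
  · refine LinearMap.ext fun X => ?_
    rw [LinearMap.comp_apply, OneWayLOCC.apply, OneWayLOCC.apply, LinearMap.sum_apply,
      LinearMap.sum_apply, map_sum]
    refine Finset.sum_congr rfl fun l _ => ?_
    rw [hD]
    exact LinearMap.congr_fun (traceSnd_comp_krausMap (hD1 l)) _
  · refine LinearMap.ext fun X => ?_
    rw [LinearMap.comp_apply, OneWayLOCC.apply, OneWayLOCC.apply, LinearMap.sum_apply,
      LinearMap.sum_apply, map_sum]
    refine Finset.sum_congr rfl fun l _ => ?_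
    rw [hD]
    exact LinearMap.congr_fun (traceFst_comp_krausMap (hD1 l)) _

end Pullback

/-- Dividing by √(xy) turns the hypothesis into √(xy) - √((1-x)(1-y)) ≤ κ, the cosine of a sum of
two angles. The left side increases in x and y, so the lower bounds 1 - ε and z may be inserted. The
condition ε < z ≤ y ≤ 1 ensures x, y > 0. -/
theorem sqrt_bound_of_angle {ε x y z κ : ℝ} (hε : 0 ≤ ε) (hεz : ε < z) (hx : 1 - ε ≤ x)
    (hz : z ≤ y) (hy1 : y ≤ 1)
    (h : x * y - Real.sqrt (x * (1 - x) * (y * (1 - y))) ≤ κ * Real.sqrt (x * y)) :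
    Real.sqrt ((1 - ε) * z) - Real.sqrt (ε * (1 - z)) ≤ κ := by
  have hx0 : 0 < x := by linarith
  have hy0 : 0 < y := by linarith
  have hs : 0 < Real.sqrt (x * y) := Real.sqrt_pos.2 (mul_pos hx0 hy0)
  have e1 : x * y = Real.sqrt (x * y) * Real.sqrt (x * y) :=
    (Real.mul_self_sqrt (mul_pos hx0 hy0).le).symm
  have e2 : Real.sqrt (x * (1 - x) * (y * (1 - y)))
      = Real.sqrt (x * y) * Real.sqrt ((1 - x) * (1 - y)) := by
    rw [← Real.sqrt_mul (mul_pos hx0 hy0).le]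
    congr 1
    ring
  have h2 : Real.sqrt (x * y) - Real.sqrt ((1 - x) * (1 - y)) ≤ κ := by
    rw [e2] at h
    nth_rewrite 1 [e1] at h
    nlinarith
  have h3 : Real.sqrt ((1 - ε) * z) ≤ Real.sqrt (x * y) :=
    Real.sqrt_le_sqrt (mul_le_mul hx hz (by linarith) hx0.le)
  have h4 : Real.sqrt ((1 - x) * (1 - y)) ≤ Real.sqrt (ε * (1 - z)) :=
    Real.sqrt_le_sqrt (mul_le_mul (by linarith) (by linarith) (by linarith) hε)
  linarith

/-! ### From the angle between the two tests to the bound in J -/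

section Bound

variable {a b : Type*} [Fintype a] [Fintype b] [DecidableEq a] [DecidableEq b]

/-- Monogamy of private correlations. The projection WW† accepts the output for N with probability
at least the fidelity, so as a test it accepts the output for M with probability at least y. Both
outputs are marginals of the single state obtained from the extension Q, on which the two
projections make a fixed angle. -/
theorem sqrt_bound_of_keyAchievable {N M : OpMap a b} (hM : M ∈ freeChannels N)
    {ε y : ℝ} (hε : 0 ≤ ε) (hy : ε < y)
    (h : ∀ (r : ℕ) (ρ : Matrix (Fin r × a) (Fin r × a) ℂ), IsState ρ →
      y ≤ typeIIError ε (actSnd N ρ) (actSnd M ρ)) {k : ℕ} (hk : 1 ≤ k)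
    (hkey : KeyAchievable N ε k) :
    y ≤ 1 ∧ Real.sqrt ((1 - ε) * y) - Real.sqrt (ε * (1 - y)) ≤ 1 / k := by
  obtain ⟨s, t, c, m, ψ, Θ, γ, hψ, ⟨τ, U, hτ, hU, rfl⟩, hF⟩ := hkey
  have hMc := isChannel_of_mem_freeChannels hM
  obtain ⟨P, hP, hPN, hPM⟩ := hM
  obtain ⟨Q, hQ, hQN, hQM⟩ := exists_extension_superchannel Θ hP
  rw [hPN] at hQN
  rw [← hPM] at hQM
  have hΩ : IsState (actSnd Q ψ) := hQ.isState_actSnd hψ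
  have hω : IsState (actSnd (Θ.apply N) ψ) := by
    rw [← hQN]
    exact (isChannel_traceSnd.comp hQ).isState_actSnd hψ
  set W := keyIsometry U with hW
  have hW1 := keyIsometry_gram hk hU
  have hT0 : 0 ≤ W * W.conjTranspose :=
    Matrix.nonneg_iff_posSemidef.2 (Matrix.posSemidef_self_mul_conjTranspose W)
  have hT1 : W * W.conjTranspose ≤ 1 := by
    rw [Matrix.le_iff]
    have hsq : (1 - W * W.conjTranspose)
        = (1 - W * W.conjTranspose).conjTranspose * (1 - W * W.conjTranspose) := by
      rw [Matrix.conjTranspose_sub, Matrix.conjTranspose_mul, Matrix.conjTranspose_conjTranspose,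
        Matrix.conjTranspose_one, Matrix.sub_mul, Matrix.one_mul, Matrix.mul_sub, Matrix.mul_one,
        Matrix.mul_assoc W, ← Matrix.mul_assoc W.conjTranspose, hW1, Matrix.one_mul, sub_self,
        sub_zero]
    rw [hsq]
    exact Matrix.posSemidef_conjTranspose_mul_self _
  rw [privateState_eq] at hF
  have hp := hF.trans (fidelity_isometry_le hω.1 hτ W)
  have hq := le_trace_superchannel Θ hMc.1 h hψ hT0 hT1 hp
  have ep : (W * W.conjTranspose * actSnd (Θ.apply N) ψ).trace
      = (keyIsometryFst U * (keyIsometryFst U).conjTranspose * actSnd Q ψ).trace := by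
    rw [trace_keyIsometryFst, ← hQN]
    rfl
  have eq : (W * W.conjTranspose * actSnd (Θ.apply M) ψ).trace
      = (keyIsometrySnd U * (keyIsometrySnd U).conjTranspose * actSnd Q ψ).trace := by
    rw [trace_keyIsometrySnd, ← hQM]
    rfl
  obtain ⟨-, -, -, hy1, hang⟩ := two_projections (keyIsometryFst_gram hk hU)
    (keyIsometrySnd_gram hk hU) (κ := 1 / k) (by positivity) (keyIsometry_cross_gram hU) hΩ rfl rfl
  rw [ep] at hp
  rw [eq] at hq
  exact ⟨hq.trans hy1, sqrt_bound_of_angle hε hy hp hq hy1 hang⟩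

/-- Read √ε, √(1-ε) and √J, √(1-J) as sines and cosines. The hypothesis bounds the cosine C =
√((1-ε)J) - √(ε(1-J)), positive as J > ε. The fraction in `keyBound` is the tangent of the same
angle, and tan² + 1 = 1/C², whence k ≤ 1/C. -/
theorem logb_le_keyBound {J ε : ℝ} (hε : 0 ≤ ε) (hεJ : ε < J) (hJ : J ≤ 1) {k : ℕ} (hk : 1 ≤ k)
    (h : Real.sqrt ((1 - ε) * J) - Real.sqrt (ε * (1 - J)) ≤ 1 / k) :
    Real.logb 2 k ≤ keyBound J ε := by
  have hk0 : (0 : ℝ) < k := by exact_mod_cast hk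
  have h1ε : 0 ≤ 1 - ε := by linarith
  have hJ0 : 0 ≤ J := by linarith
  have h1J : 0 ≤ 1 - J := by linarith
  rw [keyBound, Real.sqrt_mul hJ0, Real.sqrt_mul hε]
  rw [Real.sqrt_mul h1ε, Real.sqrt_mul hε] at h
  have ha := Real.sq_sqrt hε
  have hb := Real.sq_sqrt h1ε
  have hu := Real.sq_sqrt hJ0
  have hv := Real.sq_sqrt h1J
  have ha0 := Real.sqrt_nonneg ε
  have hb0 := Real.sqrt_nonneg (1 - ε)
  have hu0 := Real.sqrt_nonneg J
  have hv0 := Real.sqrt_nonneg (1 - J)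
  have hau : Real.sqrt ε < Real.sqrt J := Real.sqrt_lt_sqrt hε hεJ
  have hvb : Real.sqrt (1 - J) < Real.sqrt (1 - ε) := Real.sqrt_lt_sqrt h1J (by linarith)
  generalize Real.sqrt ε = α at *
  generalize Real.sqrt (1 - ε) = β at *
  generalize Real.sqrt J = u at *
  generalize Real.sqrt (1 - J) = v at *
  have hc : 0 < β * u - α * v := by
    have := mul_lt_mul'' hau hvb ha0 hv0
    linarith
  have hd : 0 < J - ε := by linarith
  have hdiv : (u * v + α * β) / (J - ε) = (α * u + v * β) / (β * u - α * v) := by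
    rw [div_eq_div_iff hd.ne' hc.ne', ← hu, ← ha]
    have e : β ^ 2 - v ^ 2 = u ^ 2 - α ^ 2 := by linarith
    linear_combination (α * u) * e
  have hsq : ((α * u + v * β) / (β * u - α * v)) ^ 2 + 1 = (1 / (β * u - α * v)) ^ 2 := by
    rw [div_pow, div_pow, div_add_one (by positivity), one_pow]
    congr 1
    have e1 : α ^ 2 + β ^ 2 = 1 := by linarith
    have e2 : u ^ 2 + v ^ 2 = 1 := by linarith
    linear_combination (u ^ 2 + v ^ 2) * e1 + e2
  have hkc : (k : ℝ) ≤ 1 / (β * u - α * v) := by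
    rw [le_div_iff₀ hc]
    rw [le_div_iff₀ hk0] at h
    linarith
  rw [hdiv, hsq, Real.logb_pow]
  push_cast
  have := Real.logb_le_logb_of_le (b := 2) (by norm_num) hk0 hkc
  linarith

/-- Free channels are available only for y < J, so the inequality is proved for those y and passed
to the limit y → J from below by continuity. The bound J ≤ 1 comes from the same y. -/
theorem distillableKey_le [Nonempty a] {N : OpMap a b} (hN : IsChannel N) {ε : ℝ} (hε : 0 ≤ ε)
    (hJ : ε < JminChannel ε N) :
    distillableKey N ε ≤ ((keyBound (JminChannel ε N) ε : ℝ) : EReal) := by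
  have hb : Nonempty b := by
    by_contra hb
    rw [not_nonempty_iff] at hb
    obtain ⟨i⟩ := ‹Nonempty a›
    have := hN.2 (Matrix.single i i 1)
    simp [Matrix.trace] at this
  refine sSup_le ?_
  rintro _ ⟨k, hk, hkey, rfl⟩
  have hy : ∀ y, ε < y → y < JminChannel ε N →
      y ≤ 1 ∧ Real.sqrt ((1 - ε) * y) - Real.sqrt (ε * (1 - y)) ≤ 1 / k := by
    intro y h1 h2
    obtain ⟨M, hM, h⟩ := exists_freeChannel_of_lt_JminChannel hN hε h2
    exact sqrt_bound_of_keyAchievable hM hε h1 h hk hkey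
  have hJ1 : JminChannel ε N ≤ 1 := by
    refine le_of_forall_lt_imp_le_of_dense fun y hyJ => ?_
    rcases le_or_gt y ε with h | h
    · obtain ⟨z, hz1, hz2⟩ := exists_between hJ
      exact h.trans (hz1.le.trans (hy z hz1 hz2).1)
    · exact (hy y h hyJ).1
  have hlim : Real.sqrt ((1 - ε) * JminChannel ε N) - Real.sqrt (ε * (1 - JminChannel ε N))
      ≤ 1 / k := by
    have hcont : Continuous fun y : ℝ => Real.sqrt ((1 - ε) * y) - Real.sqrt (ε * (1 - y)) := by
      fun_prop
    have ht : Filter.Tendsto (fun y : ℝ => Real.sqrt ((1 - ε) * y) - Real.sqrt (ε * (1 - y)))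
        (nhdsWithin (JminChannel ε N) (Set.Iio (JminChannel ε N)))
        (nhds (Real.sqrt ((1 - ε) * JminChannel ε N) - Real.sqrt (ε * (1 - JminChannel ε N)))) :=
      (hcont.tendsto _).mono_left nhdsWithin_le_nhds
    refine le_of_tendsto ht ?_
    filter_upwards [Ioo_mem_nhdsLT hJ] with y hyy
    exact (hy y hyy.1 hyy.2).2
  exact_mod_cast logb_le_keyBound hε hJ hJ1 hk hlim

end Bound


/-! ## Private communication from key distillation -/

theorem fidelity_le_trace_mul_trace {n : Type*} [Fintype n] [DecidableEq n] {ρ σ : Matrix n n ℂ}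
    (hρ : ρ.PosSemidef) (hσ : σ.PosSemidef) : fidelity ρ σ ≤ ρ.trace.re * σ.trace.re := by
  set S := CFC.sqrt ρ
  set R := CFC.sqrt σ
  have hS : ρ = S * S.conjTranspose := exists_purification hρ
  have hR : σ = R * R.conjTranspose := exists_purification hσ
  obtain ⟨U, hU, h⟩ := exists_unitary_trace_eq_sqrt_fidelity S R
  have hU2 : U * U.conjTranspose = 1 := Matrix.mem_unitaryGroup_iff.1 hU
  have hcs := norm_trace_conjTranspose_mul_sq_le S (R * U)
  have e : ((R * U).conjTranspose * (R * U)).trace = σ.trace := by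
    rw [Matrix.trace_mul_comm, Matrix.conjTranspose_mul, Matrix.mul_assoc,
      ← Matrix.mul_assoc U, hU2, Matrix.one_mul, ← hR]
  rw [h, e, Matrix.trace_mul_comm, ← hS, ← hR] at hcs
  simpa [Real.sq_sqrt (fidelity_nonneg _ _), abs_of_nonneg (Real.sqrt_nonneg _)] using hcs

/-- A particular σ bounds the real infimum only once the infimum is known to be bounded below. This
follows at one message from the fact that the fidelity is at most the product of the traces. -/
theorem privateError_le {a b e : Type*} [Fintype a] [Fintype b] [Fintype e] [DecidableEq a]
    [DecidableEq b] [DecidableEq e] {n m : ℕ} (hn : 1 ≤ n) (Θ : OneWayLOCC a b (Fin n) (Fin n) m)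
    (V : Matrix (b × e) a ℂ) {σ : Matrix (e × Fin m) (e × Fin m) ℂ} (hσ : IsState σ) {ε : ℝ}
    (h : ∀ x, 1 - ε ≤ fidelity (Matrix.single x x (1 : ℂ) ⊗ₖ σ) (receiverEveState Θ V x)) :
    privateError Θ V ≤ ε := by
  have hne : Nonempty (Fin n) := ⟨⟨0, hn⟩⟩
  have x₀ : Fin n := hne.some
  have hpos : ∀ x, (receiverEveState Θ V x).PosSemidef := by
    obtain ⟨E, D, hE, hD, -, -⟩ := Θ.exists_kraus le_rfl
    intro x
    rw [receiverEveState_eq hE hD]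
    exact Matrix.posSemidef_self_mul_conjTranspose _
  refine (ciInf_le ⟨1 - (receiverEveState Θ V x₀).trace.re, ?_⟩ ⟨σ, hσ⟩).trans ?_
  · rintro _ ⟨σ', rfl⟩
    refine le_trans ?_ (le_ciSup (Set.finite_range _).bddAbove x₀)
    have h1 := fidelity_le_trace_mul_trace
      ((isState_single (i := x₀)).1.kronecker σ'.2.1) (hpos x₀)
    rw [Matrix.trace_kronecker, σ'.2.2, Matrix.trace_single_eq_same] at h1
    simp only [mul_one, Complex.one_re, one_mul] at h1
    linarith
  · exact ciSup_le fun x => by linarith [h x]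

/-! ### The one-time pad protocol and its purification -/

section OneTimePad

variable {a b : Type*} [Fintype a] [Fintype b] [DecidableEq a] [DecidableEq b]
  {n m s t f g : ℕ} {z κ : Type*} [Fintype z] [Fintype κ] [DecidableEq z] [DecidableEq κ]

/-- The blocks of a purification of the locally prepared state. -/
def prepBlock (Ψ : Matrix ((Fin n × Fin s) × z) κ ℂ) (i : Fin n) : Matrix z (Fin s × κ) ℂ :=
  Matrix.of fun j p => Ψ ((i, p.1), j) p.2

/-- Kraus operators of the sender who announces the one-time pad of the message with the key. -/
def padEnc [NeZero n] (E : Fin m → Fin f → Matrix a z ℂ) (Ψ : Matrix ((Fin n × Fin s) × z) κ ℂ)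
    (l : Fin (m * n)) (q : Fin n × ((Fin s × κ) × Fin f)) : Matrix a (Fin n) ℂ :=
  Matrix.of fun i x => if x = q.1 then
    (E (finProdFinEquiv.symm l).1 q.2.2 * prepBlock Ψ ((finProdFinEquiv.symm l).2 - q.1)) i q.2.1
  else 0

/-- Kraus operators of the receiver who decrypts with the key. -/
def padDec [NeZero n] (D : Fin m → Fin g → Matrix (Fin n × Fin t) b ℂ) (l : Fin (m * n))
    (q : (Fin n × Fin t) × Fin g) : Matrix (Fin n) b ℂ :=
  Matrix.of fun y j => if y = (finProdFinEquiv.symm l).2 - q.1.1 then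
    D (finProdFinEquiv.symm l).1 q.2 q.1 j else 0

theorem padEnc_apply [NeZero n] (E : Fin m → Fin f → Matrix a z ℂ)
    (Ψ : Matrix ((Fin n × Fin s) × z) κ ℂ) (l : Fin (m * n))
    (q : Fin n × ((Fin s × κ) × Fin f)) (i : a) (x : Fin n) :
    padEnc E Ψ l q i x = if x = q.1 then (E (finProdFinEquiv.symm l).1 q.2.2
      * prepBlock Ψ ((finProdFinEquiv.symm l).2 - q.1)) i q.2.1 else 0 := rfl

theorem padDec_apply [NeZero n] (D : Fin m → Fin g → Matrix (Fin n × Fin t) b ℂ) (l : Fin (m * n))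
    (q : (Fin n × Fin t) × Fin g) (y : Fin n) (j : b) :
    padDec D l q y j = if y = (finProdFinEquiv.symm l).2 - q.1.1 then
      D (finProdFinEquiv.symm l).1 q.2 q.1 j else 0 := rfl

theorem sum_finProd {M : Type*} [AddCommMonoid M] (F : Fin m × Fin n → M) :
    ∑ l : Fin (m * n), F (finProdFinEquiv.symm l) = ∑ l, ∑ c, F (l, c) := by
  rw [← Fintype.sum_prod_type]
  exact finProdFinEquiv.symm.sum_comp F

theorem sum_trace_kraus_mul {ι : Type*} [Fintype ι] {K : ι → Matrix a z ℂ}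
    (hK : ∑ q, (K q).conjTranspose * K q = 1) {p : Type*} [Fintype p] (A : Matrix z p ℂ) :
    ∑ q, ((K q * A).conjTranspose * (K q * A)).trace = (A.conjTranspose * A).trace := by
  have : A.conjTranspose * A = A.conjTranspose * (∑ q, (K q).conjTranspose * K q) * A := by
    rw [hK, Matrix.mul_one]
  rw [this, Matrix.mul_sum, Matrix.sum_mul, Matrix.trace_sum]
  refine Finset.sum_congr rfl fun q _ => ?_
  rw [Matrix.conjTranspose_mul]
  simp only [Matrix.mul_assoc]

/-- The label `l : Fin (m * n)` is a pair of a public message of the key protocol and a ciphertext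
c, the sum of key and message x. So the sender uses the block of key value c - x, and summing over c
for fixed x is summing over all keys. This recovers the normalisation of Ψ. -/
theorem sum_padEnc [NeZero n] {E : Fin m → Fin f → Matrix a z ℂ}
    (hE : ∑ l, ∑ q, (E l q).conjTranspose * E l q = 1) {Ψ : Matrix ((Fin n × Fin s) × z) κ ℂ}
    (hΨ : (Ψ.conjTranspose * Ψ).trace = 1) :
    ∑ l, ∑ q, (padEnc E Ψ l q).conjTranspose * padEnc E Ψ l q = 1 := by
  ext x x'
  have h0 : ∀ l q, ((padEnc E Ψ l q).conjTranspose * padEnc E Ψ l q) x x'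
      = ∑ i, star (padEnc E Ψ l q i x) * padEnc E Ψ l q i x' := fun l q => Matrix.mul_apply
  simp only [Matrix.sum_apply, h0, padEnc_apply]
  rw [sum_finProd fun lc : Fin m × Fin n => ∑ q : Fin n × ((Fin s × κ) × Fin f), ∑ i,
    star (if x = q.1 then (E lc.1 q.2.2 * prepBlock Ψ (lc.2 - q.1)) i q.2.1 else 0)
      * (if x' = q.1 then (E lc.1 q.2.2 * prepBlock Ψ (lc.2 - q.1)) i q.2.1 else 0)]
  simp_rw [Fintype.sum_prod_type (α₁ := Fin n), Fintype.sum_prod_type (α₂ := Fin f)]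
  simp only [apply_ite star, star_zero, ite_mul, zero_mul, mul_ite, mul_zero, Finset.sum_ite_irrel,
    Finset.sum_const_zero, Finset.sum_ite_eq, Finset.mem_univ, if_true]
  by_cases hx : x = x'
  · subst hx
    simp only [if_true, Matrix.one_apply_eq]
    have h1 : ∀ i : Fin n, ∑ l, ∑ p : Fin s × κ, ∑ w, ∑ j,
        star ((E l w * prepBlock Ψ i) j p) * (E l w * prepBlock Ψ i) j p
        = ((prepBlock Ψ i).conjTranspose * prepBlock Ψ i).trace := by
      intro i
      have h2 := sum_trace_kraus_mul (K := fun q : Fin m × Fin f => E q.1 q.2)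
        (by rw [Fintype.sum_prod_type]; exact hE) (prepBlock Ψ i)
      rw [← h2, Fintype.sum_prod_type]
      refine Finset.sum_congr rfl fun l _ => ?_
      rw [Finset.sum_comm]
      refine Finset.sum_congr rfl fun w _ => ?_
      rw [trace_conjTranspose_mul, Finset.sum_comm]
    rw [Finset.sum_comm]
    simp_rw [h1]
    refine ((Equiv.subRight x).sum_comp fun i =>
      ((prepBlock Ψ i).conjTranspose * prepBlock Ψ i).trace).trans ?_
    rw [← hΨ]
    simp only [trace_conjTranspose_mul, prepBlock, Matrix.of_apply, Fintype.sum_prod_type]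
    refine Finset.sum_congr rfl fun i _ => ?_
    rw [Finset.sum_comm]
  · simp [hx]

theorem sum_padDec [NeZero n] {D : Fin m → Fin g → Matrix (Fin n × Fin t) b ℂ}
    (hD : ∀ l, ∑ q, (D l q).conjTranspose * D l q = 1) (l : Fin (m * n)) :
    ∑ q, (padDec D l q).conjTranspose * padDec D l q = 1 := by
  rw [← hD (finProdFinEquiv.symm l).1]
  ext j j'
  simp only [Matrix.sum_apply, Matrix.mul_apply, Matrix.conjTranspose_apply, padDec,
    Matrix.of_apply, apply_ite star, star_zero, ite_mul, zero_mul, mul_ite, mul_zero,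
    Finset.sum_ite_eq', Finset.mem_univ, if_true]
  rw [Fintype.sum_prod_type, Finset.sum_comm]

/-- The one-time pad superchannel. -/
def padSuperchannel [NeZero n] (E : Fin m → Fin f → Matrix a z ℂ)
    (Ψ : Matrix ((Fin n × Fin s) × z) κ ℂ) (D : Fin m → Fin g → Matrix (Fin n × Fin t) b ℂ)
    (hE : ∑ l, ∑ q, (E l q).conjTranspose * E l q = 1) (hΨ : (Ψ.conjTranspose * Ψ).trace = 1)
    (hD : ∀ l, ∑ q, (D l q).conjTranspose * D l q = 1) :
    OneWayLOCC a b (Fin n) (Fin n) (m * n) :=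
  OneWayLOCC.ofKraus (padEnc E Ψ) (padDec D) (sum_padEnc hE hΨ) (sum_padDec hD)

/-- Each Kraus operator of the encoder has a single nonzero column, and each Kraus operator of the
decoder a single nonzero row. -/
theorem isClassical_padSuperchannel [NeZero n] (E : Fin m → Fin f → Matrix a z ℂ)
    (Ψ : Matrix ((Fin n × Fin s) × z) κ ℂ) (D : Fin m → Fin g → Matrix (Fin n × Fin t) b ℂ)
    (hE : ∑ l, ∑ q, (E l q).conjTranspose * E l q = 1) (hΨ : (Ψ.conjTranspose * Ψ).trace = 1)
    (hD : ∀ l, ∑ q, (D l q).conjTranspose * D l q = 1) :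
    (padSuperchannel E Ψ D hE hΨ hD).IsClassical := by
  refine ⟨fun l X => ?_, fun l X y y' hy => ?_⟩
  · change krausMap (padEnc E Ψ l) X = krausMap (padEnc E Ψ l) (Matrix.diagonal X.diag)
    rw [krausMap_apply, krausMap_apply]
    refine Finset.sum_congr rfl fun q _ => ?_
    have h0 : ∀ Y : Matrix (Fin n) (Fin n) ℂ, padEnc E Ψ l q * Y * (padEnc E Ψ l q).conjTranspose
        = Matrix.of fun i i' => Y q.1 q.1 * (padEnc E Ψ l q i q.1 * star (padEnc E Ψ l q i' q.1)) := by
      intro Y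
      ext i i'
      rw [Matrix.mul_apply, Finset.sum_eq_single q.1, Matrix.mul_apply, Finset.sum_eq_single q.1,
        Matrix.of_apply, Matrix.conjTranspose_apply]
      · ring
      · intro x _ hx
        rw [padEnc_apply, if_neg hx, zero_mul]
      · simp
      · intro x _ hx
        rw [Matrix.conjTranspose_apply, padEnc_apply _ _ _ _ _ x, if_neg hx, star_zero, mul_zero]
      · simp
    rw [h0, h0, Matrix.diagonal_apply_eq, Matrix.diag_apply]
  · change krausMap (padDec D l) X y y' = 0
    rw [krausMap_apply, Matrix.sum_apply]
    refine Finset.sum_eq_zero fun q _ => ?_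
    rw [Matrix.mul_apply]
    refine Finset.sum_eq_zero fun j' _ => ?_
    rw [Matrix.mul_apply, Matrix.conjTranspose_apply, padDec_apply _ _ _ y']
    by_cases h1 : y = (finProdFinEquiv.symm l).2 - q.1.1
    · rw [if_neg fun h => hy (h1.trans h.symm), star_zero, mul_zero]
    · rw [Finset.sum_eq_zero, zero_mul]
      intro j _
      rw [padDec_apply, if_neg h1, zero_mul]

/-- The index of the purifying system in the key distillation protocol. -/
abbrev PurifIndex (m g d f : ℕ) (κ : Type*) := (Fin m × (Fin g × (Fin d × Fin f))) × κ

variable {d : ℕ}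

/-- The purification of the state of receiver and eavesdropper in the one-time pad protocol, in
terms of the purification of the state of the key distillation protocol. -/
def padAmplitude [NeZero n]
    (R : Matrix ((Fin n × Fin s) × (Fin n × Fin t)) (PurifIndex m g d f κ) ℂ)
    (x : Fin n) : Matrix (Fin n × (Fin d × Fin (m * n)))
      ((Fin n × ((Fin s × κ) × Fin f)) × (Fin (m * n) × ((Fin n × Fin t) × Fin g))) ℂ :=
  Matrix.of fun p q => if p.2.2 = q.2.1 ∧ x = q.1.1
      ∧ p.1 = (finProdFinEquiv.symm p.2.2).2 - q.2.2.1.1 then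
    R (((finProdFinEquiv.symm p.2.2).2 - x, q.1.2.1.1), q.2.2.1)
      (((finProdFinEquiv.symm p.2.2).1, (q.2.2.2, (p.2.1, q.1.2.2))), q.1.2.1.2) else 0

theorem eveAmplitude_pad [NeZero n] (E : Fin m → Fin f → Matrix a z ℂ)
    (Ψ : Matrix ((Fin n × Fin s) × z) κ ℂ) (D : Fin m → Fin g → Matrix (Fin n × Fin t) b ℂ)
    (V : Matrix (b × Fin d) a ℂ) (x : Fin n) :
    eveAmplitude (padEnc E Ψ) (padDec D) V x
      = padAmplitude (krausPurification (fun q : Fin m × (Fin g × (Fin d × Fin f)) =>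
            D q.1 q.2.1 * (envOp V q.2.2.1 * E q.1 q.2.2.2)) Ψ) x := by
  ext ⟨y, e, l⟩ ⟨⟨x₀, p, w⟩, l₂, j, v⟩
  have h0 : ∀ i, (envOp V e * padEnc E Ψ l (x₀, (p, w))) i x
      = if x = x₀ then (envOp V e * (E (finProdFinEquiv.symm l).1 w
          * prepBlock Ψ ((finProdFinEquiv.symm l).2 - x))) i p else 0 := by
    intro i
    rw [Matrix.mul_apply]
    split_ifs with hx
    · subst hx
      rw [Matrix.mul_apply]
      exact Finset.sum_congr rfl fun j _ => by rw [padEnc_apply, if_pos rfl]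
    · exact Finset.sum_eq_zero fun j _ => by rw [padEnc_apply, if_neg hx, mul_zero]
  have h1 : (padDec D l (j, v) * (envOp V e * padEnc E Ψ l (x₀, (p, w)))) y x
      = if x = x₀ ∧ y = (finProdFinEquiv.symm l).2 - j.1 then
        (D (finProdFinEquiv.symm l).1 v * (envOp V e * (E (finProdFinEquiv.symm l).1 w
          * prepBlock Ψ ((finProdFinEquiv.symm l).2 - x)))) j p else 0 := by
    rw [Matrix.mul_apply]
    simp only [h0, padDec_apply]
    split_ifs with hy hx hx h h
    all_goals first
      | (exfalso; tauto)
      | rw [Matrix.mul_apply]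
      | simp only [mul_zero, zero_mul, Finset.sum_const_zero]
  simp only [eveAmplitude, padAmplitude, Matrix.of_apply]
  rw [h1, ← ite_and]
  refine if_congr Iff.rfl ?_ rfl
  rw [← Matrix.mul_assoc (envOp V e), ← Matrix.mul_assoc, Matrix.mul_apply]
  rfl

/-- For fixed x, `padAmplitude` only rearranges entries: the sender's key i and the ciphertext c = i
+ x determine each other, and the output y is a function of c and the receiver's key. Hence overlaps
are preserved exactly, for every message. -/
theorem trace_padAmplitude [NeZero n]
    (S R : Matrix ((Fin n × Fin s) × (Fin n × Fin t)) (PurifIndex m g d f κ) ℂ) (x : Fin n) :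
    ((padAmplitude S x).conjTranspose * padAmplitude R x).trace
      = (S.conjTranspose * R).trace := by
  rw [trace_conjTranspose_mul, trace_conjTranspose_mul]
  have h1 : ∀ (e : Fin d) (l : Fin (m * n)),
      ∑ y : Fin n, ∑ q, star (padAmplitude S x (y, (e, l)) q) * padAmplitude R x (y, (e, l)) q
      = ∑ α : Fin s, ∑ r : κ, ∑ w : Fin f, ∑ j : Fin n × Fin t, ∑ v : Fin g,
        star (S (((finProdFinEquiv.symm l).2 - x, α), j)
          (((finProdFinEquiv.symm l).1, (v, (e, w))), r))
        * R (((finProdFinEquiv.symm l).2 - x, α), j)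
          (((finProdFinEquiv.symm l).1, (v, (e, w))), r) := by
    intro e l
    rw [Finset.sum_comm, Fintype.sum_prod_type]
    simp_rw [Fintype.sum_prod_type (α₁ := Fin n) (α₂ := (Fin s × κ) × Fin f),
      Fintype.sum_prod_type (α₁ := Fin s × κ) (α₂ := Fin f),
      Fintype.sum_prod_type (α₁ := Fin s) (α₂ := κ),
      Fintype.sum_prod_type (α₁ := Fin (m * n)), Fintype.sum_prod_type (α₂ := Fin g)]
    simp only [padAmplitude, Matrix.of_apply, ite_and, apply_ite star, star_zero,
      ite_mul, zero_mul, mul_ite, mul_zero, Finset.sum_ite_irrel, Finset.sum_const_zero,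
      Finset.sum_ite_eq, Finset.sum_ite_eq', Finset.mem_univ, if_true]
  rw [Fintype.sum_prod_type, Finset.sum_comm, Fintype.sum_prod_type]
  simp only [h1, ← Fintype.sum_prod_type']
  refine Fintype.sum_equiv
    ({ toFun := fun ⟨e, l, α, r, w, j, v⟩ => ((((finProdFinEquiv.symm l).2 - x, α), j),
        (((finProdFinEquiv.symm l).1, (v, (e, w))), r))
       invFun := fun ⟨⟨⟨i, α⟩, j⟩, ⟨⟨l, v, e, w⟩, r⟩⟩ =>
        (e, finProdFinEquiv (l, i + x), α, r, w, j, v)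
       left_inv := fun ⟨e, l, α, r, w, j, v⟩ => by
        simp only [sub_add_cancel, Prod.mk.eta, Equiv.apply_symm_apply]
       right_inv := fun ⟨⟨⟨i, α⟩, j⟩, ⟨⟨l, v, e, w⟩, r⟩⟩ => by
        simp only [Equiv.symm_apply_apply, add_sub_cancel_right] } :
      Fin d × Fin (m * n) × Fin s × κ × Fin f × (Fin n × Fin t) × Fin g ≃
        ((Fin n × Fin s) × (Fin n × Fin t)) × PurifIndex m g d f κ) _ _ fun q => rfl

/-- A purification of the eavesdropper's ideal state, up to the normalization of the messages. -/
noncomputable def padEve (G : Matrix (Fin s × Fin t) (PurifIndex m g d f κ) ℂ) :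
    Matrix (Fin d × Fin (m * n)) ((Fin s × Fin t) × (Fin (m * n) × ((Fin g × Fin f) × κ))) ℂ :=
  Matrix.of fun p q => if p.2 = q.2.1 then ((√(n : ℝ) : ℝ) : ℂ)⁻¹ * G q.1
    (((finProdFinEquiv.symm p.2).1, (q.2.2.1.1, (p.1, q.2.2.1.2))), q.2.2.2) else 0

theorem sum_unitary_mul {ι κ : Type*} [Fintype ι] [DecidableEq ι] {W : Matrix ι ι ℂ}
    (hW : W ∈ Matrix.unitaryGroup ι ℂ) (G : Matrix ι κ ℂ) (q q' : κ) :
    ∑ w, (W * G) w q * star ((W * G) w q') = ∑ w, G w q * star (G w q') := by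
  have h : ((W * G).conjTranspose * (W * G)) q' q = (G.conjTranspose * G) q' q := by
    rw [Matrix.conjTranspose_mul, Matrix.mul_assoc, ← Matrix.mul_assoc _ W,
      show W.conjTranspose * W = 1 from Matrix.mem_unitaryGroup_iff'.1 hW, Matrix.one_mul]
  simpa only [Matrix.mul_apply, Matrix.conjTranspose_apply, mul_comm] using h

theorem keyIsometry_mul_apply {s t κ : Type*} [Fintype s] [Fintype t]
    (U : Fin n → Matrix (s × t) (s × t) ℂ) (G : Matrix (s × t) κ ℂ)
    (p : (Fin n × s) × (Fin n × t)) (q : κ) :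
    (keyIsometry U * G) p q = if p.1.1 = p.2.1 then
      ((√(n : ℝ) : ℝ) : ℂ)⁻¹ * (U p.1.1 * G) (p.1.2, p.2.2) q else 0 := by
  rw [Matrix.mul_apply, Matrix.mul_apply]
  simp only [keyIsometry, Matrix.of_apply]
  split_ifs
  · rw [Finset.mul_sum]
    exact Finset.sum_congr rfl fun _ _ => by rw [mul_assoc]
  · simp

/-- In a private state both keys equal c - x, so the decrypted value c - (c - x) is x with
certainty. -/
theorem padAmplitude_keyIsometry_apply [NeZero n]
    (U : Fin n → Matrix (Fin s × Fin t) (Fin s × Fin t) ℂ)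
    (G : Matrix (Fin s × Fin t) (PurifIndex m g d f κ) ℂ) (x y : Fin n) (e : Fin d)
    (l : Fin (m * n)) (q) :
    padAmplitude (keyIsometry U * G) x (y, (e, l)) q
      = if y = x then if l = q.2.1 then if x = q.1.1 then
        if (finProdFinEquiv.symm l).2 - x = q.2.2.1.1 then
        ((√(n : ℝ) : ℝ) : ℂ)⁻¹ * (U ((finProdFinEquiv.symm l).2 - x) * G)
          (q.1.2.1.1, q.2.2.1.2)
          (((finProdFinEquiv.symm l).1, (q.2.2.2, (e, q.1.2.2))), q.1.2.1.2) else 0 else 0 else 0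
        else 0 := by
  simp only [padAmplitude, Matrix.of_apply, keyIsometry_mul_apply]
  simp only [← ite_and]
  refine if_congr ?_ rfl rfl
  constructor
  · rintro ⟨⟨h1, h2, h3⟩, h4⟩
    exact ⟨by rw [h3, ← h4, sub_sub_cancel], h1, h2, h4⟩
  · rintro ⟨h1, h2, h3, h4⟩
    exact ⟨⟨h2, h3, by rw [← h4, sub_sub_cancel, h1]⟩, h4⟩

/-- Perfect secrecy in the ideal case. The message enters the eavesdropper's state only through the
twisting unitary U_(c-x) on the shield, and the shield is traced out, so the unitary cancels. What
remains is a state independent of x. -/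
theorem padAmplitude_keyIsometry_mul_conjTranspose [NeZero n]
    {U : Fin n → Matrix (Fin s × Fin t) (Fin s × Fin t) ℂ}
    (hU : ∀ i, U i ∈ Matrix.unitaryGroup (Fin s × Fin t) ℂ)
    (G : Matrix (Fin s × Fin t) (PurifIndex m g d f κ) ℂ) (x : Fin n) :
    padAmplitude (keyIsometry U * G) x * (padAmplitude (keyIsometry U * G) x).conjTranspose
      = Matrix.single x x (1 : ℂ) ⊗ₖ (padEve (n := n) G * (padEve (n := n) G).conjTranspose) := by
  ext ⟨y, e, l⟩ ⟨y', e', l'⟩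
  rw [Matrix.kroneckerMap_apply, Matrix.mul_apply, Matrix.mul_apply]
  simp only [Matrix.conjTranspose_apply, padAmplitude_keyIsometry_apply]
  by_cases hy : y = x
  swap
  · rw [Matrix.single_apply_of_ne _ _ _ _ _ (fun h => hy h.1.symm)]
    simp only [if_neg hy, zero_mul, Finset.sum_const_zero]
  by_cases hy' : y' = x
  swap
  · rw [Matrix.single_apply_of_ne _ _ _ _ _ (fun h => hy' h.2.symm)]
    simp only [if_neg hy', star_zero, mul_zero, zero_mul, Finset.sum_const_zero]
  rw [hy, hy', Matrix.single_apply_same, one_mul]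
  simp only [if_true]
  by_cases hl : l = l'
  swap
  · trans 0
    · refine Finset.sum_eq_zero fun q _ => ?_
      by_cases h : l = q.2.1
      · rw [if_neg (c := l' = q.2.1) fun h' => hl (h.trans h'.symm), star_zero, mul_zero]
      · rw [if_neg h, zero_mul]
    · refine (Finset.sum_eq_zero fun q _ => ?_).symm
      simp only [padEve, Matrix.of_apply]
      by_cases h : l = q.2.1
      · rw [if_neg (c := l' = q.2.1) fun h' => hl (h.trans h'.symm), star_zero, mul_zero]
      · rw [if_neg h, zero_mul]
  subst hl
  set W := U ((finProdFinEquiv.symm l).2 - x)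
  simp only [padEve, Matrix.of_apply]
  have h1 : ∀ v w r, ∑ p, (W * G) p (((finProdFinEquiv.symm l).1, (v, (e, w))), r)
      * star ((W * G) p (((finProdFinEquiv.symm l).1, (v, (e', w))), r))
      = ∑ p, G p (((finProdFinEquiv.symm l).1, (v, (e, w))), r)
        * star (G p (((finProdFinEquiv.symm l).1, (v, (e', w))), r)) := fun v w r =>
    sum_unitary_mul (hU _) _ _ _
  trans ∑ v, ∑ w, ∑ r, ((√(n : ℝ) : ℝ) : ℂ)⁻¹ * star ((√(n : ℝ) : ℝ) : ℂ)⁻¹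
      * ∑ p, (W * G) p (((finProdFinEquiv.symm l).1, (v, (e, w))), r)
      * star ((W * G) p (((finProdFinEquiv.symm l).1, (v, (e', w))), r))
  · rw [Fintype.sum_prod_type]
    simp_rw [Fintype.sum_prod_type (α₁ := Fin n) (α₂ := (Fin s × κ) × Fin f),
      Fintype.sum_prod_type (α₁ := Fin s × κ) (α₂ := Fin f),
      Fintype.sum_prod_type (α₁ := Fin s) (α₂ := κ),
      Fintype.sum_prod_type (α₁ := Fin (m * n)),
      Fintype.sum_prod_type (α₁ := Fin n × Fin t) (α₂ := Fin g),
      Fintype.sum_prod_type (α₁ := Fin n) (α₂ := Fin t)]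
    simp only [apply_ite star, star_zero, star_mul', ite_mul, zero_mul, mul_ite, mul_zero,
      Finset.sum_ite_irrel, Finset.sum_const_zero, Finset.sum_ite_eq, Finset.mem_univ, if_true,
      Finset.mul_sum, ← Fintype.sum_prod_type']
    refine Fintype.sum_equiv
      ({ toFun := fun ⟨α, r, w, β, v⟩ => (v, w, r, (α, β))
         invFun := fun ⟨v, w, r, α, β⟩ => (α, r, w, β, v)
         left_inv := fun _ => rfl
         right_inv := fun _ => rfl } :
        Fin s × κ × Fin f × Fin t × Fin g ≃ Fin g × Fin f × κ × Fin s × Fin t) _ _ fun q => ?_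
    simp only [Equiv.coe_fn_mk]
    ring
  · simp only [h1]
    simp_rw [Fintype.sum_prod_type (α₁ := Fin s × Fin t),
      Fintype.sum_prod_type (α₁ := Fin (m * n)),
      Fintype.sum_prod_type (α₁ := Fin g × Fin f) (α₂ := κ),
      Fintype.sum_prod_type (α₁ := Fin g) (α₂ := Fin f)]
    simp only [apply_ite star, star_zero, star_mul', ite_mul, zero_mul, mul_ite, mul_zero,
      Finset.sum_ite_irrel, Finset.sum_const_zero, Finset.sum_ite_eq, Finset.mem_univ, if_true,
      Finset.mul_sum, ← Fintype.sum_prod_type']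
    refine Fintype.sum_equiv
      ({ toFun := fun ⟨v, w, r, p⟩ => (p, v, w, r)
         invFun := fun ⟨p, v, w, r⟩ => (v, w, r, p)
         left_inv := fun _ => rfl
         right_inv := fun _ => rfl } :
        Fin g × Fin f × κ × Fin s × Fin t ≃ (Fin s × Fin t) × Fin g × Fin f × κ) _ _ fun q => ?_
    simp only [Equiv.coe_fn_mk]
    ring

/-- The factor n^(-1/2) in the amplitude makes the n ciphertexts equiprobable, independently of the
rest. -/
theorem isState_padEve [NeZero n] {G : Matrix (Fin s × Fin t) (PurifIndex m g d f κ) ℂ}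
    (hG : (G * G.conjTranspose).trace = 1) :
    IsState (padEve (n := n) G * (padEve (n := n) G).conjTranspose) := by
  refine ⟨Matrix.posSemidef_self_mul_conjTranspose _, ?_⟩
  rw [Matrix.trace_mul_comm] at hG ⊢
  rw [trace_conjTranspose_mul] at hG ⊢
  have h1 : ∀ (l : Fin (m * n)) (e : Fin d), ∑ q, star (padEve (n := n) G (e, l) q)
      * padEve (n := n) G (e, l) q
      = 1 / (n : ℂ) * ∑ p, ∑ v, ∑ w, ∑ r,
        star (G p (((finProdFinEquiv.symm l).1, (v, (e, w))), r))
        * G p (((finProdFinEquiv.symm l).1, (v, (e, w))), r) := by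
    intro l e
    simp_rw [← inv_sqrt_mul_inv_sqrt n, Fintype.sum_prod_type (α₁ := Fin s × Fin t),
      Fintype.sum_prod_type (α₁ := Fin (m * n)),
      Fintype.sum_prod_type (α₁ := Fin g × Fin f) (α₂ := κ),
      Fintype.sum_prod_type (α₁ := Fin g) (α₂ := Fin f)]
    simp only [padEve, Matrix.of_apply, apply_ite star, star_zero, star_mul', ite_mul, zero_mul,
      mul_ite, mul_zero, Finset.sum_ite_irrel, Finset.sum_const_zero, Finset.sum_ite_eq,
      Finset.mem_univ, if_true, Finset.mul_sum]
    refine Finset.sum_congr rfl fun p _ => Finset.sum_congr rfl fun v _ =>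
      Finset.sum_congr rfl fun w _ => Finset.sum_congr rfl fun r _ => ?_
    ring
  have hn : (n : ℂ) ≠ 0 := Nat.cast_ne_zero.2 (NeZero.ne n)
  have h2 : ∀ e : Fin d, (∑ l : Fin (m * n), 1 / (n : ℂ) * ∑ p, ∑ v, ∑ w, ∑ r,
        star (G p (((finProdFinEquiv.symm l).1, (v, (e, w))), r))
        * G p (((finProdFinEquiv.symm l).1, (v, (e, w))), r))
      = ∑ l, ∑ p, ∑ v, ∑ w, ∑ r,
        star (G p ((l, (v, (e, w))), r)) * G p ((l, (v, (e, w))), r) := by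
    intro e
    refine (sum_finProd fun lc : Fin m × Fin n => 1 / (n : ℂ) * ∑ p, ∑ v, ∑ w, ∑ r,
        star (G p ((lc.1, (v, (e, w))), r)) * G p ((lc.1, (v, (e, w))), r)).trans ?_
    simp only [Finset.sum_const, Finset.card_univ, Fintype.card_fin, nsmul_eq_mul, ← mul_assoc,
      mul_one_div_cancel hn, one_mul]
  rw [← hG, Fintype.sum_prod_type]
  simp only [h1, h2]
  simp only [← Fintype.sum_prod_type']
  exact Fintype.sum_equiv
    ({ toFun := fun ⟨e, l, p, v, w, r⟩ => (p, ((l, v, e, w), r))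
       invFun := fun ⟨p, ⟨⟨l, v, e, w⟩, r⟩⟩ => (e, l, p, v, w, r)
       left_inv := fun _ => rfl
       right_inv := fun _ => rfl } :
      Fin d × Fin m × (Fin s × Fin t) × Fin g × Fin f × κ ≃
        (Fin s × Fin t) × PurifIndex m g d f κ) _ _ fun q => rfl

end OneTimePad

/-- An isometry embedding a system into a larger one. -/
theorem exists_mul_conjTranspose_eq_one {ι κ : Type*} [Fintype ι] [Fintype κ] [DecidableEq ι]
    [DecidableEq κ] (h : Fintype.card ι ≤ Fintype.card κ) :
    ∃ J : Matrix ι κ ℂ, J * J.conjTranspose = 1 := by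
  obtain ⟨emb⟩ := Function.Embedding.nonempty_of_card_le h
  refine ⟨Matrix.of fun i k => if k = emb i then 1 else 0, ?_⟩
  ext i j
  simp [Matrix.mul_apply, Matrix.one_apply, apply_ite (starRingEnd ℂ), emb.injective.eq_iff,
    eq_comm]

theorem mul_self_mul_conjTranspose {ι κ l : Type*} [Fintype ι] [Fintype κ] (K : Matrix l ι ℂ)
    (T : Matrix ι κ ℂ) :
    K * (T * T.conjTranspose) * K.conjTranspose = (K * T) * (K * T).conjTranspose := by
  simp only [Matrix.conjTranspose_mul, Matrix.mul_assoc]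

theorem nonempty_of_trace_eq_one {ι : Type*} [Fintype ι] {ρ : Matrix ι ι ℂ} (h : ρ.trace = 1) :
    Nonempty ι := by
  by_contra h'
  rw [not_nonempty_iff] at h'
  simp [Matrix.trace] at h

/-- The superchannel is built from the key protocol alone, so it does not depend on V. For each V,
Uhlmann's theorem gives a purification of the private state with optimal overlap with the real one.
The pad carries both to the communication task with the same overlap, which bounds the fidelity
there from below. -/
theorem privateAchievable_of_keyAchievable {a b : Type*} [Fintype a] [DecidableEq a] [Fintype b]
    [DecidableEq b] {N : OpMap a b} (hN : IsChannel N) {ε : ℝ} {n : ℕ} (hn : 1 ≤ n)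
    (h : KeyAchievable N ε n) : PrivateAchievable N ε n := by
  have : NeZero n := ⟨by omega⟩
  obtain ⟨s, t, c, m, ψ, Θ, γ, hψ, ⟨τ, U, hτ, hU, hγ⟩, hF⟩ := h
  -- The extra `s * t` Kraus operators make the purifying system at least as large as the shield, so
  -- that it can purify τ.
  obtain ⟨E, D, hE, hD, hE1, hD1⟩ := Θ.exists_kraus
    (s := Fintype.card (Fin c × a) + s * t) (Nat.le_add_right _ _)
  set Ψ := CFC.sqrt ψ with hΨ
  have hψΨ : ψ = Ψ * Ψ.conjTranspose := exists_purification hψ.1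
  have hΨ1 : (Ψ.conjTranspose * Ψ).trace = 1 := by
    rw [Matrix.trace_mul_comm, ← hψΨ, hψ.2]
  refine ⟨m * n, padSuperchannel E Ψ D hE1 hΨ1 hD1, isClassical_padSuperchannel _ _ _ _ _ _,
    fun d V hV => ?_⟩
  set S := krausPurification (fun q : Fin m × (Fin (Fintype.card (b × (Fin n × Fin t))) ×
    (Fin d × Fin (Fintype.card (Fin c × a) + s * t))) =>
    D q.1 q.2.1 * (envOp V q.2.2.1 * E q.1 q.2.2.2)) Ψ with hS
  have hω : actSnd (Θ.apply N) ψ = S * S.conjTranspose := by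
    rw [hV.eq_krausMap, OneWayLOCC.apply_eq_krausMap hE hD, hψΨ, actSnd_krausMap]
  have hω1 : (S * S.conjTranspose).trace = 1 := by
    rw [← hω, hψΨ]
    exact ((Θ.isChannel_apply hN).isState_actSnd (hψΨ ▸ hψ)).2
  have hne : Nonempty (PurifIndex m (Fintype.card (b × (Fin n × Fin t))) d
      (Fintype.card (Fin c × a) + s * t) ((Fin n × Fin s) × Fin c)) := by
    rw [Matrix.trace_mul_comm] at hω1
    exact nonempty_of_trace_eq_one hω1
  have hcard : Fintype.card (Fin s × Fin t) ≤ Fintype.card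
      (PurifIndex m (Fintype.card (b × (Fin n × Fin t))) d
      (Fintype.card (Fin c × a) + s * t) ((Fin n × Fin s) × Fin c)) := by
    obtain ⟨⟨⟨l, v, e, w⟩, r⟩⟩ := hne
    refine le_trans ?_ (Fintype.card_le_of_injective
      (fun w' : Fin (Fintype.card (Fin c × a) + s * t) => (((l, (v, (e, w'))), r) :
      (PurifIndex m (Fintype.card (b × (Fin n × Fin t))) d
      (Fintype.card (Fin c × a) + s * t) ((Fin n × Fin s) × Fin c)))) ?_)
    · simp
    · intro w₁ w₂ h
      simpa using h
  obtain ⟨J, hJ⟩ := exists_mul_conjTranspose_eq_one hcard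
  have hτJ : (CFC.sqrt τ * J) * (CFC.sqrt τ * J).conjTranspose = τ := by
    rw [Matrix.conjTranspose_mul, Matrix.mul_assoc, ← Matrix.mul_assoc J, hJ, Matrix.one_mul]
    exact (exists_purification hτ.1).symm
  have hγR : γ = (keyIsometry U * (CFC.sqrt τ * J))
      * (keyIsometry U * (CFC.sqrt τ * J)).conjTranspose := by
    rw [hγ, privateState_eq, ← mul_self_mul_conjTranspose, hτJ]
  obtain ⟨W, hW, hSR⟩ := exists_unitary_trace_eq_sqrt_fidelity S
    (keyIsometry U * (CFC.sqrt τ * J))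
  rw [← hω, ← hγR] at hSR
  -- Uhlmann's unitary is absorbed into the purification of τ. It acts on the purifying side, so G
  -- is still a factor of τ, but it fixes the eavesdropper state used as σ.
  set G := CFC.sqrt τ * J * W with hG
  have hGτ : G * G.conjTranspose = τ := by
    rw [hG, Matrix.conjTranspose_mul, Matrix.mul_assoc, ← Matrix.mul_assoc W,
      show W * W.conjTranspose = 1 from Matrix.mem_unitaryGroup_iff.1 hW, Matrix.one_mul, hτJ]
  refine privateError_le hn _ V (isState_padEve (G := G) (by rw [hGτ, hτ.2])) fun x => ?_
  rw [receiverEveState_eq (E := padEnc E Ψ) (D := padDec D) (fun l => rfl) (fun l => rfl),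
    eveAmplitude_pad, ← padAmplitude_keyIsometry_mul_conjTranspose hU]
  refine hF.trans (le_trans (le_of_eq ?_) (norm_trace_sq_le_fidelity _ _))
  rw [trace_padAmplitude, ← norm_star, ← Matrix.trace_conjTranspose, Matrix.conjTranspose_mul,
    Matrix.conjTranspose_conjTranspose, ← hS, hG, ← Matrix.mul_assoc (keyIsometry U), hSR, Complex.norm_real,
    Real.norm_eq_abs, sq_abs, Real.sq_sqrt (fidelity_nonneg _ _)]


/-! ## Key distillation from private communication -/

/-! ### Amplitudes flagged by the message, and an optimal ideal eavesdropper -/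

section Flag

variable {n : ℕ} {y w : Type*} [Fintype y] [Fintype w] [DecidableEq y] [DecidableEq w]

/-- The amplitude `|x⟩ ⊗ A`. -/
def flagged (x : Fin n) (A : Matrix y w ℂ) : Matrix (Fin n × y) w ℂ :=
  Matrix.of fun p q => if p.1 = x then A p.2 q else 0

theorem flagged_mul (x : Fin n) (A : Matrix y w ℂ) (U : Matrix w w ℂ) :
    flagged x A * U = flagged x (A * U) := by
  ext p q
  simp only [flagged, Matrix.mul_apply, Matrix.of_apply]
  split_ifs <;> simp

theorem flagged_mul_conjTranspose (x : Fin n) (A : Matrix y w ℂ) :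
    flagged x A * (flagged x A).conjTranspose
      = Matrix.single x x (1 : ℂ) ⊗ₖ (A * A.conjTranspose) := by
  ext ⟨i, p⟩ ⟨j, q⟩
  rw [Matrix.kroneckerMap_apply, Matrix.mul_apply, Matrix.mul_apply, Matrix.single_apply]
  simp only [flagged, Matrix.of_apply, Matrix.conjTranspose_apply]
  by_cases hi : i = x <;> by_cases hj : j = x <;> simp [hi, hj, eq_comm (a := x)]

theorem trace_conjTranspose_mul_flagged (x : Fin n) (S : Matrix (Fin n × y) w ℂ)
    (A : Matrix y w ℂ) :
    (S.conjTranspose * flagged x A).trace = ∑ p, ∑ q, star (S (x, p) q) * A p q := by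
  rw [trace_conjTranspose_mul, Fintype.sum_prod_type, Finset.sum_eq_single x]
  · simp [flagged]
  · intro i _ hi
    simp [flagged, hi]
  · simp

theorem isCompact_entries_le_one (y w : Type*) :
    IsCompact {A : Matrix y w ℂ | ∀ i j, ‖A i j‖ ≤ 1} := by
  have h : IsCompact (Set.pi Set.univ fun _ : y => Set.pi Set.univ fun _ : w =>
      Metric.closedBall (0 : ℂ) 1) :=
    isCompact_univ_pi fun _ => isCompact_univ_pi fun _ => isCompact_closedBall _ _
  change IsCompact {A : y → w → ℂ | ∀ i j, ‖A i j‖ ≤ 1}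
  convert h using 1
  ext A
  simp [Set.mem_pi]

/-- The optimum over the purifications of the ideal eavesdropper is attained. -/
theorem exists_optimal_purification (S : Fin n → Matrix (Fin n × y) w ℂ) {η : ℝ}
    (h : ∀ δ > 0, ∃ (A : Matrix y w ℂ) (U : Fin n → Matrix w w ℂ),
      (A * A.conjTranspose).trace = 1 ∧ (∀ x, U x ∈ Matrix.unitaryGroup w ℂ) ∧
      ∀ x, √(η - δ) ≤ ((S x).conjTranspose * flagged x (A * U x)).trace.re) :
    ∃ (A : Matrix y w ℂ) (U : Fin n → Matrix w w ℂ),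
      (A * A.conjTranspose).trace = 1 ∧ (∀ x, U x ∈ Matrix.unitaryGroup w ℂ) ∧
      ∀ x, √η ≤ ((S x).conjTranspose * flagged x (A * U x)).trace.re := by
  -- The private error is an infimum over σ, so only near-optimal data are given, here with δ =
  -- 1/(k+1). One A is shared by all messages while the unitary depends on the message.
  have h' : ∀ k : ℕ, ∃ p : Matrix y w ℂ × (Fin n → Matrix w w ℂ),
      (p.1 * p.1.conjTranspose).trace = 1 ∧ (∀ x, p.2 x ∈ Matrix.unitaryGroup w ℂ) ∧
      ∀ x, √(η - 1 / ((k : ℝ) + 1))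
        ≤ ((S x).conjTranspose * flagged x (p.1 * p.2 x)).trace.re := fun k => by
    obtain ⟨A, U, hAU⟩ := h (1 / ((k : ℝ) + 1)) (by positivity)
    exact ⟨(A, U), hAU⟩
  choose p hp1 hp2 hp3 using h'
  -- Amplitudes of unit Hilbert–Schmidt norm and unitaries have entries of modulus at most 1, so a
  -- subsequence converges. Normalisation, unitarity and the overlap inequalities pass to the limit.
  have hcomp : IsCompact ({A : Matrix y w ℂ | ∀ i j, ‖A i j‖ ≤ 1} ×ˢ
      Set.pi Set.univ fun _ : Fin n => {A : Matrix w w ℂ | ∀ i j, ‖A i j‖ ≤ 1}) :=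
    (isCompact_entries_le_one y w).prod
      (isCompact_univ_pi fun _ => isCompact_entries_le_one w w)
  have hmem : ∀ k, p k ∈ ({A : Matrix y w ℂ | ∀ i j, ‖A i j‖ ≤ 1} ×ˢ
      Set.pi Set.univ fun _ : Fin n => {A : Matrix w w ℂ | ∀ i j, ‖A i j‖ ≤ 1}) := by
    intro k
    refine ⟨fun i j => ?_, fun x _ i j => entry_norm_bound_of_unitary (hp2 k x) i j⟩
    have h1 := hp1 k
    rw [Matrix.trace_mul_comm, trace_conjTranspose_mul] at h1
    have h2 : ∑ i, ∑ j, ‖(p k).1 i j‖ ^ 2 = 1 := by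
      have := congrArg Complex.re h1
      simpa [Complex.re_sum, ← Complex.normSq_eq_conj_mul_self, Complex.normSq_eq_norm_sq,
        ← Complex.ofReal_pow] using this
    have h3 : ‖(p k).1 i j‖ ^ 2 ≤ 1 := by
      rw [← h2]
      exact (Finset.single_le_sum (f := fun j => ‖(p k).1 i j‖ ^ 2) (fun _ _ => by positivity)
        (Finset.mem_univ j)).trans (Finset.single_le_sum
          (f := fun i => ∑ j, ‖(p k).1 i j‖ ^ 2) (fun _ _ => by positivity) (Finset.mem_univ i))
    exact (sq_le_one_iff₀ (norm_nonneg _)).1 h3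
  have : FirstCountableTopology (Matrix y w ℂ) :=
    inferInstanceAs (FirstCountableTopology (y → w → ℂ))
  have : FirstCountableTopology (Matrix w w ℂ) :=
    inferInstanceAs (FirstCountableTopology (w → w → ℂ))
  obtain ⟨q, -, φ, hφ, hq⟩ := hcomp.tendsto_subseq hmem
  refine ⟨q.1, q.2, ?_, fun x => ?_, fun x => ?_⟩
  · have hc : Continuous fun r : Matrix y w ℂ × (Fin n → Matrix w w ℂ) =>
        (r.1 * r.1.conjTranspose).trace := by fun_prop
    refine tendsto_nhds_unique ((hc.tendsto q).comp hq) ?_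
    simp only [Function.comp_def, hp1]
    exact tendsto_const_nhds
  · rw [Matrix.mem_unitaryGroup_iff]
    have hc : Continuous fun r : Matrix y w ℂ × (Fin n → Matrix w w ℂ) =>
        r.2 x * star (r.2 x) := by
      simp only [Matrix.star_eq_conjTranspose]
      fun_prop
    refine tendsto_nhds_unique ((hc.tendsto q).comp hq) ?_
    simp only [Function.comp_def, fun k => Matrix.mem_unitaryGroup_iff.1 (hp2 k x)]
    exact tendsto_const_nhds
  · have hc : Continuous fun r : Matrix y w ℂ × (Fin n → Matrix w w ℂ) =>
        ((S x).conjTranspose * flagged x (r.1 * r.2 x)).trace.re := by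
      simp only [trace_conjTranspose_mul_flagged]
      refine Complex.continuous_re.comp (continuous_finsetSum _ fun i _ =>
        continuous_finsetSum _ fun j _ => continuous_const.mul ?_)
      exact (show Continuous fun r : Matrix y w ℂ × (Fin n → Matrix w w ℂ) => r.1 * r.2 x by
        fun_prop).matrix_elem i j
    have hl : Filter.Tendsto (fun k => √(η - 1 / (((φ k : ℕ) : ℝ) + 1))) Filter.atTop
        (nhds √η) := by
      have h1 : Filter.Tendsto (fun k : ℕ => √(η - 1 / ((k : ℝ) + 1))) Filter.atTop
          (nhds √(η - 0)) :=
        (Real.continuous_sqrt.tendsto _).comp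
          (tendsto_const_nhds.sub tendsto_one_div_add_atTop_nhds_zero_nat)
      rw [sub_zero] at h1
      exact h1.comp hφ.tendsto_atTop
    exact le_of_tendsto_of_tendsto' hl ((hc.tendsto q).comp hq) fun k => hp3 _ x

end Flag

/-! ### The coherent protocol that distils key from private communication -/

section CoherentKey

variable {a b : Type*} [Fintype a] [Fintype b] [DecidableEq a] [DecidableEq b] {n m s g : ℕ}

/-- The state prepared by the sender: a uniform superposition of messages, with the encoder
applied coherently. -/
noncomputable def keyPrep (E : Fin m → Fin s → Matrix a (Fin n) ℂ) :
    Matrix ((Fin n × Fin s) × Fin (Fintype.card (Fin m × a))) Unit ℂ :=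
  Matrix.of fun p _ => ((√(n : ℝ) : ℝ) : ℂ)⁻¹ *
    E ((Fintype.equivFin (Fin m × a)).symm p.2).1 p.1.2
      ((Fintype.equivFin (Fin m × a)).symm p.2).2 p.1.1

/-- The measurement of the classical message. -/
noncomputable def keyEnc (l : Fin m) (_ : Unit) :
    Matrix a (Fin (Fintype.card (Fin m × a))) ℂ :=
  Matrix.of fun i z => if (Fintype.equivFin (Fin m × a)).symm z = (l, i) then 1 else 0

/-- The coherent decoder. -/
def keyDec (D : Fin m → Fin g → Matrix (Fin n) b ℂ) (l : Fin m) (_ : Unit) :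
    Matrix (Fin n × Fin (m * g)) b ℂ :=
  Matrix.of fun p j => if (finProdFinEquiv.symm p.2).1 = l then
    D l (finProdFinEquiv.symm p.2).2 p.1 j else 0

theorem isState_keyPrep (hn : 1 ≤ n) {E : Fin m → Fin s → Matrix a (Fin n) ℂ}
    (hE : ∑ l, ∑ f, (E l f).conjTranspose * E l f = 1) :
    IsState (keyPrep E * (keyPrep E).conjTranspose) := by
  refine ⟨Matrix.posSemidef_self_mul_conjTranspose _, ?_⟩
  rw [Matrix.trace_mul_comm, trace_conjTranspose_mul]
  simp only [Fintype.sum_prod_type, Finset.univ_unique, Finset.sum_singleton]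
  have h1 : ∀ (i : Fin n) (f : Fin s), ∑ z, star (keyPrep E ((i, f), z) default)
      * keyPrep E ((i, f), z) default
      = 1 / (n : ℂ) * ∑ l, ((E l f).conjTranspose * E l f) i i := by
    intro i f
    refine ((Fintype.equivFin (Fin m × a)).symm.sum_comp fun z =>
      star (((√(n : ℝ) : ℝ) : ℂ)⁻¹ * E z.1 f z.2 i)
        * (((√(n : ℝ) : ℝ) : ℂ)⁻¹ * E z.1 f z.2 i)).trans ?_
    rw [Fintype.sum_prod_type, ← inv_sqrt_mul_inv_sqrt n, Finset.mul_sum]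
    refine Finset.sum_congr rfl fun l _ => ?_
    rw [Matrix.mul_apply, Finset.mul_sum]
    refine Finset.sum_congr rfl fun j _ => ?_
    rw [star_mul', Matrix.conjTranspose_apply]
    ring
  have h2 : ∀ i : Fin n, ∑ f, ∑ l, ((E l f).conjTranspose * E l f) i i = 1 := by
    intro i
    have := congrFun (congrFun hE i) i
    simp only [Matrix.sum_apply, Matrix.one_apply_eq] at this
    rw [Finset.sum_comm, this]
  simp only [h1, ← Finset.mul_sum, h2]
  rw [Finset.sum_const, Finset.card_univ, Fintype.card_fin, nsmul_eq_mul, mul_one,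
    one_div_mul_cancel (Nat.cast_ne_zero.2 (by omega))]

theorem sum_keyEnc :
    ∑ l : Fin m, ∑ f, (keyEnc (a := a) l f).conjTranspose * keyEnc (a := a) l f = 1 := by
  ext z z'
  simp only [Matrix.sum_apply, Finset.univ_unique, Finset.sum_singleton]
  have h1 : ∀ l : Fin m, ((keyEnc (a := a) l default).conjTranspose * keyEnc (a := a) l default) z z'
      = ∑ i, if (Fintype.equivFin (Fin m × a)).symm z = (l, i) then
        if (Fintype.equivFin (Fin m × a)).symm z' = (l, i) then (1 : ℂ) else 0 else 0 := by
    intro l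
    rw [Matrix.mul_apply]
    refine Finset.sum_congr rfl fun i _ => ?_
    simp only [keyEnc, Matrix.conjTranspose_apply, Matrix.of_apply]
    split_ifs <;> simp
  simp only [h1]
  rw [← Fintype.sum_prod_type' (f := fun l i =>
    if (Fintype.equivFin (Fin m × a)).symm z = (l, i) then
        if (Fintype.equivFin (Fin m × a)).symm z' = (l, i) then (1 : ℂ) else 0 else 0)]
  simp [Matrix.one_apply, eq_comm]

theorem sum_keyDec {D : Fin m → Fin g → Matrix (Fin n) b ℂ}
    (hD : ∀ l, ∑ q, (D l q).conjTranspose * D l q = 1) (l : Fin m) :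
    ∑ f, (keyDec D l f).conjTranspose * keyDec D l f = 1 := by
  rw [← hD l]
  ext j j'
  simp only [Matrix.sum_apply, Finset.univ_unique, Finset.sum_singleton]
  rw [Matrix.mul_apply, Fintype.sum_prod_type, Finset.sum_comm]
  simp only [Matrix.mul_apply]
  refine (sum_finProd fun lc : Fin m × Fin g => ∑ i : Fin n,
    star (if lc.1 = l then D l lc.2 i j else 0) * (if lc.1 = l then D l lc.2 i j' else 0)).trans ?_
  simp [apply_ite (starRingEnd ℂ)]

/-- The roles of the systems are exchanged. The Kraus indices of encoder and decoder, which purify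
the communication protocol, become the shields; the eavesdropper's systems (e, l) purify the key
protocol. Apart from n^(-1/2) the amplitudes are identical. -/
theorem krausPurification_key {d : ℕ} (E : Fin m → Fin s → Matrix a (Fin n) ℂ)
    (D : Fin m → Fin g → Matrix (Fin n) b ℂ) (V : Matrix (b × Fin d) a ℂ) (i : Fin n) (f : Fin s)
    (j : Fin n) (β : Fin (m * g)) (l : Fin m) (e : Fin d) :
    krausPurification (fun q : Fin m × (Unit × (Fin d × Unit)) =>
        keyDec D q.1 q.2.1 * (envOp V q.2.2.1 * keyEnc (a := a) q.1 q.2.2.2)) (keyPrep E)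
        ((i, f), (j, β)) ((l, ((), (e, ()))), ())
      = ((√(n : ℝ) : ℝ) : ℂ)⁻¹
        * eveAmplitude E D V i (j, (e, l)) (f, finProdFinEquiv.symm β) := by
  have h1 : ∀ i' : b, ∑ z, (envOp V e * keyEnc (a := a) l ()) i' z * keyPrep E ((i, f), z) ()
      = ((√(n : ℝ) : ℝ) : ℂ)⁻¹ * (envOp V e * E l f) i' i := by
    intro i'
    have h2 : ∀ z, (envOp V e * keyEnc (a := a) l ()) i' z
        = if ((Fintype.equivFin (Fin m × a)).symm z).1 = l then
          envOp V e i' ((Fintype.equivFin (Fin m × a)).symm z).2 else 0 := by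
      intro z
      rw [Matrix.mul_apply]
      generalize hz : (Fintype.equivFin (Fin m × a)).symm z = z'
      simp only [keyEnc, Matrix.of_apply, hz, Prod.ext_iff, ite_and, mul_ite, mul_one, mul_zero,
        Finset.sum_ite_irrel, Finset.sum_const_zero, Finset.sum_ite_eq, Finset.mem_univ, if_true]
    simp only [h2]
    refine ((Fintype.equivFin (Fin m × a)).symm.sum_comp fun z : Fin m × a =>
      (if z.1 = l then envOp V e i' z.2 else 0)
        * (((√(n : ℝ) : ℝ) : ℂ)⁻¹ * E z.1 f z.2 i)).trans ?_
    rw [Fintype.sum_prod_type, Finset.sum_eq_single l, Matrix.mul_apply, Finset.mul_sum]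
    · refine Finset.sum_congr rfl fun k _ => ?_
      rw [if_pos rfl]
      ring
    · intro l' _ hl'
      simp [hl']
    · simp
  simp only [krausPurification, Matrix.of_apply, eveAmplitude]
  simp only [Matrix.mul_apply (M := keyDec D l ()), Finset.sum_mul]
  rw [Finset.sum_comm]
  simp only [mul_assoc, ← Finset.mul_sum, h1]
  by_cases h : (finProdFinEquiv.symm β).1 = l
  · rw [if_pos h.symm, Matrix.mul_apply, Finset.mul_sum]
    refine Finset.sum_congr rfl fun k _ => ?_
    simp only [keyDec, Matrix.of_apply, if_pos h]
    ring
  · rw [if_neg (Ne.symm h), mul_zero]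
    refine Finset.sum_eq_zero fun k _ => ?_
    simp only [keyDec, Matrix.of_apply, if_neg h, zero_mul]

/-- A unitary acting on the purification of the eavesdropper's ideal state acts on the shield
systems here, as its transpose because rows and columns change roles. A message-dependent unitary is
therefore a twisting, and the overlap with the private state is the average over messages. -/
theorem trace_krausPurification_key {d : ℕ} (E : Fin m → Fin s → Matrix a (Fin n) ℂ)
    (D : Fin m → Fin g → Matrix (Fin n) b ℂ) (V : Matrix (b × Fin d) a ℂ)
    (A : Matrix (Fin d × Fin m) (Fin s × (Fin m × Fin g)) ℂ)
    (U : Fin n → Matrix (Fin s × (Fin m × Fin g)) (Fin s × (Fin m × Fin g)) ℂ) :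
    ((krausPurification (fun q : Fin m × (Unit × (Fin d × Unit)) =>
        keyDec D q.1 q.2.1 * (envOp V q.2.2.1 * keyEnc (a := a) q.1 q.2.2.2))
        (keyPrep E)).conjTranspose
      * (keyIsometry (fun i => (U i).transpose.submatrix
          ((Equiv.refl (Fin s)).prodCongr finProdFinEquiv.symm)
          ((Equiv.refl (Fin s)).prodCongr finProdFinEquiv.symm))
        * Matrix.of fun w q => A (q.1.2.2.1, q.1.1)
          ((Equiv.refl (Fin s)).prodCongr finProdFinEquiv.symm w))).trace
      = 1 / (n : ℂ) * ∑ i,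
        ((eveAmplitude E D V i).conjTranspose * flagged i (A * U i)).trace := by
  rw [trace_conjTranspose_mul]
  have h1 : ∀ (i : Fin n) (w : Fin s × Fin (m * g))
      (q : (Fin m × (Unit × (Fin d × Unit))) × Unit),
      ((U i).transpose.submatrix ((Equiv.refl (Fin s)).prodCongr finProdFinEquiv.symm)
          ((Equiv.refl (Fin s)).prodCongr finProdFinEquiv.symm)
        * Matrix.of fun w q => A (q.1.2.2.1, q.1.1)
          ((Equiv.refl (Fin s)).prodCongr finProdFinEquiv.symm w)) w q
      = (A * U i) (q.1.2.2.1, q.1.1) (w.1, finProdFinEquiv.symm w.2) := by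
    intro i w q
    rw [Matrix.mul_apply, Matrix.mul_apply]
    refine Eq.trans ?_ (((Equiv.refl (Fin s)).prodCongr finProdFinEquiv.symm).sum_comp fun w' =>
      A (q.1.2.2.1, q.1.1) w' * U i w' (w.1, finProdFinEquiv.symm w.2))
    exact Finset.sum_congr rfl fun w' _ => mul_comm _ _
  simp only [Fintype.sum_prod_type, Finset.univ_unique, Finset.sum_singleton, PUnit.default_eq_unit,
    krausPurification_key, keyIsometry_mul_apply, h1]
  simp only [mul_ite, mul_zero, Finset.sum_ite_irrel, Finset.sum_const_zero, Finset.sum_ite_eq,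
    Finset.mem_univ, if_true, trace_conjTranspose_mul_flagged, ← inv_sqrt_mul_inv_sqrt n,
    Finset.mul_sum]
  refine Finset.sum_congr rfl fun i _ => ?_
  simp only [← Fintype.sum_prod_type']
  refine Fintype.sum_equiv
    ({ toFun := fun ⟨f, β, l, e⟩ => ((e, l), (f, finProdFinEquiv.symm β))
       invFun := fun ⟨⟨e, l⟩, ⟨f, β⟩⟩ => (f, finProdFinEquiv β, l, e)
       left_inv := fun ⟨f, β, l, e⟩ => by simp only [Equiv.apply_symm_apply]
       right_inv := fun ⟨⟨e, l⟩, ⟨f, β⟩⟩ => by simp only [Equiv.symm_apply_apply] } :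
      Fin s × Fin (m * g) × Fin m × Fin d ≃
        (Fin d × Fin m) × (Fin s × (Fin m × Fin g))) _ _ fun q => ?_
  simp only [Equiv.coe_fn_mk, star_mul']
  ring

end CoherentKey

/-- Privacy provides one ideal eavesdropper state for all messages, and Uhlmann's theorem one
unitary per message with overlap at least √(1-ε). These unitaries twist a private state. Its overlap
with the coherent protocol's output is the mean of the individual overlaps, hence again at least
√(1-ε). -/
theorem keyAchievable_of_privateAchievable {a b : Type*} [Fintype a] [DecidableEq a] [Nonempty a]
    [Fintype b] [DecidableEq b] {N : OpMap a b} (hN : IsChannel N) {ε : ℝ} (hε : ε ≤ 1) {n : ℕ}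
    (hn : 1 ≤ n) (h : PrivateAchievable N ε n) : KeyAchievable N ε n := by
  obtain ⟨m, Θ, -, hΘ⟩ := h
  obtain ⟨d, V, hV⟩ := hN.exists_isIsometricExtension
  have hΘV := hΘ d V hV
  -- The extra `d * m` Kraus operators make the purifying system large enough to purify any state of
  -- the eavesdropper, who holds `Fin d × Fin m`.
  obtain ⟨E, D, hE, hD, hE1, hD1⟩ := Θ.exists_kraus
    (s := Fintype.card (Fin n × a) + d * m) (Nat.le_add_right _ _)
  have hbd : Nonempty (b × Fin d) := by
    by_contra h'
    rw [not_nonempty_iff] at h'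
    obtain ⟨i⟩ := ‹Nonempty a›
    have := congrFun (congrFun hV.1 i) i
    simp [Matrix.mul_apply] at this
  have hm : Nonempty (Fin m) := by
    by_contra h'
    rw [not_nonempty_iff] at h'
    have := congrFun (congrFun hE1 ⟨0, hn⟩) ⟨0, hn⟩
    simp at this
  obtain ⟨⟨j₀, e₀⟩⟩ := hbd
  obtain ⟨l₀⟩ := hm
  have hnn : Nonempty (Fin n) := ⟨⟨0, hn⟩⟩
  have hcard : Fintype.card (Fin d × Fin m) ≤ Fintype.card
      (Fin (Fintype.card (Fin n × a) + d * m) × (Fin m × Fin (Fintype.card (b × Fin n)))) := by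
    have hg : 0 < Fintype.card (b × Fin n) := Fintype.card_pos_iff.2 ⟨(j₀, hnn.some)⟩
    refine le_trans ?_ (Fintype.card_le_of_injective
      (fun w : Fin (Fintype.card (Fin n × a) + d * m) =>
        ((w, (l₀, ⟨0, hg⟩)) : Fin (Fintype.card (Fin n × a) + d * m) × (Fin m ×
          Fin (Fintype.card (b × Fin n))))) fun w₁ w₂ h => by simpa using h)
    simp
  obtain ⟨J, hJ⟩ := exists_mul_conjTranspose_eq_one hcard
  obtain ⟨A, U, hA, hU, hAU⟩ := exists_optimal_purification (eveAmplitude E D V) (η := 1 - ε) (by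
    intro δ hδ
    have : Nonempty {σ : Matrix (Fin d × Fin m) (Fin d × Fin m) ℂ // IsState σ} :=
      ⟨⟨_, isState_single (i := (e₀, l₀))⟩⟩
    obtain ⟨σ, hσ⟩ := exists_lt_of_ciInf_lt (lt_of_le_of_lt hΘV (lt_add_of_pos_right ε hδ))
    have hσJ : (CFC.sqrt σ.1 * J) * (CFC.sqrt σ.1 * J).conjTranspose = σ.1 := by
      rw [Matrix.conjTranspose_mul, Matrix.mul_assoc, ← Matrix.mul_assoc J, hJ, Matrix.one_mul]
      exact (exists_purification σ.2.1).symm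
    have hW : ∀ x, ∃ W ∈ Matrix.unitaryGroup (Fin (Fintype.card (Fin n × a) + d * m) × (Fin m ×
        Fin (Fintype.card (b × Fin n)))) ℂ, √(1 - ε - δ) ≤
        ((eveAmplitude E D V x).conjTranspose * flagged x (CFC.sqrt σ.1 * J * W)).trace.re := by
      intro x
      obtain ⟨W, hW, h1⟩ := exists_unitary_trace_eq_sqrt_fidelity (flagged x (CFC.sqrt σ.1 * J))
        (eveAmplitude E D V x)
      -- Uhlmann's unitary was obtained acting on the real amplitude. Its adjoint moves it to the
      -- ideal one, and the overlap is real, so conjugation does not change it.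
      refine ⟨star W, Unitary.star_mem hW, ?_⟩
      have h2 := le_ciSup (f := fun x => 1 - fidelity (Matrix.single x x (1 : ℂ) ⊗ₖ σ.1)
        (receiverEveState Θ V x)) (Set.finite_range _).bddAbove x
      have h3 : ((eveAmplitude E D V x).conjTranspose
          * flagged x (CFC.sqrt σ.1 * J * star W)).trace
          = star ((flagged x (CFC.sqrt σ.1 * J)).conjTranspose
            * (eveAmplitude E D V x * W)).trace := by
        rw [← flagged_mul, ← Matrix.mul_assoc, Matrix.trace_mul_comm,
          ← Matrix.trace_conjTranspose, Matrix.conjTranspose_mul, Matrix.conjTranspose_mul,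
          Matrix.conjTranspose_conjTranspose, Matrix.mul_assoc, Matrix.star_eq_conjTranspose]
      rw [h3, h1, flagged_mul_conjTranspose, hσJ, ← receiverEveState_eq hE hD, Complex.star_def,
        Complex.conj_ofReal, Complex.ofReal_re]
      exact Real.sqrt_le_sqrt (by linarith)
    choose W hW hWx using hW
    exact ⟨_, W, by rw [hσJ, σ.2.2], hW, hWx⟩)
  set ew := (Equiv.refl (Fin (Fintype.card (Fin n × a) + d * m))).prodCongr
    (finProdFinEquiv (m := m) (n := Fintype.card (b × Fin n))).symm with hew
  set T : Matrix _ ((Fin m × (Unit × (Fin d × Unit))) × Unit) ℂ :=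
    Matrix.of fun w q => A (q.1.2.2.1, q.1.1) (ew w) with hT
  have hT1 : (T * T.conjTranspose).trace = 1 := by
    rw [← hA, Matrix.trace_mul_comm, Matrix.trace_mul_comm A, trace_conjTranspose_mul,
      trace_conjTranspose_mul, Finset.sum_comm]
    refine Fintype.sum_equiv
      ({ toFun := fun q => (q.1.2.2.1, q.1.1)
         invFun := fun p => ((p.2, ((), (p.1, ()))), ())
         left_inv := fun _ => rfl
         right_inv := fun _ => rfl } :
        (Fin m × (Unit × (Fin d × Unit))) × Unit ≃ Fin d × Fin m) _ _ fun q => ?_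
    exact ew.sum_comp fun w => star (A (q.1.2.2.1, q.1.1) w) * A (q.1.2.2.1, q.1.1) w
  have hUk : ∀ i, (U i).transpose.submatrix ew ew ∈ Matrix.unitaryGroup _ ℂ := by
    intro i
    have h1 := Matrix.mem_unitaryGroup_iff'.1 (hU i)
    rw [Matrix.mem_unitaryGroup_iff, Matrix.star_eq_conjTranspose, Matrix.conjTranspose_submatrix,
      Matrix.submatrix_mul_equiv]
    rw [Matrix.star_eq_conjTranspose] at h1
    have h2 : (U i).transpose * (U i).transpose.conjTranspose
        = ((U i).conjTranspose * U i).transpose := by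
      rw [Matrix.transpose_mul]
      rfl
    rw [h2, h1, Matrix.transpose_one, Matrix.submatrix_one_equiv]
  refine ⟨_, _, _, m, _, OneWayLOCC.ofKraus keyEnc (keyDec D) sum_keyEnc (sum_keyDec hD1), _,
    isState_keyPrep hn hE1, ⟨T * T.conjTranspose, fun i => (U i).transpose.submatrix ew ew,
      ⟨Matrix.posSemidef_self_mul_conjTranspose _, hT1⟩, hUk, rfl⟩, ?_⟩
  rw [hV.eq_krausMap, OneWayLOCC.apply_eq_krausMap (E := keyEnc) (D := keyDec D) (fun _ => rfl)
    (fun _ => rfl), actSnd_krausMap, privateState_eq,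
    mul_self_mul_conjTranspose]
  refine le_trans ?_ (norm_trace_sq_le_fidelity _ _)
  rw [hT, hew, trace_krausPurification_key]
  have hn0 : (0 : ℝ) < n := by exact_mod_cast hn
  have h1 : √(1 - ε) ≤ (1 / (n : ℂ) * ∑ i,
      ((eveAmplitude E D V i).conjTranspose * flagged i (A * U i)).trace).re := by
    rw [show (1 / (n : ℂ)) = ((1 / (n : ℝ) : ℝ) : ℂ) by push_cast; rfl, Complex.re_ofReal_mul,
      Complex.re_sum]
    have h2 := Finset.card_nsmul_le_sum Finset.univ _ _ fun i _ => hAU i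
    rw [Finset.card_univ, Fintype.card_fin, nsmul_eq_mul] at h2
    rw [one_div, inv_mul_eq_div, le_div_iff₀ hn0]
    linarith
  calc 1 - ε = √(1 - ε) ^ 2 := (Real.sq_sqrt (by linarith)).symm
    _ ≤ _ := pow_le_pow_left₀ (Real.sqrt_nonneg _) (h1.trans (Complex.re_le_norm _)) 2

end PrivateCapacity

theorem theorem3 {A B : Type*} [Fintype A] [DecidableEq A] [Nonempty A] [Fintype B] [DecidableEq B]
    (N : PrivateCapacity.OpMap A B) (hN : PrivateCapacity.IsChannel N)
    (ε : ℝ) (hε : ε ∈ Set.Icc (0 : ℝ) 1) :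
    IsLUB (PrivateCapacity.sdpValues ε N) (PrivateCapacity.JminChannel ε N) ∧
    (ε < PrivateCapacity.JminChannel ε N →
      PrivateCapacity.privateCapacity N ε = PrivateCapacity.distillableKey N ε ∧
      PrivateCapacity.distillableKey N ε ≤
        ((PrivateCapacity.keyBound (PrivateCapacity.JminChannel ε N) ε : ℝ) : EReal)) := by
  refine ⟨PrivateCapacity.isLUB_sdpValues hN hε.1, fun hJ => ⟨?_,
    PrivateCapacity.distillableKey_le hN hε.1 hJ⟩⟩
  rw [PrivateCapacity.privateCapacity, PrivateCapacity.distillableKey]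
  congr 1
  ext r
  -- The two suprema agree because they range over the same set: each k is achievable for one task
  -- exactly when it is for the other.
  refine exists_congr fun k => and_congr_right fun hk => and_congr_left fun _ => ?_
  exact ⟨PrivateCapacity.keyAchievable_of_privateAchievable hN hε.2 hk,
    PrivateCapacity.privateAchievable_of_keyAchievable hN hk⟩
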